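/- Let $\hbar>0$ and let $\mathsf b\in\mathbb C$ satisfy $\operatorname{Re}\mathsf b>0$ and $(\mathsf b+\mathsf b^{-1})^2=\hbar^{-1}$ (that is, $\mathsf b>0$ or $|\mathsf b|=1$), and put $c_{\mathsf b}=\frac{i}{2}(\mathsf b+\mathsf b^{-1})$. For $|\operatorname{Im}z|<|\operatorname{Im}c_{\mathsf b}|$ let $$\Phi_{\mathsf b}(z)=\exp\left(\int_{C}\frac{e^{-2izw}\,dw}{4\sinh(w\mathsf b)\sinh(w/\mathsf b)\,w}\right)$$ be Faddeev's quantum dilogarithm, where $C$ is the real axis pushed into the upper half plane near the origin (equivalently, a line $\mathbb R+i\varepsilon$ with small $\varepsilon>0$). For real $a,c>0$ with $a+c<\frac12$ and real $s,t$, define $$\psi_{a,c}(t)=\frac{1}{\Phi_{\mathsf b}(t-2c_{\mathsf b}(a+c))}\,e^{-4\pi i c_{\mathsf b}a(t-c_{\mathsf b}(a+c))}\,e^{-\pi i c_{\mathsf b}^2(4(a-c)+1)/6},$$ $$\tilde\psi_{a,c}(s)=\int_{\mathbb R}\psi_{a,c}(t)e^{-2\pi i st}\,dt,\qquad \tilde\psi'_{a,c}(s)=e^{-\pi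 i s^2}\tilde\psi_{a,c}(s),$$ $$g_{a,c}(s,t)=\sum_{m\in\mathbb Z}\tilde\psi'_{a,c}(s+m)\,e^{i\pi t(s+2m)},\qquad \bar g_{a,c}(s,t)=\overline{g_{a,c}(s,t)}.$$ Let $a,b,c>0$ be real with $b=\frac12-a-c$. Then the integral for $\Phi_{\mathsf b}$ at the points $t-2c_{\mathsf b}(a+c)$, $t\in\mathbb R$, the integral for $\tilde\psi_{a,c}$ and the series for $g_{a,c}$ converge absolutely, and for all $x,y\in\mathbb R$ $$g_{a,c}(x,y)=\bar g_{a,b}(-x,\,y-x-\tfrac12)\,e^{\pi i x/2},$$ $$g_{a,c}(x,y)=e^{-\pi i/6}\,\bar g_{b,c}(x-y-\tfrac12,\,-y)\,e^{-\pi i y/2}.$$ -/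

import Mathlib

open MeasureTheory

/- Throughout, `β` is the quantum parameter (the letter b in sans serif), with
`(β + β⁻¹) ^ 2 = 1 / ħ`, whereas `a`, `b`, `c` are dihedral angles divided by `2π`. -/

/-- The constant `c_β = (i / 2) (β + β⁻¹)`. -/
noncomputable def dilogConst (β : ℂ) : ℂ :=
  Complex.I / 2 * (β + β⁻¹)

/-- The height of the integration line `ℝ + i ε` in the definition of the quantum dilogarithm.
For `Re β > 0` it lies strictly between `0` and `min (π Re β) (π Re β⁻¹)`, the least positive
imaginary part of a zero of `sinh (w β) sinh (w / β)`. Hence that line passes above the pole at the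
origin and below all the other poles in the upper half plane, so that it is the real axis pushed
into the upper half plane at the origin. -/
noncomputable def dilogHeight (β : ℂ) : ℝ :=
  Real.pi * β.re / (1 + ‖β‖ ^ 2)

/-- The integrand `exp (-2 i z w) / (4 sinh (w β) sinh (w / β) w)`. -/
noncomputable def dilogIntegrand (β z w : ℂ) : ℂ :=
  Complex.exp (-2 * Complex.I * z * w) /
    (4 * Complex.sinh (w * β) * Complex.sinh (w / β) * w)

/-- Faddeev's quantum dilogarithm `Φ_β (z)`, for `z` in the strip `|Im z| < |Im c_β|`. -/
noncomputable def faddeevDilog (β z : ℂ) : ℂ :=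
  Complex.exp (∫ u : ℝ, dilogIntegrand β z ((u : ℂ) + (dilogHeight β : ℂ) * Complex.I))

/-- The function `ψ_{a,c}`. -/
noncomputable def psiFun (β : ℂ) (a c t : ℝ) : ℂ :=
  (faddeevDilog β (t - 2 * dilogConst β * (a + c)))⁻¹ *
    Complex.exp (-4 * Real.pi * Complex.I * dilogConst β * a * (t - dilogConst β * (a + c))) *
    Complex.exp (-Real.pi * Complex.I * dilogConst β ^ 2 * (4 * (a - c) + 1) / 6)

/-- The Fourier transform of `ψ_{a,c}`. -/
noncomputable def psiTilde (β : ℂ) (a c s : ℝ) : ℂ :=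
  ∫ t : ℝ, psiFun β a c t * Complex.exp (-2 * Real.pi * Complex.I * s * t)

/-- The Fourier transform of `ψ_{a,c}` multiplied by the Gaussian `exp (-π i s ^ 2)`. -/
noncomputable def psiTildePrime (β : ℂ) (a c s : ℝ) : ℂ :=
  Complex.exp (-Real.pi * Complex.I * (s : ℂ) ^ 2) * psiTilde β a c s

/-- The term of index `m` of the series that defines `g_{a,c} (s, t)`. -/
noncomputable def weightTerm (β : ℂ) (a c s t : ℝ) (m : ℤ) : ℂ :=
  psiTildePrime β a c (s + m) * Complex.exp (Complex.I * Real.pi * t * (s + 2 * m))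

/-- The tetrahedral weight `g_{a,c} (s, t)` of a positive tetrahedron. -/
noncomputable def tetWeight (β : ℂ) (a c s t : ℝ) : ℂ :=
  ∑' m : ℤ, weightTerm β a c s t m

/-- The tetrahedral weight of a negative tetrahedron: the complex conjugate of `g_{a,c} (s, t)`. -/
noncomputable def tetWeightBar (β : ℂ) (a c s t : ℝ) : ℂ :=
  (starRingEnd ℂ) (tetWeight β a c s t)

section

open Complex Filter Topology

/-! Three facts about ψ carry the theorem; throughout, b = 1/2 - a - c. (1) Fourier duality,
`psiTilde_eq`: the transform of ψ_{a,c} at s is e^{-πi/12} e^{πis²} ψ_{c,b}(s). The Gaussian in the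
definition of ψ̃' cancels e^{πis²}, so g_{a,c} is, up to a constant, a series of values of ψ_{c,b}.
(2) Conjugation, `conj_psiFun`: the conjugate of ψ_{a,c}(t) is e^{-πi/6} e^{πit²} ψ_{c,a}(-t), from
unitarity and inversion of the quantum dilogarithm. (3) Exponential decay, `exists_norm_psiFun_le`,
at rates proportional to a at -∞ and to c at +∞. Given these, the first symmetry holds term by term
under m ↦ -m. The second is Poisson summation: the Fourier transform of e^{πit²} ψ_{c,b}(t) is, by
(2), a phase times the conjugate of ψ̃'_{b,c}.

The substance is (1). It is proved for a small positive parameter β. The transform G(w) of 1/Φ along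
a horizontal line and the candidate H(w) = e^{πiw²}/Φ(w - iq), with q half the width of the strip,
satisfy the same difference equation with step iβ (`dilogFourier_add`, `dilogDual_add`). Their
quotient is therefore iβ-periodic. Its growth is below the threshold of the Liouville argument
`deriv_eq_zero_of_periodic_strip`, so a single period suffices and the quotient is constant. The
constant comes from the simple pole of G at 0: comparing residues through the functional equations
with steps iβ and i/β yields two equations, which unitarity and inversion resolve
(`dilogFourier_eq`). Both sides of (1) are holomorphic in β on Re β > 0, so the identity theorem
extends the formula to every β there, including |β| = 1.

The properties of Φ follow from its integral: inversion from the residue at the triple pole 0,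
unitarity from the reflection u ↦ -u, and the functional equation by differentiating a difference of
two exponents, which reduces it to the Fourier transform of 1/sinh. -/

/-! ### Parameter integrals and residues on horizontal strips. -/

lemma integrable_exp_neg_mul_abs {κ : ℝ} (hκ : 0 < κ) :
    Integrable (fun u : ℝ => Real.exp (-(κ * |u|))) := by
  rw [← integrableOn_univ, ← Set.Iic_union_Ioi (a := (0 : ℝ))]
  refine IntegrableOn.union ?_ ?_
  · refine (integrableOn_exp_mul_Iic hκ 0).congr_fun (fun u hu => ?_) measurableSet_Iic
    simp only [abs_of_nonpos (Set.mem_Iic.1 hu)]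
    ring_nf
  · refine (exp_neg_integrableOn_Ioi 0 hκ).congr_fun (fun u hu => ?_) measurableSet_Ioi
    simp only [abs_of_pos (Set.mem_Ioi.1 hu)]
    ring_nf

/-- Differentiation under the integral sign for a holomorphic family with a locally uniform
integrable bound: the bound of the derivative comes from Cauchy's estimate. -/
theorem hasDerivAt_integral_of_holomorphic {F : ℂ → ℝ → ℂ} {ξ₀ : ℂ} {g : ℝ → ℝ}
    (hd : ∀ᶠ ξ in 𝓝 ξ₀, ∀ u, DifferentiableAt ℂ (fun ξ => F ξ u) ξ)
    (hm : ∀ᶠ ξ in 𝓝 ξ₀, AEStronglyMeasurable (F ξ))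
    (hb : ∀ᶠ ξ in 𝓝 ξ₀, ∀ u, ‖F ξ u‖ ≤ g u) (hg : Integrable g) :
    HasDerivAt (fun ξ => ∫ u, F ξ u) (∫ u, deriv (fun ξ => F ξ u) ξ₀) ξ₀ := by
  obtain ⟨r, hr, h⟩ := Metric.eventually_nhds_iff_ball.1 (hd.and (hm.and hb))
  -- Half the radius leaves room for Cauchy discs of radius r/2 around every point of the smaller
  -- ball.
  have hr2 : 0 < r / 2 := by positivity
  have hsub : ∀ ξ ∈ Metric.ball ξ₀ (r / 2), Metric.closedBall ξ (r / 2) ⊆ Metric.ball ξ₀ r := by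
    intro ξ hξ x hx
    rw [Metric.mem_ball] at *
    rw [Metric.mem_closedBall] at hx
    linarith [dist_triangle x ξ ξ₀]
  have hint : ∀ ξ ∈ Metric.ball ξ₀ r, Integrable (F ξ) := fun ξ hξ =>
    hg.mono' (h ξ hξ).2.1 (ae_of_all _ (h ξ hξ).2.2)
  have h0 : ξ₀ ∈ Metric.ball ξ₀ r := Metric.mem_ball_self hr
  have hseq : ∀ n : ℕ, ξ₀ + ((r / 2 / (n + 1) : ℝ) : ℂ) ∈ Metric.ball ξ₀ r := by
    intro n
    rw [Metric.mem_ball, dist_eq_norm, add_sub_cancel_left, Complex.norm_real, Real.norm_eq_abs,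
      abs_of_pos (by positivity)]
    have : r / 2 / ((n : ℝ) + 1) ≤ r / 2 := div_le_self hr2.le (by linarith [n.cast_nonneg (α := ℝ)])
    linarith
  -- The derivative is a pointwise limit of difference quotients along a sequence of real
  -- increments, each of them measurable in u.
  have hmeas : AEStronglyMeasurable (fun u => deriv (fun ξ => F ξ u) ξ₀) := by
    refine aestronglyMeasurable_of_tendsto_ae atTop
      (f := fun (n : ℕ) u => (((r / 2 / (n + 1) : ℝ) : ℂ))⁻¹ •
        (F (ξ₀ + ((r / 2 / (n + 1) : ℝ) : ℂ)) u - F ξ₀ u)) (fun n => ?_) (ae_of_all _ fun u => ?_)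
    · exact (((h _ (hseq n)).2.1).sub (h _ h0).2.1).const_mul _
    · have hd := ((h _ h0).1 u).hasDerivAt.tendsto_slope_zero
      refine hd.comp (tendsto_nhdsWithin_iff.2 ⟨?_, Eventually.of_forall fun n => ?_⟩)
      · have : Tendsto (fun n : ℕ => r / 2 / ((n : ℝ) + 1)) atTop (𝓝 0) :=
          tendsto_const_nhds.div_atTop (tendsto_atTop_add_const_right _ _ tendsto_natCast_atTop_atTop)
        simpa [Function.comp_def] using (Complex.continuous_ofReal.tendsto 0).comp this
      · simp only [Set.mem_compl_iff, Set.mem_singleton_iff, Complex.ofReal_eq_zero]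
        positivity
  refine (hasDerivAt_integral_of_dominated_loc_of_deriv_le (bound := fun u => g u / (r / 2))
    (F' := fun ξ u => deriv (fun ξ => F ξ u) ξ)
    (Metric.ball_mem_nhds ξ₀ hr2) ?_ (hint _ h0) hmeas ?_ (hg.div_const _) ?_).2
  · exact hm
  · refine ae_of_all _ fun u ξ hξ => ?_
    refine Complex.norm_deriv_le_of_forall_mem_sphere_norm_le hr2 ?_ ?_
    · refine DifferentiableOn.diffContOnCl fun x hx => ?_
      exact ((h x (hsub ξ hξ (closure_minimal Metric.ball_subset_closedBall
        Metric.isClosed_closedBall hx))).1 u).differentiableWithinAt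
    · exact fun x hx => (h x (hsub ξ hξ (Metric.sphere_subset_closedBall hx))).2.2 u
  · refine ae_of_all _ fun u ξ hξ => ?_
    exact ((h ξ (Metric.ball_subset_ball (by linarith) hξ)).1 u).hasDerivAt

/-- Division of a holomorphic function by a linear factor after subtraction of its value. -/
lemma exists_differentiableOn_eq_add_mul {F : ℂ → ℂ} {U : Set ℂ} (hU : IsOpen U)
    (hF : DifferentiableOn ℂ F U) {p : ℂ} (hp : p ∈ U) :
    ∃ g : ℂ → ℂ, DifferentiableOn ℂ g U ∧ g p = deriv F p ∧
      ∀ w, F w = F p + (w - p) * g w := by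
  refine ⟨dslope F p, (differentiableOn_dslope (hU.mem_nhds hp)).2 hF, dslope_same F p, fun w => ?_⟩
  rw [← smul_eq_mul, sub_smul_dslope]
  ring

/-- The integral of the principal part of a Laurent series along the two edges of a strip. -/
lemma tendsto_intervalIntegral_principalPart (c₁ c₂ c₃ : ℂ) (x η : ℝ) (hη : η ≠ 0) :
    Tendsto (fun T : ℝ => ∫ u in (-T)..T, (c₁ / (u - x + η * I) + c₂ / (u - x + η * I) ^ 2 +
      c₃ / (u - x + η * I) ^ 3)) atTop
      (𝓝 (if 0 < η then -(Real.pi * I * c₁) else Real.pi * I * c₁)) := by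
  have hne : ∀ u : ℝ, (u - x + η * I : ℂ) ∈ slitPlane := fun u => by
    rw [mem_slitPlane_iff]; right; simpa using hη
  have hne0 : ∀ u : ℝ, (u - x + η * I : ℂ) ≠ 0 := fun u => slitPlane_ne_zero (hne u)
  have hder : ∀ u : ℝ, HasDerivAt (fun u : ℝ => c₁ * Complex.log (u - x + η * I)
      - c₂ * (u - x + η * I : ℂ)⁻¹ - c₃ / 2 * ((u - x + η * I : ℂ)⁻¹) ^ 2)
      (c₁ / (u - x + η * I) + c₂ / (u - x + η * I) ^ 2 + c₃ / (u - x + η * I) ^ 3) u := by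
    intro u
    have h1 : HasDerivAt (fun u : ℝ => (u - x + η * I : ℂ)) 1 u := by
      simpa using ((HasDerivAt.ofReal_comp (hasDerivAt_id u)).sub_const (x : ℂ)).add_const (η * I : ℂ)
    have hinv := h1.inv (hne0 u)
    refine ((((h1.clog_real (hne u)).const_mul c₁).sub (hinv.const_mul c₂)).sub
      ((hinv.pow 2).const_mul (c₃ / 2))).congr_deriv ?_
    have := hne0 u
    simp only [Pi.inv_apply, Nat.add_one_sub_one, pow_one, Nat.cast_ofNat]
    generalize (u - x + η * I : ℂ) = v at this ⊢
    field_simp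
    ring
  have hcont : Continuous (fun u : ℝ => (c₁ / (u - x + η * I : ℂ) + c₂ / (u - x + η * I : ℂ) ^ 2 +
      c₃ / (u - x + η * I : ℂ) ^ 3)) := by
    refine ((continuous_const.div (by fun_prop) hne0).add (continuous_const.div (by fun_prop)
      fun u => pow_ne_zero 2 (hne0 u))).add (continuous_const.div (by fun_prop)
      fun u => pow_ne_zero 3 (hne0 u))
  have heq : ∀ T : ℝ, ∫ u in (-T)..T, (c₁ / (u - x + η * I : ℂ) + c₂ / (u - x + η * I : ℂ) ^ 2 +
      c₃ / (u - x + η * I : ℂ) ^ 3) = _ := fun T =>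
    intervalIntegral.integral_eq_sub_of_hasDerivAt (fun u _ => hder u)
      (hcont.intervalIntegrable _ _)
  simp only [heq]
  have hinvT : ∀ σ : ℝ, Tendsto (fun T : ℝ => (((-x / T : ℝ) : ℂ) + ((η / T : ℝ) : ℂ) * I) + σ)
      atTop (𝓝 (σ : ℂ)) := by
    intro σ
    have h1 : Tendsto (fun T : ℝ => -x / T) atTop (𝓝 0) := tendsto_const_nhds.div_atTop tendsto_id
    have h2 : Tendsto (fun T : ℝ => η / T) atTop (𝓝 0) := tendsto_const_nhds.div_atTop tendsto_id
    have h1' := (Complex.continuous_ofReal.tendsto 0).comp h1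
    have h2' := (Complex.continuous_ofReal.tendsto 0).comp h2
    simpa using (h1'.add (h2'.mul_const I)).add_const (σ : ℂ)
  -- With the positive factor T extracted, the terms log T cancel in the difference of logarithms,
  -- and only the limits of log near 1 and near -1 remain. The sign of η decides from which side of
  -- the cut -1 is approached.
  have hfac : ∀ σ : ℝ, ∀ T : ℝ, 0 < T → ((σ * T : ℝ) : ℂ) - x + η * I =
      (T : ℂ) * ((((-x / T : ℝ) : ℂ) + ((η / T : ℝ) : ℂ) * I) + σ) := by
    intro σ T hT
    have : (T : ℂ) ≠ 0 := by exact_mod_cast hT.ne'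
    push_cast
    field_simp
    ring
  have hinv0 : ∀ σ : ℝ, σ ≠ 0 → Tendsto (fun T : ℝ => (((σ * T : ℝ) : ℂ) - x + η * I)⁻¹)
      atTop (𝓝 0) := by
    intro σ hσ
    have h1 : Tendsto (fun T : ℝ => (T : ℂ)⁻¹) atTop (𝓝 0) := by
      have := (Complex.continuous_ofReal.tendsto 0).comp (tendsto_inv_atTop_zero (𝕜 := ℝ))
      simpa [Function.comp_def] using this
    have h2 := (hinvT σ).inv₀ (by exact_mod_cast hσ)
    have h3 := h1.mul h2
    rw [zero_mul] at h3
    refine h3.congr' ?_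
    filter_upwards [eventually_gt_atTop 0] with T hT
    rw [hfac σ T hT, mul_inv]
  have hlog : Tendsto (fun T : ℝ => Complex.log (T - x + η * I) -
      Complex.log (((-T : ℝ) : ℂ) - x + η * I)) atTop
      (𝓝 (if 0 < η then -(Real.pi * I) else Real.pi * I)) := by
    have hp : Tendsto (fun T : ℝ => Complex.log ((((-x / T : ℝ) : ℂ) + ((η / T : ℝ) : ℂ) * I) +
        (1 : ℝ))) atTop (𝓝 0) := by
      have := (continuousAt_clog (x := ((1 : ℝ) : ℂ)) (by simp)).tendsto.comp (hinvT 1)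
      simpa [Function.comp_def] using this
    have hm : Tendsto (fun T : ℝ => Complex.log ((((-x / T : ℝ) : ℂ) + ((η / T : ℝ) : ℂ) * I) +
        (-1 : ℝ))) atTop (𝓝 (if 0 < η then Real.pi * I else -(Real.pi * I))) := by
      split_ifs with hpos
      · have h := tendsto_log_nhdsWithin_im_nonneg_of_re_neg_of_im_zero (z := ((-1 : ℝ) : ℂ))
          (by simp) (by simp)
        have := h.comp (tendsto_nhdsWithin_iff.2 ⟨hinvT (-1), by
          filter_upwards [eventually_gt_atTop 0] with T hT
          simp
          positivity⟩)
        simpa [Function.comp_def] using this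
      · have h := tendsto_log_nhdsWithin_im_neg_of_re_neg_of_im_zero (z := ((-1 : ℝ) : ℂ))
          (by simp) (by simp)
        have hneg : η < 0 := lt_of_le_of_ne (not_lt.1 hpos) hη
        have := h.comp (tendsto_nhdsWithin_iff.2 ⟨hinvT (-1), by
          filter_upwards [eventually_gt_atTop 0] with T hT
          simpa using div_neg_of_neg_of_pos hneg hT⟩)
        simpa [Function.comp_def] using this
    have := hp.sub hm
    have hlim : (0 : ℂ) - (if 0 < η then Real.pi * I else -(Real.pi * I)) =
        if 0 < η then -(Real.pi * I) else Real.pi * I := by split_ifs <;> ring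
    rw [hlim] at this
    refine this.congr' ?_
    filter_upwards [eventually_gt_atTop 0] with T hT
    have e1 := hfac 1 T hT
    have e2 := hfac (-1) T hT
    rw [one_mul] at e1
    rw [neg_one_mul] at e2
    have n1 := hne0 T
    have n2 := hne0 (-T)
    rw [e1] at n1 ⊢
    rw [e2] at n2 ⊢
    rw [Complex.log_ofReal_mul hT (right_ne_zero_of_mul n1),
      Complex.log_ofReal_mul hT (right_ne_zero_of_mul n2)]
    ring
  have i1 := hinv0 1 one_ne_zero
  have i2 := hinv0 (-1) (by norm_num)
  have := ((hlog.const_mul c₁).sub ((i1.sub i2).const_mul c₂)).sub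
    (((i1.pow 2).sub (i2.pow 2)).const_mul (c₃ / 2))
  have hlim : c₁ * (if 0 < η then -(Real.pi * I) else Real.pi * I) - c₂ * (0 - 0) -
      c₃ / 2 * (0 ^ 2 - 0 ^ 2) = if 0 < η then -(Real.pi * I * c₁) else Real.pi * I * c₁ := by
    split_ifs <;> ring
  rw [hlim] at this
  refine this.congr fun T => ?_
  simp only [one_mul, neg_one_mul]
  ring

lemma integrable_of_norm_le_exp_neg_mul_abs {h : ℝ → ℂ} (hc : Continuous h) {C κ T₀ : ℝ}
    (hκ : 0 < κ) (hb : ∀ u, T₀ ≤ |u| → ‖h u‖ ≤ C * Real.exp (-(κ * |u|))) : Integrable h := by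
  rw [← integrableOn_univ, ← Set.union_compl_self (Set.Icc (-T₀) T₀)]
  refine IntegrableOn.union (hc.continuousOn.integrableOn_Icc) ?_
  refine Integrable.mono' (g := fun u => C * Real.exp (-(κ * |u|)))
    ((integrable_exp_neg_mul_abs hκ).const_mul C).integrableOn hc.aestronglyMeasurable ?_
  refine (ae_restrict_iff' measurableSet_Icc.compl).2 (ae_of_all _ fun u hu => hb u ?_)
  by_contra hlt
  exact hu (abs_le.1 (not_le.1 hlt).le)

/-- Moving the line of integration across a pole of order at most three. -/
theorem integral_line_sub_integral_line {f g : ℂ → ℂ} {y₁ y₂ : ℝ} {p c₁ c₂ c₃ : ℂ}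
    (h₁ : y₁ < p.im) (h₂ : p.im < y₂)
    (hg : ∀ w : ℂ, y₁ ≤ w.im → w.im ≤ y₂ → DifferentiableAt ℂ g w)
    (hf : ∀ w : ℂ, w ≠ p → y₁ ≤ w.im → w.im ≤ y₂ →
      f w = g w + (c₁ / (w - p) + c₂ / (w - p) ^ 2 + c₃ / (w - p) ^ 3))
    {C κ T₀ : ℝ} (hκ : 0 < κ)
    (hb : ∀ w : ℂ, y₁ ≤ w.im → w.im ≤ y₂ → T₀ ≤ |w.re| →
      ‖f w‖ ≤ C * Real.exp (-(κ * |w.re|))) :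
    Integrable (fun u : ℝ => f (u + y₁ * I)) ∧ Integrable (fun u : ℝ => f (u + y₂ * I)) ∧
      (∫ u : ℝ, f (u + y₁ * I)) - ∫ u : ℝ, f (u + y₂ * I) = 2 * Real.pi * I * c₁ := by
  have hp : ∀ (u y : ℝ), (u + y * I : ℂ) - p = u - (p.re : ℂ) + ((y - p.im : ℝ) : ℂ) * I := by
    intro u y
    apply Complex.ext <;> simp
  have hneq : ∀ (u y : ℝ), y ≠ p.im → (u + y * I : ℂ) ≠ p := by
    rintro u y hy rfl
    simp at hy
  have hline : ∀ (u y : ℝ), y₁ ≤ y → y ≤ y₂ → y ≠ p.im → f (u + y * I) = g (u + y * I) +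
      (c₁ / (u - (p.re : ℂ) + ((y - p.im : ℝ) : ℂ) * I) +
        c₂ / (u - (p.re : ℂ) + ((y - p.im : ℝ) : ℂ) * I) ^ 2 +
        c₃ / (u - (p.re : ℂ) + ((y - p.im : ℝ) : ℂ) * I) ^ 3) := by
    intro u y hy1 hy2 hy
    rw [hf _ (hneq u y hy) (by simpa using hy1) (by simpa using hy2), hp]
  have hgc : ∀ y : ℝ, y₁ ≤ y → y ≤ y₂ → Continuous (fun u : ℝ => g (u + y * I)) := by
    intro y hy1 hy2
    refine continuous_iff_continuousAt.2 fun u => ?_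
    exact ContinuousAt.comp (f := fun u : ℝ => (u + y * I : ℂ))
      (hg (u + y * I) (by simpa using hy1) (by simpa using hy2)).continuousAt (by fun_prop)
  have hPc : ∀ y : ℝ, y ≠ p.im → Continuous (fun u : ℝ =>
      (c₁ / (u - (p.re : ℂ) + ((y - p.im : ℝ) : ℂ) * I) +
        c₂ / (u - (p.re : ℂ) + ((y - p.im : ℝ) : ℂ) * I) ^ 2 +
        c₃ / (u - (p.re : ℂ) + ((y - p.im : ℝ) : ℂ) * I) ^ 3)) := by
    intro y hy
    have hne0 : ∀ u : ℝ, (u - (p.re : ℂ) + ((y - p.im : ℝ) : ℂ) * I : ℂ) ≠ 0 := fun u => by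
      rw [← hp]; exact sub_ne_zero.2 (hneq u y hy)
    exact ((continuous_const.div (by fun_prop) hne0).add (continuous_const.div (by fun_prop)
      fun u => pow_ne_zero 2 (hne0 u))).add (continuous_const.div (by fun_prop)
      fun u => pow_ne_zero 3 (hne0 u))
  have hint : ∀ y : ℝ, y₁ ≤ y → y ≤ y₂ → y ≠ p.im → Integrable (fun u : ℝ => f (u + y * I)) := by
    intro y hy1 hy2 hy
    refine integrable_of_norm_le_exp_neg_mul_abs (C := C) (T₀ := T₀) ?_ hκ fun u hu => ?_
    · exact ((hgc y hy1 hy2).add (hPc y hy)).congr fun u => (hline u y hy1 hy2 hy).symm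
    · simpa using hb (u + y * I) (by simpa using hy1) (by simpa using hy2) (by simpa using hu)
  have hi1 := hint y₁ le_rfl (h₁.trans h₂).le h₁.ne
  have hi2 := hint y₂ (h₁.trans h₂).le le_rfl h₂.ne'
  refine ⟨hi1, hi2, ?_⟩
  -- The term c₁ / (w - p) is not absolutely integrable on a line, so f and its principal part are
  -- compared on symmetric intervals [-T, T].
  have hlim : ∀ y : ℝ, y₁ ≤ y → y ≤ y₂ → y ≠ p.im → Tendsto
      (fun T : ℝ => ∫ u in (-T)..T, g (u + y * I)) atTop (𝓝 ((∫ u : ℝ, f (u + y * I)) -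
      (if 0 < y - p.im then -(Real.pi * I * c₁) else Real.pi * I * c₁))) := by
    intro y hy1 hy2 hy
    refine ((intervalIntegral_tendsto_integral (hint y hy1 hy2 hy) tendsto_neg_atTop_atBot
      tendsto_id).sub (tendsto_intervalIntegral_principalPart c₁ c₂ c₃ p.re (y - p.im)
      (sub_ne_zero.2 hy))).congr fun T => ?_
    have := (hPc y hy).intervalIntegrable (μ := volume) (-T) T
    rw [id, ← intervalIntegral.integral_sub (hint y hy1 hy2 hy).intervalIntegrable this]
    refine intervalIntegral.integral_congr fun u _ => ?_
    simp only [hline u y hy1 hy2 hy]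
    ring
  have hl1 := hlim y₁ le_rfl (h₁.trans h₂).le h₁.ne
  have hl2 := hlim y₂ (h₁.trans h₂).le le_rfl h₂.ne'
  rw [if_neg (by linarith)] at hl1
  rw [if_pos (by linarith)] at hl2
  -- On the vertical sides g is f minus the principal part, and both tend to 0 uniformly.
  have hvert : ∀ σ : ℝ, |σ| = 1 → Tendsto (fun T : ℝ => ∫ y in y₁..y₂,
      g (((σ * T : ℝ) : ℂ) + y * I)) atTop (𝓝 0) := by
    intro σ hσ
    have hbound : Tendsto (fun T : ℝ => (C * Real.exp (-(κ * T)) + (‖c₁‖ / (T - |p.re|) +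
        ‖c₂‖ / (T - |p.re|) ^ 2 + ‖c₃‖ / (T - |p.re|) ^ 3)) * |y₂ - y₁|) atTop (𝓝 0) := by
      have e1 : Tendsto (fun T : ℝ => T - |p.re|) atTop atTop :=
        tendsto_atTop_add_const_right _ _ tendsto_id
      have e2 : Tendsto (fun T : ℝ => Real.exp (-(κ * T))) atTop (𝓝 0) :=
        Real.tendsto_exp_neg_atTop_nhds_zero.comp (tendsto_id.const_mul_atTop hκ)
      have e3 := (e2.const_mul C).add (((tendsto_const_nhds (x := ‖c₁‖)).div_atTop e1).add
        ((tendsto_const_nhds (x := ‖c₂‖)).div_atTop ((tendsto_pow_atTop two_ne_zero).comp e1)) |>.add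
        ((tendsto_const_nhds (x := ‖c₃‖)).div_atTop
          ((tendsto_pow_atTop three_ne_zero).comp e1)))
      simpa using e3.mul_const |y₂ - y₁|
    refine squeeze_zero_norm' ?_ hbound
    filter_upwards [eventually_gt_atTop (max T₀ (|p.re|)), eventually_gt_atTop 0] with T hT hT0
    have hTT : T₀ ≤ T := (le_max_left _ _).trans hT.le
    have hTp : 0 < T - |p.re| := by linarith [(le_max_right T₀ |p.re|).trans_lt hT]
    have hre : |σ * T| = T := by rw [abs_mul, hσ, one_mul, abs_of_pos hT0]
    refine intervalIntegral.norm_integral_le_of_norm_le_const fun y hy => ?_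
    rw [Set.uIoc_of_le (h₁.trans h₂).le] at hy
    set w : ℂ := ((σ * T : ℝ) : ℂ) + y * I with hw
    have hwre : w.re = σ * T := by rw [hw]; simp
    have hwim : w.im = y := by rw [hw]; simp
    have hd : T - |p.re| ≤ ‖w - p‖ := by
      have a1 := Complex.abs_re_le_norm (w - p)
      rw [Complex.sub_re, hwre] at a1
      have a2 := abs_sub_abs_le_abs_sub (σ * T) p.re
      rw [hre] at a2
      linarith
    have hne : w ≠ p := by
      intro h
      rw [h, sub_self, norm_zero] at hd
      linarith
    have hfw := hf w hne (by rw [hwim]; exact hy.1.le) (by rw [hwim]; exact hy.2)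
    have hbw := hb w (by rw [hwim]; exact hy.1.le) (by rw [hwim]; exact hy.2)
      (by rw [hwre, hre]; exact hTT)
    rw [hwre, hre] at hbw
    rw [eq_comm, ← eq_sub_iff_add_eq] at hfw
    rw [hfw]
    refine (norm_sub_le _ _).trans (add_le_add hbw ?_)
    refine (norm_add₃_le).trans ?_
    rw [norm_div, norm_div, norm_div, norm_pow, norm_pow]
    gcongr
  have hv1 := hvert 1 (by simp)
  have hv2 := hvert (-1) (by simp)
  have htot := ((hl1.sub hl2).add (hv1.const_mul I)).sub (hv2.const_mul I)
  have hzero : ∀ T : ℝ, (∫ u in (-T)..T, g (u + y₁ * I)) - (∫ u in (-T)..T, g (u + y₂ * I)) +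
      I * (∫ y in y₁..y₂, g (((1 * T : ℝ) : ℂ) + y * I)) -
      I * (∫ y in y₁..y₂, g (((-1 * T : ℝ) : ℂ) + y * I)) = 0 := by
    intro T
    have := integral_boundary_rect_eq_zero_of_differentiableOn g
      (((-T : ℝ) : ℂ) + y₁ * I) (T + y₂ * I) (fun w hw => ?_)
    · simpa using this
    · rw [mem_reProdIm] at hw
      have h2 := hw.2
      simp only [add_im, ofReal_im, mul_im, ofReal_re, I_im, mul_one, I_re, mul_zero, add_zero,
        zero_add] at h2
      rw [Set.uIcc_of_le (h₁.trans h₂).le] at h2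
      exact (hg w h2.1 h2.2).differentiableWithinAt
  have := tendsto_nhds_unique (htot.congr hzero) tendsto_const_nhds
  linear_combination this

/-- Moving the line of integration inside a strip of holomorphy. -/
theorem integral_line_eq_integral_line {f : ℂ → ℂ} {y₁ y₂ : ℝ} (h : y₁ < y₂)
    (hf : ∀ w : ℂ, y₁ ≤ w.im → w.im ≤ y₂ → DifferentiableAt ℂ f w)
    {C κ T₀ : ℝ} (hκ : 0 < κ)
    (hb : ∀ w : ℂ, y₁ ≤ w.im → w.im ≤ y₂ → T₀ ≤ |w.re| →
      ‖f w‖ ≤ C * Real.exp (-(κ * |w.re|))) :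
    ∫ u : ℝ, f (u + y₁ * I) = ∫ u : ℝ, f (u + y₂ * I) := by
  -- A fictitious pole in the middle of the strip with zero principal part.
  have := (integral_line_sub_integral_line (p := ((y₁ + y₂) / 2 : ℝ) * I) (c₁ := 0) (c₂ := 0)
    (c₃ := 0) (f := f) (g := f) (by simp; linarith) (by simp; linarith) hf
    (fun w _ _ _ => by simp) hκ hb).2.2
  rw [mul_zero] at this
  exact sub_eq_zero.1 this

/-! ### Taylor expansions and bounds for the hyperbolic sine. -/

/-- Taylor expansion of an entire function at the origin with a remainder of order three. -/
lemma exists_differentiable_taylor_three {F : ℂ → ℂ} (hF : Differentiable ℂ F) :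
    ∃ k : ℂ → ℂ, Differentiable ℂ k ∧ ∀ v, F v = F 0 + deriv F 0 * v +
      deriv (deriv F) 0 / 2 * v ^ 2 + v ^ 3 * k v := by
  obtain ⟨g, hg, hg0, hFg⟩ := exists_differentiableOn_eq_add_mul isOpen_univ hF.differentiableOn
    (Set.mem_univ (0 : ℂ))
  obtain ⟨h, hh, hh0, hgh⟩ := exists_differentiableOn_eq_add_mul isOpen_univ hg (Set.mem_univ (0 : ℂ))
  obtain ⟨k, hk, -, hhk⟩ := exists_differentiableOn_eq_add_mul isOpen_univ hh (Set.mem_univ (0 : ℂ))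
  rw [differentiableOn_univ] at hg hh hk
  have hg' : Differentiable ℂ (deriv g) := fun v =>
    ((hg.differentiableOn.deriv isOpen_univ) v trivial).differentiableAt univ_mem
  have h1 : deriv F = fun v => g v + v * deriv g v := by
    funext v
    have : F = fun v => F 0 + v * g v := by
      funext v
      rw [hFg v, sub_zero]
    rw [this]
    have := (((hasDerivAt_id v).mul (hg v).hasDerivAt).const_add (F 0)).deriv
    simpa using this
  have h2 : deriv (deriv F) 0 = 2 * deriv g 0 := by
    rw [h1]
    have := ((hg 0).hasDerivAt.add ((hasDerivAt_id (0 : ℂ)).mul (hg' 0).hasDerivAt)).deriv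
    have h3 : deriv (fun v => g v + v * deriv g v) 0 = deriv g 0 + (1 * deriv g 0 +
      id 0 * deriv (deriv g) 0) := this
    rw [h3]
    simp
    ring
  refine ⟨k, hk, fun v => ?_⟩
  rw [hFg v, hgh v, hhk v, hh0, hg0, h2]
  ring

/-- The entire function `sinh v / v`. -/
noncomputable def sinhc : ℂ → ℂ := dslope Complex.sinh 0

lemma differentiable_sinhc : Differentiable ℂ sinhc := fun v =>
  (((differentiableOn_dslope (univ_mem (α := ℂ))).2
    Complex.differentiable_sinh.differentiableOn) v trivial).differentiableAt univ_mem

lemma mul_sinhc (v : ℂ) : v * sinhc v = Complex.sinh v := by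
  have := sub_smul_dslope Complex.sinh 0 v
  simpa [sinhc] using this

lemma sinhc_zero : sinhc 0 = 1 := by
  simp [sinhc, dslope_same]

lemma sinhc_ne_zero {v : ℂ} (hv : v ≠ 0 → Complex.sinh v ≠ 0) : sinhc v ≠ 0 := by
  by_cases h : v = 0
  · rw [h, sinhc_zero]; exact one_ne_zero
  · intro h0
    apply hv h
    rw [← mul_sinhc, h0, mul_zero]

/-- Differentiating v · sinhc v = sinh v up to three times and evaluating at 0 gives the
coefficients without power series. -/
lemma exists_sinhc_eq : ∃ k : ℂ → ℂ, Differentiable ℂ k ∧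
    ∀ v, sinhc v = 1 + v ^ 2 / 6 + v ^ 3 * k v := by
  obtain ⟨k, hk, h⟩ := exists_differentiable_taylor_three differentiable_sinhc
  refine ⟨k, hk, fun v => ?_⟩
  have d0 := differentiable_sinhc
  have hd : ∀ {g : ℂ → ℂ}, Differentiable ℂ g → Differentiable ℂ (deriv g) := fun hg v =>
    ((hg.differentiableOn.deriv isOpen_univ) v trivial).differentiableAt univ_mem
  have d1 := hd d0
  have d2 := hd d1
  have e0 : (fun v => v * sinhc v) = Complex.sinh := funext mul_sinhc
  have e1 : (fun v => sinhc v + v * deriv sinhc v) = Complex.cosh := by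
    rw [← Complex.deriv_sinh, ← e0]
    funext v
    have h3 : deriv (fun v => v * sinhc v) v = 1 * sinhc v + id v * deriv sinhc v :=
      ((hasDerivAt_id v).mul (d0 v).hasDerivAt).deriv
    rw [h3]
    simp
  have e2 : (fun v => 2 * deriv sinhc v + v * deriv (deriv sinhc) v) = Complex.sinh := by
    rw [← Complex.deriv_cosh, ← e1]
    funext v
    have h3 : deriv (fun v => sinhc v + v * deriv sinhc v) v = deriv sinhc v +
        (1 * deriv sinhc v + id v * deriv (deriv sinhc) v) :=
      ((d0 v).hasDerivAt.add ((hasDerivAt_id v).mul (d1 v).hasDerivAt)).deriv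
    rw [h3]
    simp
    ring
  have e3 : (2 * deriv (deriv sinhc) 0 + (1 * deriv (deriv sinhc) 0 +
      id 0 * deriv (deriv (deriv sinhc)) 0)) = Complex.cosh 0 := by
    rw [← Complex.deriv_sinh, ← e2]
    exact ((((d1 0).hasDerivAt.const_mul 2).add
      ((hasDerivAt_id (0 : ℂ)).mul (d2 0).hasDerivAt)).deriv).symm
  have f2 := congrFun e2 0
  simp only [zero_mul, add_zero, Complex.sinh_zero, mul_eq_zero, OfNat.ofNat_ne_zero,
    false_or] at f2
  simp only [id, zero_mul, add_zero, one_mul, Complex.cosh_zero] at e3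
  rw [h v, sinhc_zero, f2]
  linear_combination (v ^ 2 / 6) * e3

lemma exists_cos_eq : ∃ k : ℂ → ℂ, Differentiable ℂ k ∧
    ∀ v, Complex.cos v = 1 - v ^ 2 / 2 + v ^ 3 * k v := by
  obtain ⟨k, hk, h⟩ := exists_differentiable_taylor_three Complex.differentiable_cos
  refine ⟨k, hk, fun v => ?_⟩
  rw [h v]
  have : deriv Complex.cos = fun v => -Complex.sin v := by
    funext v
    exact Complex.deriv_cos
  simp [this]
  ring

lemma norm_exp_sub_norm_exp_le_two_mul_norm_sinh (ζ : ℂ) :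
    Real.exp |ζ.re| - Real.exp (-|ζ.re|) ≤ 2 * ‖Complex.sinh ζ‖ := by
  have h : ∀ ζ : ℂ, Real.exp ζ.re - Real.exp (-ζ.re) ≤ 2 * ‖Complex.sinh ζ‖ := by
    intro ζ
    have h1 : 2 * ‖Complex.sinh ζ‖ = ‖cexp ζ - cexp (-ζ)‖ := by
      rw [← Complex.two_sinh, norm_mul]
      simp
    rw [h1]
    refine le_trans (le_of_eq ?_) (norm_sub_norm_le _ _)
    rw [Complex.norm_exp, Complex.norm_exp, Complex.neg_re]
  rcases abs_cases ζ.re with ⟨h0, _⟩ | ⟨h0, _⟩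
  · rw [h0]; exact h ζ
  · rw [h0]
    have := h (-ζ)
    rwa [Complex.sinh_neg, norm_neg, Complex.neg_re] at this

lemma exp_abs_re_le_four_mul_norm_sinh {ζ : ℂ} (h : 1 ≤ |ζ.re|) :
    Real.exp |ζ.re| ≤ 4 * ‖Complex.sinh ζ‖ := by
  have h1 := norm_exp_sub_norm_exp_le_two_mul_norm_sinh ζ
  have h2 : 2 * Real.exp (-|ζ.re|) ≤ Real.exp |ζ.re| := by
    have h3 : Real.exp |ζ.re| * Real.exp (-|ζ.re|) = 1 := by rw [← Real.exp_add]; simp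
    have h4 : 2 ≤ Real.exp |ζ.re| := by linarith [Real.add_one_le_exp |ζ.re|]
    have h5 := Real.exp_pos (-|ζ.re|)
    nlinarith
  linarith

/-! ### A Liouville argument for periodic functions on a strip. -/

/-- A holomorphic function on a strip that has the width of the strip as an imaginary period and
grows slower than the square of the hyperbolic sine of that period is constant. -/
theorem deriv_eq_zero_of_periodic_strip {R : ℂ → ℂ} {y₀ h : ℝ} (hh : 0 < h)
    {U : Set ℂ} (hU : IsOpen U) (hUs : ∀ w : ℂ, y₀ ≤ w.im → w.im ≤ y₀ + h → w ∈ U)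
    (hR : DifferentiableOn ℂ R U)
    (hper : ∀ w : ℂ, w.im = y₀ → R (w + h * I) = R w) {C κ : ℝ} (hC : 0 ≤ C)
    (hκ : κ < 2 * Real.pi / h)
    (hb : ∀ w : ℂ, y₀ ≤ w.im → w.im ≤ y₀ + h → ‖R w‖ ≤ C * Real.exp (κ * |w.re|))
    {w₀ : ℂ} (h₁ : y₀ < w₀.im) (h₂ : w₀.im < y₀ + h) : deriv R w₀ = 0 := by
  set k : ℝ := Real.pi / h with hk
  have hkpos : 0 < k := div_pos Real.pi_pos hh
  have hkh : k * h = Real.pi := by rw [hk]; field_simp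
  -- the kernel does not vanish on the strip
  have hS : ∀ w : ℂ, |w.im - w₀.im| < h → sinhc (k * (w - w₀)) ≠ 0 := by
    intro w hw
    refine sinhc_ne_zero fun hne h0 => hne ?_
    rw [Complex.sinh, div_eq_zero_iff, or_iff_left two_ne_zero, sub_eq_zero,
      Complex.exp_eq_exp_iff_exists_int] at h0
    obtain ⟨n, hn⟩ := h0
    have hn' : (k : ℂ) * (w - w₀) = n * (Real.pi * I) := by linear_combination hn / 2
    have him := congrArg Complex.im hn'
    simp only [mul_im, ofReal_re, sub_im, ofReal_im, zero_mul, add_zero, intCast_re, I_im, mul_one,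
      I_re, mul_zero, intCast_im, mul_re, sub_zero] at him
    have hn0 : n = 0 := by
      have habs : |(n : ℝ)| * Real.pi < Real.pi := by
        calc |(n : ℝ)| * Real.pi = |(n : ℝ) * Real.pi| := by
              rw [abs_mul, abs_of_pos Real.pi_pos]
          _ = k * |w.im - w₀.im| := by rw [← him, abs_mul, abs_of_pos hkpos]
          _ < k * h := by gcongr
          _ = Real.pi := hkh
      have h1 : |(n : ℝ)| < 1 := by
        have := Real.pi_pos
        by_contra hge
        nlinarith [not_lt.1 hge]
      exact Int.abs_lt_one_iff.1 (by exact_mod_cast h1)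
    rw [hn', hn0]
    simp
  set V : Set ℂ := U ∩ {w : ℂ | |w.im - w₀.im| < h} with hV
  have hVo : IsOpen V := hU.inter (isOpen_lt (by fun_prop) continuous_const)
  have hVs : ∀ w : ℂ, y₀ ≤ w.im → w.im ≤ y₀ + h → w ∈ V := fun w hw1 hw2 =>
    ⟨hUs w hw1 hw2, show |w.im - w₀.im| < h from abs_lt.2 ⟨by linarith, by linarith⟩⟩
  have hw₀ : w₀ ∈ V := hVs w₀ h₁.le h₂.le
  have hSd : Differentiable ℂ (fun w => sinhc (k * (w - w₀))) :=
    differentiable_sinhc.comp (by fun_prop)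
  set F : ℂ → ℂ := fun w => R w / (sinhc (k * (w - w₀))) ^ 2 with hF
  have hFd : DifferentiableOn ℂ F V := fun w hw =>
    ((hR w hw.1).mono Set.inter_subset_left).div ((hSd w).pow 2).differentiableWithinAt
      (pow_ne_zero 2 (hS w hw.2))
  obtain ⟨g, hg, hg0, hFg⟩ := exists_differentiableOn_eq_add_mul hVo hFd hw₀
  obtain ⟨m, hm, -, hgm⟩ := exists_differentiableOn_eq_add_mul hVo hg hw₀
  -- The double pole at w₀ has residue F'(w₀) / k². Periodicity makes the integrals of f along the
  -- two edges equal, so this residue vanishes.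
  set f : ℂ → ℂ := fun w => R w / Complex.sinh (k * (w - w₀)) ^ 2 with hf
  have hkc : (k : ℂ) ≠ 0 := by exact_mod_cast hkpos.ne'
  obtain ⟨-, -, hres⟩ := integral_line_sub_integral_line (f := f) (g := fun w => m w / k ^ 2)
    (y₁ := y₀) (y₂ := y₀ + h) (p := w₀) (c₁ := deriv F w₀ / k ^ 2) (c₂ := F w₀ / k ^ 2) (c₃ := 0)
    (C := 16 * C * Real.exp (2 * k * |w₀.re|)) (κ := 2 * k - κ) (T₀ := |w₀.re| + 1 / k) h₁ h₂
    (fun w hw1 hw2 => ((hm w (hVs w hw1 hw2)).differentiableAt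
      (hVo.mem_nhds (hVs w hw1 hw2))).div_const _)
    (fun w hw hw1 hw2 => by
      have hne : w - w₀ ≠ 0 := sub_ne_zero.2 hw
      have hs := hS w (hVs w hw1 hw2).2
      have e1 : f w = F w / (k ^ 2 * (w - w₀) ^ 2) := by
        simp only [hf, hF]
        rw [← mul_sinhc]
        field_simp
      rw [e1, hFg w, hgm w, hg0]
      field_simp
      ring)
    (by
      have : 2 * k = 2 * Real.pi / h := by rw [hk]; ring
      linarith)
    (fun w hw1 hw2 hwT => by
      have hRb := hb w hw1 hw2
      have hX : |w.re| - |w₀.re| ≤ |w.re - w₀.re| := abs_sub_abs_le_abs_sub _ _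
      have hre : ((k : ℂ) * (w - w₀)).re = k * (w.re - w₀.re) := by simp
      have hre' : |((k : ℂ) * (w - w₀)).re| = k * |w.re - w₀.re| := by
        rw [hre, abs_mul, abs_of_pos hkpos]
      have h1 : 1 ≤ |((k : ℂ) * (w - w₀)).re| := by
        rw [hre']
        have : 1 / k ≤ |w.re - w₀.re| := by linarith
        rw [div_le_iff₀ hkpos] at this
        linarith
      have hsinh := exp_abs_re_le_four_mul_norm_sinh h1
      rw [hre'] at hsinh
      have hlow : Real.exp (k * |w.re| - k * |w₀.re|) / 4 ≤ ‖Complex.sinh (k * (w - w₀))‖ := by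
        have : Real.exp (k * |w.re| - k * |w₀.re|) ≤ Real.exp (k * |w.re - w₀.re|) := by
          apply Real.exp_le_exp.2
          nlinarith
        linarith
      have hpos : 0 < Real.exp (k * |w.re| - k * |w₀.re|) / 4 := by positivity
      calc ‖f w‖ = ‖R w‖ / ‖Complex.sinh (k * (w - w₀))‖ ^ 2 := by
            simp only [hf, norm_div, norm_pow]
        _ ≤ (C * Real.exp (κ * |w.re|)) / (Real.exp (k * |w.re| - k * |w₀.re|) / 4) ^ 2 := by
            gcongr
        _ = 16 * C * Real.exp (2 * k * |w₀.re|) * Real.exp (-((2 * k - κ) * |w.re|)) := by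
            have e3 : 2 * k * |w₀.re| + -((2 * k - κ) * |w.re|) = κ * |w.re| -
                ((k * |w.re| - k * |w₀.re|) + (k * |w.re| - k * |w₀.re|)) := by ring
            rw [mul_assoc (16 * C), ← Real.exp_add, e3]
            generalize k * |w.re| - k * |w₀.re| = X
            rw [Real.exp_sub, Real.exp_add]
            have := (Real.exp_pos X).ne'
            field_simp
            norm_num)
  have hperiod : ∀ u : ℝ, f (u + y₀ * I) = f (u + ((y₀ + h : ℝ) : ℂ) * I) := by
    intro u
    have e1 : (u + ((y₀ + h : ℝ) : ℂ) * I : ℂ) = (u + y₀ * I) + h * I := by push_cast; ring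
    have e2 : (k : ℂ) * ((u + y₀ * I) + h * I - w₀) = k * ((u + y₀ * I) - w₀) + Real.pi * I := by
      rw [← hkh]; push_cast; ring
    simp only [hf]
    rw [e1, hper _ (by simp), e2, Complex.sinh_add, Complex.sinh_mul_I, Complex.cosh_mul_I]
    simp
  simp only [hperiod, sub_self] at hres
  have hF' : deriv F w₀ = 0 := by
    have h2 := hres.symm
    simpa [Real.pi_ne_zero, hkpos.ne'] using h2
  have hRF : R =ᶠ[𝓝 w₀] fun w => F w * (sinhc (k * (w - w₀))) ^ 2 := by
    filter_upwards [hVo.mem_nhds hw₀] with w hw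
    have := hS w hw.2
    simp only [hF]
    field_simp
  -- The expansion of `sinhc` at 0 has no linear term, so F'(w₀) = 0 passes to R.
  have hS' : deriv (fun w => sinhc (k * (w - w₀))) w₀ = 0 := by
    obtain ⟨q, hq, hqe⟩ := exists_sinhc_eq
    have : (fun w => sinhc (k * (w - w₀))) = fun w => 1 + (w - w₀) ^ 2 * (k ^ 2 / 6 +
        k ^ 3 * (w - w₀) * q (k * (w - w₀))) := by
      funext w
      rw [hqe]
      ring
    rw [this]
    have hd2 : DifferentiableAt ℂ (fun w => (k ^ 2 / 6 : ℂ) +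
        k ^ 3 * (w - w₀) * q (k * (w - w₀))) w₀ := by fun_prop
    have h3 := (((((hasDerivAt_id w₀).sub_const w₀).pow 2).mul hd2.hasDerivAt).const_add 1).deriv
    simpa using h3
  rw [hRF.deriv_eq]
  have h3 := (((hFd w₀ hw₀).differentiableAt (hVo.mem_nhds hw₀)).hasDerivAt.mul
    ((hSd w₀).hasDerivAt.pow 2)).deriv
  rw [hF', hS'] at h3
  refine Eq.trans h3 ?_
  simp

/-! ### The exponent of the quantum dilogarithm: convergence, contour independence, holomorphy. -/

/-- A height at which a horizontal line separates the origin from the other poles of the integrand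
of the quantum dilogarithm in the upper half plane. -/
def AdmissibleHeight (β : ℂ) (ε : ℝ) : Prop :=
  0 < ε ∧ ε * ‖β‖ ^ 2 < Real.pi * β.re ∧ ε < Real.pi * β.re

/-- Half the width of the strip of convergence of the quantum dilogarithm. -/
noncomputable def dilogWidth (β : ℂ) : ℝ := (β + β⁻¹).re / 2

/-- The exponent of the quantum dilogarithm. -/
noncomputable def dilogLog (β z : ℂ) : ℂ :=
  ∫ u : ℝ, dilogIntegrand β z ((u : ℂ) + (dilogHeight β : ℂ) * I)

lemma faddeevDilog_eq (β z : ℂ) : faddeevDilog β z = cexp (dilogLog β z) := rfl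

lemma inv_re_pos {β : ℂ} (hβ : 0 < β.re) : 0 < β⁻¹.re := by
  rw [Complex.inv_re]
  exact div_pos hβ (normSq_pos.2 (ne_zero_of_re_pos hβ))

lemma dilogWidth_pos {β : ℂ} (hβ : 0 < β.re) : 0 < dilogWidth β := by
  have := inv_re_pos hβ
  rw [dilogWidth, Complex.add_re]
  linarith

lemma admissibleHeight_dilogHeight {β : ℂ} (hβ : 0 < β.re) :
    AdmissibleHeight β (dilogHeight β) := by
  have h1 : 0 < 1 + ‖β‖ ^ 2 := by positivity
  have h2 : 0 < ‖β‖ := norm_pos_iff.2 (ne_zero_of_re_pos hβ)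
  have h3 : 0 < Real.pi * β.re := mul_pos Real.pi_pos hβ
  refine ⟨by unfold dilogHeight; positivity, ?_, ?_⟩
  · rw [dilogHeight, div_mul_eq_mul_div, div_lt_iff₀ h1]
    nlinarith
  · rw [dilogHeight, div_lt_iff₀ h1]
    have : 0 < ‖β‖ ^ 2 := by positivity
    nlinarith

lemma mul_norm_inv_sq_lt {β : ℂ} (hβ : 0 < β.re) {ε : ℝ} (h : ε < Real.pi * β.re) :
    ε * ‖β⁻¹‖ ^ 2 < Real.pi * β⁻¹.re := by
  have h2 : 0 < normSq β := normSq_pos.2 (ne_zero_of_re_pos hβ)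
  rw [norm_inv, inv_pow, ← Complex.normSq_eq_norm_sq, Complex.inv_re, ← div_eq_mul_inv,
    ← mul_div_assoc]
  gcongr

lemma AdmissibleHeight.inv {β : ℂ} (hβ : 0 < β.re) {ε : ℝ} (h : AdmissibleHeight β ε) :
    AdmissibleHeight β⁻¹ ε := by
  refine ⟨h.1, mul_norm_inv_sq_lt hβ h.2.2, ?_⟩
  have h2 : 0 < normSq β := normSq_pos.2 (ne_zero_of_re_pos hβ)
  rw [Complex.inv_re, ← mul_div_assoc, lt_div_iff₀ h2, Complex.normSq_eq_norm_sq]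
  exact h.2.1

/-- The zeros of sinh(wβ) are w = πin/β, of imaginary part nπ Re β / |β|²; below the first of these
heights only n = 0 is left. -/
lemma sinh_mul_ne_zero {β w : ℂ} (hβ : 0 < β.re) (hw : w ≠ 0)
    (h : |w.im| * ‖β‖ ^ 2 < Real.pi * β.re) : Complex.sinh (w * β) ≠ 0 := by
  intro h0
  have hβ0 := ne_zero_of_re_pos hβ
  rw [Complex.sinh, div_eq_zero_iff, or_iff_left two_ne_zero, sub_eq_zero,
    Complex.exp_eq_exp_iff_exists_int] at h0
  obtain ⟨n, hn⟩ := h0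
  have hn' : w * β = n * (Real.pi * I) := by linear_combination hn / 2
  have hw' : w * (normSq β : ℂ) = n * Real.pi * (I * (starRingEnd ℂ) β) := by
    rw [← Complex.mul_conj, ← mul_assoc, hn']
    ring
  have him := congrArg Complex.im hw'
  rw [Complex.im_mul_ofReal, show (n : ℂ) * Real.pi = (((n : ℝ) * Real.pi : ℝ) : ℂ) by push_cast; rfl,
    Complex.im_ofReal_mul, Complex.I_mul_im, Complex.conj_re, Complex.normSq_eq_norm_sq] at him
  have hπβ : 0 < Real.pi * β.re := mul_pos Real.pi_pos hβ
  have habs : |w.im| * ‖β‖ ^ 2 = |(n : ℝ)| * (Real.pi * β.re) := by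
    rw [← abs_of_pos hπβ, ← abs_mul, ← mul_assoc, ← him, abs_mul, abs_of_nonneg (sq_nonneg ‖β‖)]
  rw [habs] at h
  have h1 : |(n : ℝ)| < 1 := by
    by_contra hge
    nlinarith [not_lt.1 hge]
  have hn0 : n = 0 := Int.abs_lt_one_iff.1 (by exact_mod_cast h1)
  rw [hn0, Int.cast_zero, zero_mul, mul_eq_zero] at hn'
  exact hn'.elim hw hβ0

lemma exp_le_four_mul_norm_sinh_mul {β w : ℂ} (hβ : 0 < β.re) {Y : ℝ} (hY : |w.im| ≤ Y)
    (h : Y * ‖β‖ + 1 ≤ |w.re| * β.re) :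
    Real.exp (|w.re| * β.re - Y * ‖β‖) ≤ 4 * ‖Complex.sinh (w * β)‖ := by
  have h1 : |w.re| * β.re - Y * ‖β‖ ≤ |(w * β).re| := by
    rw [Complex.mul_re]
    have e1 := abs_sub_abs_le_abs_sub (w.re * β.re) (w.im * β.im)
    rw [abs_mul, abs_of_pos hβ, abs_mul w.im] at e1
    have e2 : |w.im| * |β.im| ≤ Y * ‖β‖ :=
      mul_le_mul hY (Complex.abs_im_le_norm β) (abs_nonneg _) ((abs_nonneg _).trans hY)
    linarith
  exact (Real.exp_le_exp.2 h1).trans (exp_abs_re_le_four_mul_norm_sinh (by linarith))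

/-- For |u| ≤ U, compactness in (β, u) and the absence of zeros give a positive minimum; beyond U
the exponential bound takes over. Uniformity in β is needed to differentiate in the parameter. -/
lemma exists_le_norm_sinh_line {β₀ : ℂ} (hβ₀ : 0 < β₀.re) {y : ℝ} (hy : 0 < y)
    (h : y * ‖β₀‖ ^ 2 < Real.pi * β₀.re) :
    ∃ c : ℝ, 0 < c ∧ ∀ᶠ β in 𝓝 β₀, ∀ u : ℝ,
      c * Real.exp (|u| * β.re) ≤ ‖Complex.sinh ((u + y * I) * β)‖ := by
  have hev : ∀ᶠ β in 𝓝 β₀, β₀.re / 2 < β.re ∧ y * ‖β‖ ^ 2 < Real.pi * β.re ∧ ‖β‖ < ‖β₀‖ + 1 := by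
    refine ((continuous_re.tendsto β₀).eventually_const_lt (by linarith)).and
      ((?_ : ∀ᶠ β in 𝓝 β₀, _).and ((continuous_norm.tendsto β₀).eventually_lt_const (by linarith)))
    exact (ContinuousAt.eventually_lt (f := fun β : ℂ => y * ‖β‖ ^ 2)
      (g := fun β : ℂ => Real.pi * β.re) (by fun_prop) (by fun_prop) h)
  obtain ⟨r, hr, hball⟩ := Metric.nhds_basis_closedBall.eventually_iff.1 hev
  set B := ‖β₀‖ + 1 with hB
  have hBpos : 0 < B := by positivity
  -- Beyond U the real part of (u + iy)β has modulus at least 1 for every β in the ball, as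
  -- `exp_le_four_mul_norm_sinh_mul` requires.
  set U := (y * B + 1) / (β₀.re / 2) with hU
  have hρ : 0 < β₀.re / 2 := by linarith
  have hUpos : 0 < U := by positivity
  have hK : IsCompact (Metric.closedBall β₀ r ×ˢ Set.Icc (-U) U) :=
    (isCompact_closedBall _ _).prod isCompact_Icc
  have hKne : (Metric.closedBall β₀ r ×ˢ Set.Icc (-U) U).Nonempty :=
    ⟨(β₀, 0), Metric.mem_closedBall_self hr.le, by constructor <;> linarith⟩
  obtain ⟨⟨β₁, u₁⟩, hm₁, hmin⟩ := hK.exists_isMinOn hKne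
    (f := fun x : ℂ × ℝ => ‖Complex.sinh ((x.2 + y * I) * x.1)‖)
    (Continuous.continuousOn (by
      refine continuous_norm.comp (Complex.continuous_sinh.comp ?_)
      fun_prop))
  set m := ‖Complex.sinh ((u₁ + y * I) * β₁)‖ with hm
  have hmpos : 0 < m := by
    obtain ⟨hb1, hb2, -⟩ := hball hm₁.1
    refine norm_pos_iff.2 (sinh_mul_ne_zero (hρ.trans hb1) ?_ ?_)
    · intro h0
      have := congrArg Complex.im h0
      simp at this
      exact hy.ne' this
    · simpa [abs_of_pos hy] using hb2
  refine ⟨min (m * Real.exp (-(U * B))) (Real.exp (-(y * B)) / 4), by positivity, ?_⟩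
  filter_upwards [Metric.closedBall_mem_nhds β₀ hr] with β hβ u
  obtain ⟨hb1, hb2, hb3⟩ := hball hβ
  have hβpos : 0 < β.re := hρ.trans hb1
  rcases le_total |u| U with hu | hu
  · have h1 : m ≤ ‖Complex.sinh ((u + y * I) * β)‖ := hmin (a := (β, u)) ⟨hβ, abs_le.1 hu⟩
    have h2 : Real.exp (|u| * β.re) ≤ Real.exp (U * B) := by
      apply Real.exp_le_exp.2
      have := (Complex.re_le_norm β).trans hb3.le
      gcongr
    calc _ ≤ (m * Real.exp (-(U * B))) * Real.exp (U * B) := by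
          gcongr
          exact min_le_left _ _
      _ = m := by rw [mul_assoc, ← Real.exp_add]; simp
      _ ≤ _ := h1
  · have h1 : y * ‖β‖ + 1 ≤ |u| * β.re := by
      calc y * ‖β‖ + 1 ≤ y * B + 1 := by gcongr
        _ = U * (β₀.re / 2) := by rw [hU]; field_simp
        _ ≤ |u| * β.re := by gcongr
    have h2 := exp_le_four_mul_norm_sinh_mul (β := β) (w := u + y * I) hβpos (Y := y)
      (by simp [abs_of_pos hy]) (by simpa using h1)
    have h3 : (u + y * I : ℂ).re = u := by simp
    rw [h3] at h2
    have h4 : Real.exp (|u| * β.re - y * B) ≤ Real.exp (|u| * β.re - y * ‖β‖) := by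
      apply Real.exp_le_exp.2
      have : y * ‖β‖ ≤ y * B := by gcongr
      linarith
    calc _ ≤ (Real.exp (-(y * B)) / 4) * Real.exp (|u| * β.re) := by
          gcongr
          exact min_le_right _ _
      _ = Real.exp (|u| * β.re - y * B) / 4 := by
          rw [sub_eq_add_neg, Real.exp_add]; ring
      _ ≤ _ := by linarith

lemma norm_dilogIntegrand (β z w : ℂ) : ‖dilogIntegrand β z w‖ =
    Real.exp (2 * (z.re * w.im + z.im * w.re)) /
      (4 * ‖Complex.sinh (w * β)‖ * ‖Complex.sinh (w * β⁻¹)‖ * ‖w‖) := by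
  rw [dilogIntegrand, norm_div, Complex.norm_exp, norm_mul, norm_mul, norm_mul, div_eq_mul_inv w β]
  congr 2
  · simp
    ring
  · simp

lemma two_mul_dilogWidth (β : ℂ) : 2 * dilogWidth β = β.re + β⁻¹.re := by
  rw [dilogWidth, Complex.add_re]; ring

/-- The two sinh factors decay at total rate Re(β + β⁻¹) = 2 `dilogWidth β` against a numerator of
growth 2|Im z|. The factor exp(2ε Re z) is kept explicit because it makes the integral small as Re z
→ -∞. -/
lemma exists_norm_dilogIntegrand_le {β₀ : ℂ} (hβ₀ : 0 < β₀.re) {ε : ℝ}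
    (hε : AdmissibleHeight β₀ ε) :
    ∃ C : ℝ, 0 < C ∧ ∀ᶠ β in 𝓝 β₀, ∀ (z : ℂ) (u : ℝ), ‖dilogIntegrand β z (u + ε * I)‖ ≤
      C * Real.exp (2 * ε * z.re) * Real.exp (-(2 * (dilogWidth β - |z.im|) * |u|)) := by
  obtain ⟨c, hc, h1⟩ := exists_le_norm_sinh_line hβ₀ hε.1 hε.2.1
  obtain ⟨d, hd, h2⟩ := exists_le_norm_sinh_line (inv_re_pos hβ₀) hε.1 (hε.inv hβ₀).2.1
  have h2' := (continuousAt_inv₀ (ne_zero_of_re_pos hβ₀)).eventually h2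
  have hε0 := hε.1
  refine ⟨1 / (4 * c * d * ε), by positivity, ?_⟩
  filter_upwards [h1, h2'] with β hβ1 hβ2 z u
  have hw : ε ≤ ‖(u + ε * I : ℂ)‖ := by
    have := Complex.abs_im_le_norm (u + ε * I : ℂ)
    simpa [abs_of_pos hε0] using this
  rw [norm_dilogIntegrand]
  have him : (u + ε * I : ℂ).im = ε := by simp
  have hre : (u + ε * I : ℂ).re = u := by simp
  rw [him, hre]
  have hu : z.im * u ≤ |z.im| * |u| := by rw [← abs_mul]; exact le_abs_self _
  calc _ ≤ Real.exp (2 * (z.re * ε + |z.im| * |u|)) /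
        (4 * (c * Real.exp (|u| * β.re)) * (d * Real.exp (|u| * β⁻¹.re)) * ε) := by
        gcongr
        · exact hβ1 u
        · exact hβ2 u
    _ = 1 / (4 * c * d * ε) * (Real.exp (2 * (z.re * ε + |z.im| * |u|)) /
        (Real.exp (|u| * β.re) * Real.exp (|u| * β⁻¹.re))) := by
        field_simp
    _ = _ := by
        rw [← Real.exp_add, ← Real.exp_sub, mul_assoc (1 / _), ← Real.exp_add]
        congr 2
        have := two_mul_dilogWidth β
        linear_combination |u| * this

/-- The poles in |Im w| ≤ Y lie in a bounded region, so far out the bound is uniform over the strip.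
This controls contour moves, including those across the pole at 0. -/
lemma exists_norm_dilogIntegrand_le_tail {β : ℂ} (hβ : 0 < β.re) (z : ℂ) (Y : ℝ) :
    ∃ C T : ℝ, ∀ w : ℂ, |w.im| ≤ Y → T ≤ |w.re| →
      ‖dilogIntegrand β z w‖ ≤ C * Real.exp (-(2 * (dilogWidth β - |z.im|) * |w.re|)) := by
  have hβi := inv_re_pos hβ
  refine ⟨4 * Real.exp (2 * |z.re| * Y + Y * ‖β‖ + Y * ‖β⁻¹‖),
    max 1 (max ((Y * ‖β‖ + 1) / β.re) ((Y * ‖β⁻¹‖ + 1) / β⁻¹.re)), fun w hw hT => ?_⟩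
  have hT1 : 1 ≤ |w.re| := (le_max_left _ _).trans hT
  have hT2 : Y * ‖β‖ + 1 ≤ |w.re| * β.re :=
    (div_le_iff₀ hβ).1 (((le_max_left _ _).trans (le_max_right _ _)).trans hT)
  have hT3 : Y * ‖β⁻¹‖ + 1 ≤ |w.re| * β⁻¹.re :=
    (div_le_iff₀ hβi).1 (((le_max_right _ _).trans (le_max_right _ _)).trans hT)
  have h1 := exp_le_four_mul_norm_sinh_mul hβ hw hT2
  have h2 := exp_le_four_mul_norm_sinh_mul hβi hw hT3
  have h3 : 1 ≤ ‖w‖ := hT1.trans (Complex.abs_re_le_norm w)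
  have h4 : z.re * w.im + z.im * w.re ≤ |z.re| * Y + |z.im| * |w.re| := by
    refine add_le_add ?_ ?_
    · refine (le_abs_self _).trans ?_
      rw [abs_mul]
      gcongr
    · rw [← abs_mul]; exact le_abs_self _
  rw [norm_dilogIntegrand]
  calc _ ≤ Real.exp (2 * (|z.re| * Y + |z.im| * |w.re|)) /
        (4 * (Real.exp (|w.re| * β.re - Y * ‖β‖) / 4) *
          (Real.exp (|w.re| * β⁻¹.re - Y * ‖β⁻¹‖) / 4) * 1) := by
        gcongr
        · linarith
        · linarith
    _ = 4 * (Real.exp (2 * (|z.re| * Y + |z.im| * |w.re|)) /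
        (Real.exp (|w.re| * β.re - Y * ‖β‖) * Real.exp (|w.re| * β⁻¹.re - Y * ‖β⁻¹‖))) := by
        have e1 := (Real.exp_pos (|w.re| * β.re - Y * ‖β‖)).ne'
        have e2 := (Real.exp_pos (|w.re| * β⁻¹.re - Y * ‖β⁻¹‖)).ne'
        field_simp
    _ = _ := by
        rw [← Real.exp_add, ← Real.exp_sub, mul_assoc, ← Real.exp_add]
        congr 2
        have := two_mul_dilogWidth β
        linear_combination |w.re| * this

lemma dilogIntegrand_denom_ne_zero {β w : ℂ} (hβ : 0 < β.re) (hw : w ≠ 0)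
    (h1 : |w.im| * ‖β‖ ^ 2 < Real.pi * β.re) (h2 : |w.im| < Real.pi * β.re) :
    4 * Complex.sinh (w * β) * Complex.sinh (w / β) * w ≠ 0 := by
  have e1 := sinh_mul_ne_zero hβ hw h1
  have e2 := sinh_mul_ne_zero (inv_re_pos hβ) hw (mul_norm_inv_sq_lt hβ h2)
  rw [← div_eq_mul_inv] at e2
  exact mul_ne_zero (mul_ne_zero (mul_ne_zero (by norm_num) e1) e2) hw

lemma AdmissibleHeight.denom_ne_zero {β : ℂ} {ε : ℝ} (h : AdmissibleHeight β ε) (u : ℝ) :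
    4 * Complex.sinh ((u + ε * I) * β) * Complex.sinh ((u + ε * I) / β) * (u + ε * I) ≠ 0 := by
  have hβ : 0 < β.re := pos_of_mul_pos_right (h.1.trans h.2.2) Real.pi_pos.le
  refine dilogIntegrand_denom_ne_zero hβ ?_ ?_ ?_
  · intro h0
    have := congrArg Complex.im h0
    simp at this
    exact h.1.ne' this
  · simpa [abs_of_pos h.1] using h.2.1
  · simpa [abs_of_pos h.1] using h.2.2

lemma AdmissibleHeight.continuous_dilogIntegrand {β : ℂ} {ε : ℝ} (h : AdmissibleHeight β ε)
    (z : ℂ) : Continuous (fun u : ℝ => dilogIntegrand β z (u + ε * I)) := by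
  unfold dilogIntegrand
  have hs := Complex.continuous_sinh
  refine Continuous.div (by fun_prop) ?_ (fun u => h.denom_ne_zero u)
  exact ((continuous_const.mul (hs.comp (by fun_prop))).mul (hs.comp (by fun_prop))).mul
    (by fun_prop)

lemma AdmissibleHeight.integrable {β : ℂ} {ε : ℝ} (h : AdmissibleHeight β ε) {z : ℂ}
    (hz : |z.im| < dilogWidth β) : Integrable (fun u : ℝ => dilogIntegrand β z (u + ε * I)) := by
  have hβ : 0 < β.re := pos_of_mul_pos_right (h.1.trans h.2.2) Real.pi_pos.le
  obtain ⟨C, T, hb⟩ := exists_norm_dilogIntegrand_le_tail hβ z ε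
  refine integrable_of_norm_le_exp_neg_mul_abs (h.continuous_dilogIntegrand z)
    (κ := 2 * (dilogWidth β - |z.im|)) (C := C) (T₀ := T) (by linarith) fun u hu => ?_
  simpa using hb (u + ε * I) (by simp [abs_of_pos h.1]) (by simpa using hu)

lemma differentiableAt_dilogIntegrand {β z w : ℂ}
    (h : 4 * Complex.sinh (w * β) * Complex.sinh (w / β) * w ≠ 0) :
    DifferentiableAt ℂ (dilogIntegrand β z) w := by
  unfold dilogIntegrand
  have hs := Complex.differentiable_sinh
  refine DifferentiableAt.div (by fun_prop) ?_ h
  fun_prop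

lemma dilogInt_eq_of_lt {β z : ℂ} {ε₁ ε₂ : ℝ} (h₁ : AdmissibleHeight β ε₁)
    (h₂ : AdmissibleHeight β ε₂) (hlt : ε₁ < ε₂) (hz : |z.im| < dilogWidth β) :
    ∫ u : ℝ, dilogIntegrand β z (u + ε₁ * I) = ∫ u : ℝ, dilogIntegrand β z (u + ε₂ * I) := by
  have hβ : 0 < β.re := pos_of_mul_pos_right (h₁.1.trans h₁.2.2) Real.pi_pos.le
  obtain ⟨C, T, hb⟩ := exists_norm_dilogIntegrand_le_tail hβ z ε₂
  refine integral_line_eq_integral_line hlt (fun w hw1 hw2 => ?_)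
    (κ := 2 * (dilogWidth β - |z.im|)) (C := C) (T₀ := T) (by linarith) fun w hw1 hw2 hw3 => ?_
  · have hpos : 0 < w.im := h₁.1.trans_le hw1
    refine differentiableAt_dilogIntegrand (dilogIntegrand_denom_ne_zero hβ ?_ ?_ ?_)
    · rintro rfl
      simp at hpos
    · rw [abs_of_pos hpos]
      exact (mul_le_mul_of_nonneg_right hw2 (by positivity)).trans_lt h₂.2.1
    · rw [abs_of_pos hpos]
      exact hw2.trans_lt h₂.2.2
  · exact hb w (by rw [abs_of_pos (h₁.1.trans_le hw1)]; exact hw2) hw3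

/-- The height in the definition of `dilogLog` varies with β and not holomorphically. Admissibility
is an open condition on β, so one fixed height serves all nearby parameters. -/
lemma AdmissibleHeight.dilogLog_eq {β z : ℂ} {ε : ℝ} (h : AdmissibleHeight β ε)
    (hz : |z.im| < dilogWidth β) :
    dilogLog β z = ∫ u : ℝ, dilogIntegrand β z (u + ε * I) := by
  have hβ : 0 < β.re := pos_of_mul_pos_right (h.1.trans h.2.2) Real.pi_pos.le
  have h' := admissibleHeight_dilogHeight hβ
  rcases lt_trichotomy (dilogHeight β) ε with hlt | heq | hlt
  · exact dilogInt_eq_of_lt h' h hlt hz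
  · rw [dilogLog, heq]
  · exact (dilogInt_eq_of_lt h h' hlt hz).symm

lemma AdmissibleHeight.eventually {β₀ : ℂ} {ε : ℝ} (h : AdmissibleHeight β₀ ε) :
    ∀ᶠ β in 𝓝 β₀, AdmissibleHeight β ε := by
  have h1 := ContinuousAt.eventually_lt (f := fun β : ℂ => ε * ‖β‖ ^ 2)
    (g := fun β : ℂ => Real.pi * β.re) (x₀ := β₀) (by fun_prop) (by fun_prop) h.2.1
  have h2 := ContinuousAt.eventually_lt (f := fun _ : ℂ => ε)
    (g := fun β : ℂ => Real.pi * β.re) (x₀ := β₀) (by fun_prop) (by fun_prop) h.2.2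
  filter_upwards [h1, h2] with β e1 e2
  exact ⟨h.1, e1, e2⟩

lemma continuousAt_dilogWidth {β₀ : ℂ} (hβ₀ : 0 < β₀.re) : ContinuousAt dilogWidth β₀ := by
  have := continuousAt_inv₀ (ne_zero_of_re_pos hβ₀)
  exact (continuous_re.continuousAt.comp (continuousAt_id.add this)).div_const 2

/-- The exponent of the quantum dilogarithm decays as the real part of the argument tends to `-∞`,
locally uniformly in the parameter. -/
lemma exists_norm_dilogLog_le {β₀ : ℂ} (hβ₀ : 0 < β₀.re) {κ : ℝ} (hκ : 0 < κ) :
    ∃ M ε : ℝ, 0 < M ∧ 0 < ε ∧ ∀ᶠ β in 𝓝 β₀, ∀ z : ℂ, κ ≤ dilogWidth β - |z.im| →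
      ‖dilogLog β z‖ ≤ M * Real.exp (2 * ε * z.re) := by
  have hε := admissibleHeight_dilogHeight hβ₀
  obtain ⟨C, hC, hb⟩ := exists_norm_dilogIntegrand_le hβ₀ hε
  set ε := dilogHeight β₀
  have hint : Integrable (fun u : ℝ => Real.exp (-(2 * κ * |u|))) :=
    integrable_exp_neg_mul_abs (by positivity)
  have hnn : 0 ≤ ∫ u : ℝ, Real.exp (-(2 * κ * |u|)) := integral_nonneg fun u => (Real.exp_pos _).le
  refine ⟨C * ((∫ u : ℝ, Real.exp (-(2 * κ * |u|))) + 1), ε, by positivity, hε.1, ?_⟩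
  filter_upwards [hb, hε.eventually] with β h1 h2 z hz
  rw [h2.dilogLog_eq (by linarith)]
  have h3 : ‖∫ u : ℝ, dilogIntegrand β z (u + ε * I)‖ ≤
      ∫ u : ℝ, C * Real.exp (2 * ε * z.re) * Real.exp (-(2 * κ * |u|)) := by
    refine norm_integral_le_of_norm_le (hint.const_mul _) (ae_of_all _ fun u => ?_)
    refine (h1 z u).trans ?_
    gcongr
  rw [integral_const_mul] at h3
  refine h3.trans ?_
  have : 0 < C * Real.exp (2 * ε * z.re) := by positivity
  nlinarith

/-- The exponent of the quantum dilogarithm is holomorphic in its parameter and its argument. -/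
lemma differentiableAt_dilogLog_comp {B Z : ℂ → ℂ} {ξ₀ : ℂ}
    (hB : ∀ᶠ ξ in 𝓝 ξ₀, DifferentiableAt ℂ B ξ) (hZ : ∀ᶠ ξ in 𝓝 ξ₀, DifferentiableAt ℂ Z ξ)
    (hβ : 0 < (B ξ₀).re) (hz : |(Z ξ₀).im| < dilogWidth (B ξ₀)) :
    DifferentiableAt ℂ (fun ξ => dilogLog (B ξ) (Z ξ)) ξ₀ := by
  have hBc : ContinuousAt B ξ₀ := hB.self_of_nhds.continuousAt
  have hZc : ContinuousAt Z ξ₀ := hZ.self_of_nhds.continuousAt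
  have hε := admissibleHeight_dilogHeight hβ
  obtain ⟨C, hC, hb⟩ := exists_norm_dilogIntegrand_le hβ hε
  set ε := dilogHeight (B ξ₀)
  have hadm := hBc.eventually hε.eventually
  have hbB := hBc.eventually hb
  obtain ⟨κ, hκ, hκ'⟩ : ∃ κ : ℝ, 0 < κ ∧ |(Z ξ₀).im| + κ < dilogWidth (B ξ₀) :=
    ⟨(dilogWidth (B ξ₀) - |(Z ξ₀).im|) / 2, by linarith, by linarith⟩
  have hw : ∀ᶠ ξ in 𝓝 ξ₀, |(Z ξ).im| + κ < dilogWidth (B ξ) :=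
    ContinuousAt.eventually_lt (by fun_prop)
      (ContinuousAt.comp (g := dilogWidth) (continuousAt_dilogWidth hβ) hBc) hκ'
  have hre : ∀ᶠ ξ in 𝓝 ξ₀, (Z ξ).re < (Z ξ₀).re + 1 :=
    (continuous_re.continuousAt.comp hZc).eventually_lt_const
      (show (Z ξ₀).re < (Z ξ₀).re + 1 by linarith)
  -- The contour is frozen at the height belonging to B(ξ₀); the integrand is then holomorphic in ξ.
  have heq : (fun ξ => dilogLog (B ξ) (Z ξ)) =ᶠ[𝓝 ξ₀]
      fun ξ => ∫ u : ℝ, dilogIntegrand (B ξ) (Z ξ) (u + ε * I) := by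
    filter_upwards [hadm, hw] with ξ h1 h2
    exact h1.dilogLog_eq (by linarith)
  refine DifferentiableAt.congr_of_eventuallyEq ?_ heq
  refine (hasDerivAt_integral_of_holomorphic
    (g := fun u => C * Real.exp (2 * ε * ((Z ξ₀).re + 1)) * Real.exp (-(2 * κ * |u|)))
    ?_ ?_ ?_ ((integrable_exp_neg_mul_abs (by positivity)).const_mul _)).differentiableAt
  · filter_upwards [hadm, hB, hZ] with ξ h1 h2 h3 u
    have hB0 : B ξ ≠ 0 :=
      ne_zero_of_re_pos (pos_of_mul_pos_right (h1.1.trans h1.2.2) Real.pi_pos.le)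
    unfold dilogIntegrand
    have hs := Complex.differentiable_sinh
    refine DifferentiableAt.div (by fun_prop) ?_ (h1.denom_ne_zero u)
    have hq : DifferentiableAt ℂ (fun ξ => (u + ε * I : ℂ) / B ξ) ξ :=
      (differentiableAt_const _).div h2 hB0
    have hs1 : DifferentiableAt ℂ (fun ξ => Complex.sinh ((u + ε * I : ℂ) / B ξ)) ξ := hq.csinh
    have hs2 : DifferentiableAt ℂ (fun ξ => Complex.sinh ((u + ε * I : ℂ) * B ξ)) ξ :=
      (h2.const_mul _).csinh
    exact (((hs2.const_mul 4).mul hs1).mul_const _)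
  · filter_upwards [hadm] with ξ h1
    exact (h1.continuous_dilogIntegrand _).aestronglyMeasurable
  · filter_upwards [hbB, hw, hre] with ξ h1 h2 h3 u
    refine (h1 _ u).trans ?_
    have := hε.1
    gcongr
    linarith

lemma differentiableAt_dilogLog {β z : ℂ} (hβ : 0 < β.re) (hz : |z.im| < dilogWidth β) :
    DifferentiableAt ℂ (dilogLog β) z :=
  differentiableAt_dilogLog_comp (B := fun _ => β) (Z := fun z => z)
    (Eventually.of_forall fun _ => differentiableAt_const _)
    (Eventually.of_forall fun _ => differentiableAt_id) hβ hz

/-! ### Inversion and unitarity. -/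

/-- At the triple pole of the integrand only the coefficient of w² enters the residue; everything
from w³ on goes into the remainder. -/
lemma exists_sinhc_mul_sinhc_eq (β : ℂ) : ∃ M : ℂ → ℂ, Differentiable ℂ M ∧
    ∀ w, sinhc (w * β) * sinhc (w / β) =
      1 + (β ^ 2 + β⁻¹ ^ 2) / 6 * w ^ 2 + w ^ 3 * M w := by
  obtain ⟨m, hm, hme⟩ := exists_sinhc_eq
  have h1 : Differentiable ℂ (fun w => m (w * β)) := hm.comp (by fun_prop)
  have h2 : Differentiable ℂ (fun w => m (w / β)) := hm.comp (by fun_prop)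
  refine ⟨fun w => β ^ 3 * m (w * β) + β⁻¹ ^ 3 * m (w / β) +
    w * ((β ^ 2 / 6 + w * β ^ 3 * m (w * β)) * (β⁻¹ ^ 2 / 6 + w * β⁻¹ ^ 3 * m (w / β))),
    by fun_prop, fun w => ?_⟩
  rw [hme, hme]
  ring

/-- The inversion relation of the quantum dilogarithm. -/
theorem dilogLog_add_dilogLog_neg {β z : ℂ} (hβ : 0 < β.re) (hz : |z.im| < dilogWidth β) :
    dilogLog β z + dilogLog β (-z) = Real.pi * I * (z ^ 2 + ((β + β⁻¹) ^ 2 - 2) / 12) := by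
  have hβ0 := Complex.ne_zero_of_re_pos hβ
  have hε := admissibleHeight_dilogHeight hβ
  have hz' : |(-z).im| < dilogWidth β := by simpa using hz
  set ε := dilogHeight β with hεd
  set f : ℂ → ℂ := fun w => dilogIntegrand β z w + dilogIntegrand β (-z) w with hf
  obtain ⟨M, hM, hS⟩ := exists_sinhc_mul_sinhc_eq β
  obtain ⟨n, hn, hcos⟩ := exists_cos_eq
  set s : ℂ := (β ^ 2 + β⁻¹ ^ 2) / 6 with hs
  -- The residue at 0 of cos(2zw) / (2w³S(w)), where S(w) = 1 + sw² + O(w³).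
  set a : ℂ := -z ^ 2 - s / 2 with ha
  set S : ℂ → ℂ := fun w => sinhc (w * β) * sinhc (w / β) with hSd
  have hdS : Differentiable ℂ S :=
    (differentiable_sinhc.comp (by fun_prop)).mul (differentiable_sinhc.comp (by fun_prop))
  have hdn : Differentiable ℂ (fun w => n (2 * z * w)) := hn.comp (by fun_prop)
  have hnz : ∀ w : ℂ, w ≠ 0 → -ε ≤ w.im → w.im ≤ ε →
      4 * Complex.sinh (w * β) * Complex.sinh (w / β) * w ≠ 0 := by
    intro w hw h1 h2
    have habs : |w.im| ≤ ε := abs_le.2 ⟨h1, h2⟩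
    exact dilogIntegrand_denom_ne_zero hβ hw
      ((mul_le_mul_of_nonneg_right habs (by positivity)).trans_lt hε.2.1) (habs.trans_lt hε.2.2)
  have hS0 : ∀ w : ℂ, -ε ≤ w.im → w.im ≤ ε → S w ≠ 0 := by
    intro w h1 h2
    refine mul_ne_zero (sinhc_ne_zero fun h => ?_) (sinhc_ne_zero fun h => ?_)
    · have := hnz w (left_ne_zero_of_mul h) h1 h2
      exact right_ne_zero_of_mul (left_ne_zero_of_mul (left_ne_zero_of_mul this))
    · have hw : w ≠ 0 := by rintro rfl; simp at h
      exact right_ne_zero_of_mul (left_ne_zero_of_mul (hnz w hw h1 h2))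
  obtain ⟨C₁, T₁, hb₁⟩ := exists_norm_dilogIntegrand_le_tail hβ z ε
  obtain ⟨C₂, T₂, hb₂⟩ := exists_norm_dilogIntegrand_le_tail hβ (-z) ε
  have hε0 := hε.1
  obtain ⟨-, hint, hres⟩ := integral_line_sub_integral_line (f := f)
    (g := fun w => (4 * z ^ 3 * n (2 * z * w) - M w / 2 - a * s * w - a * w ^ 2 * M w) / S w)
    (y₁ := -ε) (y₂ := ε) (p := 0) (c₁ := a) (c₂ := 0) (c₃ := 1 / 2)
    (C := C₁ + C₂) (κ := 2 * (dilogWidth β - |z.im|)) (T₀ := max T₁ T₂)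
    (by simpa using hε0) (by simpa using hε0)
    (fun w h1 h2 => DifferentiableAt.div (by fun_prop) (hdS w) (hS0 w h1 h2))
    (fun w hw h1 h2 => by
      have e1 : f w = Complex.cos (2 * z * w) / (2 * w ^ 3 * S w) := by
        simp only [hf, dilogIntegrand, hSd]
        rw [← add_div, ← mul_sinhc (w * β), ← mul_sinhc (w / β), Complex.cos,
          show -2 * I * z * w = -(2 * z * w) * I by ring,
          show -2 * I * -z * w = (2 * z * w) * I by ring]
        have q1 : sinhc (w * β) ≠ 0 := left_ne_zero_of_mul (hS0 w h1 h2)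
        have q2 : sinhc (w / β) ≠ 0 := right_ne_zero_of_mul (hS0 w h1 h2)
        field_simp
        ring
      have e2 := hS0 w h1 h2
      have e3 := hS w
      have e4 := hcos (2 * z * w)
      change S w = _ at e3
      rw [e1, sub_zero]
      field_simp
      rw [e4, e3, ha]
      ring)
    (by linarith)
    (fun w h1 h2 h3 => by
      have habs : |w.im| ≤ ε := abs_le.2 ⟨h1, h2⟩
      have b1 := hb₁ w habs ((le_max_left _ _).trans h3)
      have b2 := hb₂ w habs ((le_max_right _ _).trans h3)
      rw [Complex.neg_im, abs_neg] at b2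
      refine (norm_add_le _ _).trans ?_
      rw [add_mul]
      exact add_le_add b1 b2)
  have hsum : dilogLog β z + dilogLog β (-z) = ∫ u : ℝ, f (u + ε * I) := by
    rw [hε.dilogLog_eq hz, hε.dilogLog_eq hz', ← integral_add (hε.integrable hz)
      (hε.integrable hz')]
  -- Oddness makes the integral along height -ε the negative of that along ε, so the latter is -πi
  -- times the residue.
  have hodd : ∀ w, f (-w) = -f w := by
    intro w
    simp only [hf, dilogIntegrand, neg_mul, neg_div, Complex.sinh_neg, mul_neg, neg_neg, div_neg]
    ring
  have hneg : ∫ u : ℝ, f (u + ((-ε : ℝ) : ℂ) * I) = -∫ u : ℝ, f (u + ε * I) := by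
    rw [← integral_neg, ← integral_neg_eq_self]
    refine integral_congr_ae (ae_of_all _ fun u => ?_)
    simp only
    rw [← hodd]
    congr 1
    push_cast
    ring
  rw [hneg] at hres
  rw [hsum]
  have hββ : β * β⁻¹ = 1 := mul_inv_cancel₀ hβ0
  rw [ha, hs] at hres
  linear_combination -(1 / 2) * hres + (-(Real.pi * I) / 6) * hββ

/-- Unitarity of the quantum dilogarithm for the physical values of the parameter. -/
theorem conj_dilogLog {β : ℂ} (hβ : (starRingEnd ℂ) β = β ∨ (starRingEnd ℂ) β = β⁻¹) (z : ℂ) :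
    (starRingEnd ℂ) (dilogLog β z) = -dilogLog β ((starRingEnd ℂ) z) := by
  rw [dilogLog, dilogLog, ← integral_conj, ← integral_neg, ← integral_neg_eq_self]
  refine integral_congr_ae (ae_of_all _ fun u => ?_)
  simp only [dilogIntegrand]
  -- After u ↦ -u, conjugation sends the point w of the contour to -w. The product of the two sinh
  -- is unchanged, since β and β⁻¹ are each fixed or are exchanged; the remaining factor w changes
  -- sign.
  have hw : (starRingEnd ℂ) (((-u : ℝ) : ℂ) + (dilogHeight β : ℂ) * I) =
      -((u : ℂ) + (dilogHeight β : ℂ) * I) := by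
    simp
    ring
  have hsinh : (starRingEnd ℂ) (Complex.sinh ((((-u : ℝ) : ℂ) + (dilogHeight β : ℂ) * I) * β)) *
      (starRingEnd ℂ) (Complex.sinh ((((-u : ℝ) : ℂ) + (dilogHeight β : ℂ) * I) / β)) =
      Complex.sinh (((u : ℂ) + (dilogHeight β : ℂ) * I) * β) *
        Complex.sinh (((u : ℂ) + (dilogHeight β : ℂ) * I) / β) := by
    rw [← Complex.sinh_conj, ← Complex.sinh_conj, map_mul, map_div₀, hw]
    rcases hβ with h | h
    · rw [h, neg_mul, neg_div, Complex.sinh_neg, Complex.sinh_neg]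
      ring
    · rw [h, neg_mul, neg_div, div_inv_eq_mul, Complex.sinh_neg, Complex.sinh_neg,
        ← div_eq_mul_inv]
      ring
  rw [map_div₀, ← Complex.exp_conj, map_mul, map_mul, map_mul, map_mul, map_mul, map_mul, hw]
  have h4 : (starRingEnd ℂ) (4 : ℂ) = 4 := Complex.conj_ofNat 4
  rw [mul_assoc ((starRingEnd ℂ) 4), hsinh, h4, ← div_neg]
  congr 1
  · congr 1
    rw [map_neg, Complex.conj_I, Complex.conj_ofNat]
    ring
  · ring

lemma dilogWidth_inv (β : ℂ) : dilogWidth β⁻¹ = dilogWidth β := by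
  rw [dilogWidth, dilogWidth, inv_inv, add_comm]

lemma dilogLog_inv {β z : ℂ} (hβ : 0 < β.re) (hz : |z.im| < dilogWidth β) :
    dilogLog β⁻¹ z = dilogLog β z := by
  have h := admissibleHeight_dilogHeight hβ
  rw [(h.inv hβ).dilogLog_eq (by rwa [dilogWidth_inv]), h.dilogLog_eq hz]
  refine integral_congr_ae (ae_of_all _ fun u => ?_)
  simp only [dilogIntegrand, div_eq_mul_inv, inv_inv]
  ring

lemma dilogWidth_ofReal (b : ℝ) : dilogWidth (b : ℂ) = (b + b⁻¹) / 2 := by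
  rw [dilogWidth, ← Complex.ofReal_inv, ← Complex.ofReal_add, Complex.ofReal_re]

/-! ### The functional equation for a positive parameter. -/

/-- The Fourier transform of the reciprocal of the hyperbolic sine along a shifted line. -/
lemma integral_exp_div_sinh {b : ℝ} (hb : 0 < b) {ε : ℝ} (hε : 0 < ε) (hεb : ε < Real.pi * b)
    {z : ℂ} (hz : |z.im| < 1 / (2 * b)) :
    (∫ u : ℝ, cexp (-2 * I * z * (u + ε * I)) / Complex.sinh ((u + ε * I) * (b⁻¹ : ℝ))) *
      (1 + cexp (-(2 * Real.pi * b * z))) = -(2 * Real.pi * I * b) := by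
  have hbi : 0 < b⁻¹ := inv_pos.2 hb
  have hbc : (b : ℂ) ≠ 0 := by exact_mod_cast hb.ne'
  have hre : 0 < ((b⁻¹ : ℝ) : ℂ).re := by simpa using hb
  set f : ℂ → ℂ := fun w => cexp (-2 * I * z * w) / Complex.sinh (w * (b⁻¹ : ℝ)) with hf
  set V : Set ℂ := {w | |w.im| < Real.pi * b} with hV
  have hVo : IsOpen V := isOpen_lt (by fun_prop) continuous_const
  have hs : ∀ w ∈ V, w ≠ 0 → Complex.sinh (w * (b⁻¹ : ℝ)) ≠ 0 := by
    intro w hw hw0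
    refine sinh_mul_ne_zero hre hw0 ?_
    have hw' : |w.im| < Real.pi * b := hw
    rw [Complex.norm_real, Real.norm_eq_abs, abs_of_pos hbi, Complex.ofReal_re]
    calc |w.im| * b⁻¹ ^ 2 < Real.pi * b * b⁻¹ ^ 2 := by gcongr
      _ = Real.pi * b⁻¹ := by field_simp
  have hsc : ∀ w ∈ V, sinhc (w * (b⁻¹ : ℝ)) ≠ 0 := fun w hw =>
    sinhc_ne_zero fun h => hs w hw (left_ne_zero_of_mul h)
  have hsd : Differentiable ℂ (fun w : ℂ => sinhc (w * (b⁻¹ : ℝ))) :=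
    differentiable_sinhc.comp (differentiable_id.mul_const _)
  have hFd : DifferentiableOn ℂ (fun w => b * cexp (-2 * I * z * w) / sinhc (w * (b⁻¹ : ℝ))) V := by
    intro w hw
    have hnum : DifferentiableAt ℂ (fun w => b * cexp (-2 * I * z * w)) w := by fun_prop
    exact (hnum.div (hsd w) (hsc w hw)).differentiableWithinAt
  have h0V : (0 : ℂ) ∈ V := by
    have := mul_pos Real.pi_pos hb
    simpa [hV] using this
  obtain ⟨g, hg, -, hFg⟩ := exists_differentiableOn_eq_add_mul hVo hFd h0V
  have hstrip : ∀ w : ℂ, ε - Real.pi * b ≤ w.im → w.im ≤ ε → w ∈ V := fun w h1 h2 =>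
    show |w.im| < Real.pi * b from abs_lt.2 ⟨by linarith, by linarith⟩
  have hκ : 0 < b⁻¹ - 2 * |z.im| := by
    have : 2 * (1 / (2 * b)) = b⁻¹ := by field_simp
    linarith
  -- Between the two lines, at distance πb, the only pole is 0, with residue b; the lower integral
  -- is a multiple of the upper one by quasi-periodicity.
  obtain ⟨-, -, hres⟩ := integral_line_sub_integral_line (f := f) (g := g)
    (y₁ := ε - Real.pi * b) (y₂ := ε) (p := 0) (c₁ := b) (c₂ := 0) (c₃ := 0)
    (C := 4 * Real.exp (2 * |z.re| * (Real.pi * b) + Real.pi * b * ‖((b⁻¹ : ℝ) : ℂ)‖))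
    (κ := b⁻¹ - 2 * |z.im|) (T₀ := (Real.pi * b * ‖((b⁻¹ : ℝ) : ℂ)‖ + 1) * b)
    (by simpa using hεb) (by simpa using hε)
    (fun w h1 h2 => (hg w (hstrip w h1 h2)).differentiableAt (hVo.mem_nhds (hstrip w h1 h2)))
    (fun w hw h1 h2 => by
      have e1 := hFg w
      have e2 := hsc w (hstrip w h1 h2)
      simp only [hf, ← mul_sinhc]
      have e3 : cexp (-2 * I * z * w) / (w * (b⁻¹ : ℝ) * sinhc (w * (b⁻¹ : ℝ))) =
          b * cexp (-2 * I * z * w) / sinhc (w * (b⁻¹ : ℝ)) / w := by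
        push_cast
        field_simp
      rw [e3, e1]
      simp only [mul_zero, Complex.exp_zero, mul_one, zero_mul, sinhc_zero, div_one, sub_zero]
      field_simp
      ring)
    hκ
    (fun w h1 h2 h3 => by
      have hY : |w.im| ≤ Real.pi * b := (show |w.im| < Real.pi * b from hstrip w h1 h2).le
      have hlow := exp_le_four_mul_norm_sinh_mul hre hY (by
        rw [Complex.ofReal_re, ← div_eq_mul_inv, le_div_iff₀ hb]
        exact h3)
      rw [Complex.ofReal_re] at hlow
      have h4 : z.re * w.im + z.im * w.re ≤ |z.re| * (Real.pi * b) + |z.im| * |w.re| := by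
        refine add_le_add ?_ ?_
        · refine (le_abs_self _).trans ?_
          rw [abs_mul]
          gcongr
        · rw [← abs_mul]; exact le_abs_self _
      have h5 : ‖cexp (-2 * I * z * w)‖ = Real.exp (2 * (z.re * w.im + z.im * w.re)) := by
        rw [Complex.norm_exp]
        congr 1
        simp
        ring
      simp only [hf]
      rw [norm_div, h5]
      calc _ ≤ Real.exp (2 * (|z.re| * (Real.pi * b) + |z.im| * |w.re|)) /
            (Real.exp (|w.re| * b⁻¹ - Real.pi * b * ‖((b⁻¹ : ℝ) : ℂ)‖) / 4) := by
            gcongr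
            linarith
        _ = 4 * (Real.exp (2 * (|z.re| * (Real.pi * b) + |z.im| * |w.re|)) /
            Real.exp (|w.re| * b⁻¹ - Real.pi * b * ‖((b⁻¹ : ℝ) : ℂ)‖)) := by
            field_simp
        _ = _ := by
            rw [← Real.exp_sub, mul_assoc 4 (Real.exp _), ← Real.exp_add]
            congr 2
            ring)
  have hshift : ∀ u : ℝ, f (u + ((ε - Real.pi * b : ℝ) : ℂ) * I) =
      -cexp (-(2 * Real.pi * b * z)) * f (u + ε * I) := by
    intro u
    have e1 : (u + ((ε - Real.pi * b : ℝ) : ℂ) * I) * (b⁻¹ : ℝ) =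
        (u + ε * I) * (b⁻¹ : ℝ) - Real.pi * I := by
      push_cast
      field_simp
      ring
    have e2 : -2 * I * z * (u + ((ε - Real.pi * b : ℝ) : ℂ) * I) =
        -(2 * Real.pi * b * z) + -2 * I * z * (u + ε * I) := by
      push_cast
      linear_combination (2 * z * Real.pi * b) * I_mul_I
    simp only [hf]
    rw [e1, e2, Complex.exp_add, Complex.sinh_sub, Complex.sinh_mul_I, Complex.cosh_mul_I]
    simp only [← Complex.ofReal_sin, ← Complex.ofReal_cos, Real.sin_pi, Real.cos_pi]
    simp [div_neg]
    ring
  simp only [hshift] at hres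
  rw [integral_const_mul] at hres
  linear_combination -hres

lemma norm_exp_neg_two_I_mul (z w : ℂ) :
    ‖cexp (-2 * I * z * w)‖ = Real.exp (2 * (z.re * w.im + z.im * w.re)) := by
  rw [Complex.norm_exp]
  congr 1
  simp
  ring

/-- The numerators differ by the factor e^{-wb} - e^{wb} = -2 sinh(wb), which cancels one sinh of
the denominator. -/
lemma dilogLog_sub_dilogLog_eq {b : ℝ} (hb : 0 < b) {z : ℂ} (hz : |z.im| < 1 / (2 * b)) :
    dilogLog b (z - I * b / 2) - dilogLog b (z + I * b / 2) =
      ∫ u : ℝ, -(cexp (-2 * I * z * (u + dilogHeight b * I)) / (2 * (u + dilogHeight b * I) *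
        Complex.sinh ((u + dilogHeight b * I) * (b⁻¹ : ℝ)))) := by
  have hre : 0 < (b : ℂ).re := by simpa using hb
  have hε := admissibleHeight_dilogHeight hre
  have hw : |z.im| + b / 2 < dilogWidth b := by
    rw [dilogWidth_ofReal]
    have : 1 / (2 * b) = b⁻¹ / 2 := by field_simp
    linarith
  have h1 : |(z - I * b / 2).im| < dilogWidth b := by
    refine lt_of_le_of_lt ?_ hw
    have : (z - I * b / 2).im = z.im - b / 2 := by simp
    rw [this]
    exact (abs_sub _ _).trans (by rw [abs_of_pos (half_pos hb)])
  have h2 : |(z + I * b / 2).im| < dilogWidth b := by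
    refine lt_of_le_of_lt ?_ hw
    have : (z + I * b / 2).im = z.im + b / 2 := by simp
    rw [this]
    exact (abs_add_le _ _).trans (by rw [abs_of_pos (half_pos hb)])
  rw [dilogLog, dilogLog, ← integral_sub (hε.integrable h1) (hε.integrable h2)]
  refine integral_congr_ae (ae_of_all _ fun u => ?_)
  have hd := hε.denom_ne_zero u
  simp only [dilogIntegrand]
  push_cast
  rw [← div_eq_mul_inv]
  set w : ℂ := u + dilogHeight b * I
  have e1 : -2 * I * (z - I * b / 2) * w = -2 * I * z * w + -(w * b) := by
    linear_combination (b * w) * I_mul_I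
  have e2 : -2 * I * (z + I * b / 2) * w = -2 * I * z * w + w * b := by
    linear_combination -(b * w) * I_mul_I
  rw [e1, e2, Complex.exp_add, Complex.exp_add, ← sub_div, ← mul_sub]
  have e3 : cexp (-(w * b)) - cexp (w * b) = -(2 * Complex.sinh (w * b)) := by
    rw [Complex.two_sinh]; ring
  rw [e3]
  have q1 := right_ne_zero_of_mul hd
  have q2 := right_ne_zero_of_mul (left_ne_zero_of_mul hd)
  have q3 := right_ne_zero_of_mul (left_ne_zero_of_mul (left_ne_zero_of_mul hd))
  field_simp
  ring

/-- Differentiating in z brings down -2iw, which cancels the remaining w in the denominator and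
leaves the integral of `integral_exp_div_sinh`. -/
lemma hasDerivAt_dilogLog_sub_dilogLog {b : ℝ} (hb : 0 < b) {z : ℂ} (hz : |z.im| < 1 / (2 * b)) :
    HasDerivAt (fun z => dilogLog b (z - I * b / 2) - dilogLog b (z + I * b / 2))
      (I * ∫ u : ℝ, cexp (-2 * I * z * (u + dilogHeight b * I)) /
        Complex.sinh ((u + dilogHeight b * I) * (b⁻¹ : ℝ))) z := by
  have hre : 0 < (b : ℂ).re := by simpa using hb
  have hbi : 0 < b⁻¹ := inv_pos.2 hb
  have hε := admissibleHeight_dilogHeight hre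
  have hinv : ((b : ℂ))⁻¹ = ((b⁻¹ : ℝ) : ℂ) := by push_cast; rfl
  have hε' := hε.inv hre
  rw [hinv] at hε'
  set ε := dilogHeight (b : ℂ)
  obtain ⟨c, hc, hlow⟩ := exists_le_norm_sinh_line (β₀ := ((b⁻¹ : ℝ) : ℂ)) (by simpa using hb)
    hε'.1 hε'.2.1
  have hlow' := hlow.self_of_nhds
  have habs : ContinuousAt (fun ξ : ℂ => |ξ.im|) z := by fun_prop
  have hstrip : ∀ᶠ ξ in 𝓝 z, |ξ.im| < 1 / (2 * b) :=
    habs.eventually_lt_const hz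
  have heq : (fun z => dilogLog b (z - I * b / 2) - dilogLog b (z + I * b / 2)) =ᶠ[𝓝 z] fun z =>
      ∫ u : ℝ, -(cexp (-2 * I * z * (u + ε * I)) / (2 * (u + ε * I) *
        Complex.sinh ((u + ε * I) * (b⁻¹ : ℝ)))) := by
    filter_upwards [hstrip] with ξ hξ
    exact dilogLog_sub_dilogLog_eq hb hξ
  have hw0 : ∀ u : ℝ, (u + ε * I : ℂ) ≠ 0 := fun u =>
    right_ne_zero_of_mul (hε.denom_ne_zero u)
  have hs0 : ∀ u : ℝ, Complex.sinh ((u + ε * I) * (b⁻¹ : ℝ)) ≠ 0 := by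
    intro u
    have := right_ne_zero_of_mul (left_ne_zero_of_mul (hε.denom_ne_zero u))
    rwa [div_eq_mul_inv, hinv] at this
  have hd0 : ∀ u : ℝ, 2 * (u + ε * I) * Complex.sinh ((u + ε * I) * (b⁻¹ : ℝ)) ≠ 0 := fun u =>
    mul_ne_zero (mul_ne_zero two_ne_zero (hw0 u)) (hs0 u)
  obtain ⟨κ, hκ, hκ'⟩ : ∃ κ : ℝ, 0 < κ ∧ |z.im| < 1 / (2 * b) - κ :=
    ⟨(1 / (2 * b) - |z.im|) / 2, by linarith, by linarith⟩
  have hstrip' : ∀ᶠ ξ in 𝓝 z, |ξ.im| < 1 / (2 * b) - κ :=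
    habs.eventually_lt_const hκ'
  have hrez : ∀ᶠ ξ in 𝓝 z, ξ.re < z.re + 1 :=
    continuous_re.continuousAt.eventually_lt_const (show z.re < z.re + 1 by linarith)
  have hε0 := hε.1
  have hder := hasDerivAt_integral_of_holomorphic (ξ₀ := z)
    (F := fun z u => -(cexp (-2 * I * z * (u + ε * I)) / (2 * (u + ε * I) *
        Complex.sinh ((u + ε * I) * (b⁻¹ : ℝ)))))
    (g := fun u => Real.exp (2 * (z.re + 1) * ε) / (2 * ε * c) * Real.exp (-(2 * κ * |u|)))
    (Eventually.of_forall fun ξ u => by fun_prop)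
    (Eventually.of_forall fun ξ => by
      refine Continuous.aestronglyMeasurable ?_
      have hs := Complex.continuous_sinh
      refine (Continuous.div (by fun_prop) ?_ hd0).neg
      exact (by fun_prop : Continuous fun u : ℝ => (2 * (u + ε * I) : ℂ)).mul
        (hs.comp (by fun_prop)))
    (by
      filter_upwards [hstrip', hrez] with ξ h1 h2 u
      have him : (u + ε * I : ℂ).im = ε := by simp
      have hre : (u + ε * I : ℂ).re = u := by simp
      have hwn : ε ≤ ‖(u + ε * I : ℂ)‖ := by
        have := Complex.abs_im_le_norm (u + ε * I : ℂ)
        rwa [him, abs_of_pos hε0] at this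
      have hl := hlow' u
      rw [Complex.ofReal_re] at hl
      have hu : ξ.im * u ≤ (1 / (2 * b) - κ) * |u| := by
        refine (le_abs_self _).trans ?_
        rw [abs_mul]
        gcongr
      rw [norm_neg, norm_div, norm_exp_neg_two_I_mul, norm_mul, norm_mul, him, hre,
        Complex.norm_ofNat]
      calc _ ≤ Real.exp (2 * ((z.re + 1) * ε + (1 / (2 * b) - κ) * |u|)) /
            (2 * ε * (c * Real.exp (|u| * b⁻¹))) := by
            gcongr
        _ = 1 / (2 * ε * c) * (Real.exp (2 * ((z.re + 1) * ε + (1 / (2 * b) - κ) * |u|)) /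
            Real.exp (|u| * b⁻¹)) := by
            field_simp
        _ = 1 / (2 * ε * c) * (Real.exp (2 * (z.re + 1) * ε) * Real.exp (-(2 * κ * |u|))) := by
            rw [← Real.exp_sub, ← Real.exp_add]
            congr 2
            field_simp
            ring
        _ = _ := by ring)
    ((integrable_exp_neg_mul_abs (by positivity)).const_mul _)
  refine (hder.congr_of_eventuallyEq heq).congr_deriv ?_
  rw [← integral_const_mul]
  refine integral_congr_ae (ae_of_all _ fun u => ?_)
  simp only
  have h1 : HasDerivAt (fun ξ : ℂ => -2 * I * ξ * (u + ε * I)) (-2 * I * (u + ε * I)) z := by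
    simpa using ((hasDerivAt_id z).const_mul (-2 * I)).mul_const (u + ε * I : ℂ)
  refine ((h1.cexp.div_const _).neg).deriv.trans ?_
  have q1 := hw0 u
  have q2 := hs0 u
  generalize Complex.sinh ((u + ε * I) * (b⁻¹ : ℝ)) = S at q2 ⊢
  generalize (u + ε * I : ℂ) = w at q1 ⊢
  field_simp

/-- The functional equation of the quantum dilogarithm, for a positive parameter. -/
theorem exp_dilogLog_sub_eq {b : ℝ} (hb : 0 < b) {z : ℂ} (hz : |z.im| < 1 / (2 * b)) :
    cexp (dilogLog b (z - I * b / 2)) =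
      (1 + cexp (2 * Real.pi * b * z)) * cexp (dilogLog b (z + I * b / 2)) := by
  have hre : 0 < (b : ℂ).re := by simpa using hb
  have hε := admissibleHeight_dilogHeight hre
  set D : ℂ → ℂ := fun z => dilogLog b (z - I * b / 2) - dilogLog b (z + I * b / 2) with hD
  -- By the value of the sinh integral, D' is the logarithmic derivative of 1 + e^{2πbz}, so Q is
  -- constant on horizontal lines; its limit at -∞ is 1.
  set Q : ℝ → ℂ := fun x => cexp (-D (z + x)) * (1 + cexp (2 * Real.pi * b * (z + x))) with hQ
  have himx : ∀ x : ℝ, (z + x).im = z.im := fun x => by simp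
  have hQd : ∀ x : ℝ, HasDerivAt Q 0 x := by
    intro x
    have hzx : |(z + x).im| < 1 / (2 * b) := by rwa [himx]
    have hX := integral_exp_div_sinh hb hε.1 (by simpa using hε.2.2) hzx
    have hD' := hasDerivAt_dilogLog_sub_dilogLog hb hzx
    set X := ∫ u : ℝ, cexp (-2 * I * (z + x) * (u + dilogHeight b * I)) /
        Complex.sinh ((u + dilogHeight b * I) * (b⁻¹ : ℝ))
    have hx : HasDerivAt (fun x : ℝ => z + (x : ℂ)) 1 x :=
      (HasDerivAt.ofReal_comp (hasDerivAt_id x)).const_add z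
    have h1 := (HasDerivAt.comp (h₂ := D) x hD' hx).neg.cexp
    have h2 := ((hx.const_mul (2 * Real.pi * b : ℂ)).cexp).const_add 1
    refine (h1.mul h2).congr_deriv ?_
    have hexp : cexp (-(2 * Real.pi * b * (z + x))) * cexp (2 * Real.pi * b * (z + x)) = 1 := by
      rw [← Complex.exp_add]; simp
    simp only [Function.comp_def, Pi.neg_apply]
    linear_combination (-cexp (-D (z + x)) * I * cexp (2 * Real.pi * b * (z + x))) * hX +
      (cexp (-D (z + x)) * I * X) * hexp +
      (2 * Real.pi * b * cexp (-D (z + x)) * cexp (2 * Real.pi * b * (z + x))) * I_mul_I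
  have hconst : ∀ x : ℝ, Q x = Q 0 := fun x =>
    is_const_of_deriv_eq_zero (fun x => (hQd x).differentiableAt) (fun x => (hQd x).deriv) x 0
  have hlim : Tendsto Q atBot (𝓝 1) := by
    obtain ⟨κ, hκ, hκ'⟩ : ∃ κ : ℝ, 0 < κ ∧ |z.im| + κ ≤ 1 / (2 * b) :=
      ⟨1 / (2 * b) - |z.im|, by linarith, by linarith⟩
    have h12 : 1 / (2 * b) = b⁻¹ / 2 := by field_simp
    obtain ⟨M, ε, hM, hε0, hbd⟩ := exists_norm_dilogLog_le hre hκ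
    have hbd' := hbd.self_of_nhds
    have hexp0 : ∀ k : ℝ, 0 < k → Tendsto (fun x : ℝ => Real.exp (k * (z.re + x))) atBot (𝓝 0) :=
      fun k hk => Real.tendsto_exp_atBot.comp
        ((tendsto_atBot_add_const_left _ _ tendsto_id).const_mul_atBot hk)
    have hlog : ∀ σ : ℝ, |σ| = 1 → Tendsto (fun x : ℝ => dilogLog b (z + x + σ * (I * b / 2)))
        atBot (𝓝 0) := by
      intro σ hσ
      have := (hexp0 (2 * ε) (by positivity)).const_mul M
      rw [mul_zero] at this
      refine squeeze_zero_norm (fun x => ?_) this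
      have hrex : (z + x + σ * (I * b / 2)).re = z.re + x := by simp
      have him : (z + x + σ * (I * b / 2)).im = z.im + σ * (b / 2) := by simp
      have := hbd' (z + x + σ * (I * b / 2)) (by
        rw [him, dilogWidth_ofReal]
        have := abs_add_le z.im (σ * (b / 2))
        rw [abs_mul, hσ, one_mul, abs_of_pos (half_pos hb)] at this
        linarith)
      rwa [hrex] at this
    have hDlim : Tendsto (fun x : ℝ => D (z + x)) atBot (𝓝 0) := by
      have := (hlog (-1) (by simp)).sub (hlog 1 (by simp))
      rw [sub_zero] at this
      refine this.congr fun x => ?_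
      simp only [hD]
      push_cast
      ring_nf
    have hE : Tendsto (fun x : ℝ => cexp (2 * Real.pi * b * (z + x))) atBot (𝓝 0) := by
      refine squeeze_zero_norm (fun x => le_of_eq ?_) (hexp0 (2 * Real.pi * b) (by positivity))
      rw [Complex.norm_exp]
      congr 1
      simp
    have h1 := (hDlim.neg.cexp).mul (hE.const_add 1)
    simpa using h1
  have hQ0 : Q 0 = 1 :=
    tendsto_nhds_unique (tendsto_const_nhds.congr fun x => (hconst x).symm) hlim
  simp only [hQ, hD, Complex.ofReal_zero, add_zero, neg_sub] at hQ0
  have e : cexp (dilogLog b (z - I * b / 2)) * cexp (dilogLog b (z + I * b / 2) -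
      dilogLog b (z - I * b / 2)) = cexp (dilogLog b (z + I * b / 2)) := by
    rw [← Complex.exp_add]; congr 1; ring
  rw [← e]
  linear_combination -cexp (dilogLog b (z - I * b / 2)) * hQ0

/-! ### Decay of ψ and holomorphy in the parameter. -/

lemma psiFun_eq (β : ℂ) (a c t : ℝ) : psiFun β a c t =
    cexp (-dilogLog β (t - I * (β + β⁻¹) * (a + c)) +
      2 * Real.pi * (β + β⁻¹) * a * (t - I * (β + β⁻¹) * (a + c) / 2) +
      Real.pi * I * (β + β⁻¹) ^ 2 * (4 * (a - c) + 1) / 24) := by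
  have e1 : (t : ℂ) - 2 * dilogConst β * (a + c) = t - I * (β + β⁻¹) * (a + c) := by
    rw [dilogConst]; ring
  rw [psiFun, faddeevDilog_eq, e1, ← Complex.exp_neg, ← Complex.exp_add, ← Complex.exp_add]
  congr 1
  rw [dilogConst]
  linear_combination (-2 * Real.pi * (β + β⁻¹) * a * (t - I / 2 * (β + β⁻¹) * (a + c)) -
    Real.pi * I * (β + β⁻¹) ^ 2 * (4 * (a - c) + 1) / 24) * I_mul_I

lemma re_dilogArg (β : ℂ) (a c t : ℝ) :
    ((t : ℂ) - I * (β + β⁻¹) * (a + c)).re = t + (β + β⁻¹).im * (a + c) := by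
  rw [← Complex.ofReal_add, mul_assoc]
  simp only [sub_re, ofReal_re, mul_re, I_re, zero_mul, I_im, one_mul, im_mul_ofReal]
  ring

lemma im_dilogArg (β : ℂ) (a c t : ℝ) :
    ((t : ℂ) - I * (β + β⁻¹) * (a + c)).im = -(2 * dilogWidth β * (a + c)) := by
  rw [← Complex.ofReal_add, mul_assoc, dilogWidth]
  simp only [sub_im, ofReal_im, mul_im, I_re, zero_mul, I_im, one_mul, re_mul_ofReal]
  ring

lemma dilogWidth_sub_abs_im_dilogArg {β : ℂ} (hβ : 0 < β.re) {a c : ℝ} (hac : 0 ≤ a + c) (t : ℝ) :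
    dilogWidth β - |((t : ℂ) - I * (β + β⁻¹) * (a + c)).im| =
      dilogWidth β * (1 - 2 * (a + c)) := by
  rw [im_dilogArg, abs_neg, abs_of_nonneg
    (mul_nonneg (mul_nonneg zero_le_two (dilogWidth_pos hβ).le) hac)]
  ring

lemma abs_im_dilogArg_lt {β : ℂ} (hβ : 0 < β.re) {a c : ℝ} (hac : 0 ≤ a + c) (hac' : a + c < 1 / 2)
    (t : ℝ) : |((t : ℂ) - I * (β + β⁻¹) * (a + c)).im| < dilogWidth β := by
  have h1 := dilogWidth_sub_abs_im_dilogArg hβ hac t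
  have h2 := mul_pos (dilogWidth_pos hβ) (by linarith : 0 < 1 - 2 * (a + c))
  linarith

lemma continuous_psiFun {β : ℂ} (hβ : 0 < β.re) {a c : ℝ} (hac : 0 ≤ a + c) (hac' : a + c < 1 / 2) :
    Continuous (psiFun β a c) := by
  have : psiFun β a c = fun t : ℝ => _ := funext fun t => psiFun_eq β a c t
  rw [this]
  have hL : Continuous (fun t : ℝ => dilogLog β (t - I * (β + β⁻¹) * (a + c))) :=
    continuous_iff_continuousAt.2 fun t => ContinuousAt.comp
      (f := fun t : ℝ => (t - I * (β + β⁻¹) * (a + c) : ℂ))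
      (differentiableAt_dilogLog hβ (abs_im_dilogArg_lt hβ hac hac' t)).continuousAt (by fun_prop)
  fun_prop

lemma differentiableAt_psiFun {β : ℂ} (hβ : 0 < β.re) {a c : ℝ} (hac : 0 ≤ a + c)
    (hac' : a + c < 1 / 2) (t : ℝ) : DifferentiableAt ℂ (fun β => psiFun β a c t) β := by
  have : (fun β => psiFun β a c t) = fun β => _ := funext fun β => psiFun_eq β a c t
  rw [this]
  have hs : ∀ β : ℂ, 0 < β.re → DifferentiableAt ℂ (fun β : ℂ => β + β⁻¹) β := fun β hβ =>
    differentiableAt_id.add (differentiableAt_inv (Complex.ne_zero_of_re_pos hβ))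
  have hev : ∀ᶠ β' in 𝓝 β, 0 < β'.re := continuous_re.continuousAt.eventually_const_lt hβ
  have hs0 := hs β hβ
  have hL : DifferentiableAt ℂ (fun β => dilogLog β (t - I * (β + β⁻¹) * (a + c))) β :=
    differentiableAt_dilogLog_comp (B := fun β => β)
      (Z := fun β => t - I * (β + β⁻¹) * (a + c))
      (Eventually.of_forall fun _ => differentiableAt_id)
      (hev.mono fun β' hβ' => (((hs β' hβ').const_mul I).mul_const _).const_sub _) hβ
      (abs_im_dilogArg_lt hβ hac hac' t)
  exact ((hL.neg.add ((hs0.const_mul _).mul_const _ |>.mul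
    ((((hs0.const_mul I).mul_const _).div_const 2).const_sub _))).add
    ((((hs0.pow 2).const_mul _).mul_const _).div_const 24)).cexp

/-- The exponential decay of `ψ_{a,c}`, locally uniformly in the quantum parameter. -/
lemma exists_norm_psiFun_le {β₀ : ℂ} (hβ₀ : 0 < β₀.re) {a c : ℝ} (ha : 0 < a) (hc : 0 < c)
    (hac : a + c < 1 / 2) : ∃ C κ : ℝ, 0 < κ ∧
      ∀ᶠ β in 𝓝 β₀, ∀ t : ℝ, ‖psiFun β a c t‖ ≤ C * Real.exp (-(κ * |t|)) := by
  have hs : ContinuousAt (fun β : ℂ => β + β⁻¹) β₀ :=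
    continuousAt_id.add (continuousAt_inv₀ (Complex.ne_zero_of_re_pos hβ₀))
  set ω := dilogWidth β₀ / 2 with hω
  have hωpos : 0 < ω := half_pos (dilogWidth_pos hβ₀)
  have hac2 : 0 < 1 - 2 * (a + c) := by linarith
  obtain ⟨M, ε, hM, hε, hb⟩ := exists_norm_dilogLog_le hβ₀ (mul_pos hωpos hac2)
  have hev1 : ∀ᶠ β in 𝓝 β₀, 0 < β.re := continuous_re.continuousAt.eventually_const_lt hβ₀
  have hev2 : ∀ᶠ β in 𝓝 β₀, ω < dilogWidth β :=
    (continuousAt_dilogWidth hβ₀).eventually_const_lt (by rw [hω]; linarith)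
  set S := ‖β₀ + β₀⁻¹‖ + 1 with hS
  have hev3 : ∀ᶠ β in 𝓝 β₀, ‖β + β⁻¹‖ < S :=
    hs.norm.eventually_lt_const (by rw [hS]; linarith)
  -- A and A' collect the real parts of the terms of the exponent independent of t, for t ≤ 0 and,
  -- after inversion, for t ≥ 0. By continuity both are bounded near β₀.
  set A : ℂ → ℝ := fun β => (-(Real.pi * I * (β + β⁻¹) ^ 2 * a * (a + c)) +
    Real.pi * I * (β + β⁻¹) ^ 2 * (4 * (a - c) + 1) / 24).re with hA
  set A' : ℂ → ℝ := fun β => A β + (-(Real.pi * I * ((-(β + β⁻¹) ^ 2 * (a + c) ^ 2) +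
    ((β + β⁻¹) ^ 2 - 2) / 12))).re with hA'
  have hAc : ContinuousAt A β₀ := by
    refine continuous_re.continuousAt.comp ?_
    fun_prop
  have hAc' : ContinuousAt A' β₀ := by
    refine hAc.add (continuous_re.continuousAt.comp ?_)
    fun_prop
  have hev4 := hAc.eventually_lt_const (show A β₀ < A β₀ + 1 by linarith)
  have hev5 := hAc'.eventually_lt_const (show A' β₀ < A' β₀ + 1 by linarith)
  set K := M * Real.exp (2 * ε * S) + max (A β₀ + 1) (A' β₀ + 1) with hK
  set κ := 4 * Real.pi * ω * min a c with hκ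
  have hπ := Real.pi_pos
  have hmin : 0 < min a c := lt_min ha hc
  refine ⟨Real.exp K, κ, by positivity, ?_⟩
  filter_upwards [hb, hev1, hev2, hev3, hev4, hev5] with β h1 h2 h3 h4 h5 h6 t
  rw [psiFun_eq, Complex.norm_exp, ← Real.exp_add]
  apply Real.exp_le_exp.2
  set s := β + β⁻¹ with hsdef
  set z : ℂ := (t : ℂ) - I * s * (a + c) with hz
  have hwz := dilogWidth_sub_abs_im_dilogArg h2 (add_pos ha hc).le t
  rw [← hsdef, ← hz] at hwz
  have hzre : z.re = t + s.im * (a + c) := re_dilogArg β a c t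
  have hsim : |s.im * (a + c)| ≤ S := by
    rw [abs_mul, abs_of_pos (add_pos ha hc)]
    calc |s.im| * (a + c) ≤ S * 1 := by
          gcongr
          · exact (Complex.abs_im_le_norm s).trans h4.le
          · linarith
      _ = S := mul_one S
  have hsim' := abs_le.1 hsim
  have hwpos : 0 < dilogWidth β := hωpos.trans h3
  have hsre : s.re = 2 * dilogWidth β := by rw [dilogWidth]; ring
  have hwid : ω * (1 - 2 * (a + c)) ≤ dilogWidth β * (1 - 2 * (a + c)) := by gcongr
  rcases le_total t 0 with ht | ht
  · have hL := h1 z (by rw [hwz]; exact hwid)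
    have hL2 : M * Real.exp (2 * ε * z.re) ≤ M * Real.exp (2 * ε * S) := by
      gcongr
      rw [hzre]
      linarith
    have hL3 : -(dilogLog β z).re ≤ ‖dilogLog β z‖ :=
      (neg_le_abs _).trans (Complex.abs_re_le_norm _)
    have e1 : (-dilogLog β z + 2 * Real.pi * s * a * (t - I * s * (a + c) / 2) +
        Real.pi * I * s ^ 2 * (4 * (a - c) + 1) / 24).re =
        -(dilogLog β z).re + A β + 4 * Real.pi * dilogWidth β * a * t := by
      have : -dilogLog β z + 2 * Real.pi * s * a * (t - I * s * (a + c) / 2) +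
        Real.pi * I * s ^ 2 * (4 * (a - c) + 1) / 24 = -dilogLog β z +
        (-(Real.pi * I * s ^ 2 * a * (a + c)) + Real.pi * I * s ^ 2 * (4 * (a - c) + 1) / 24) +
        ((2 * Real.pi * a * t : ℝ) : ℂ) * s := by push_cast; ring
      rw [this, Complex.add_re, Complex.add_re, Complex.neg_re, Complex.re_ofReal_mul, hsre]
      simp only [hA]
      rw [← hsdef]
      ring
    rw [e1, abs_of_nonpos ht]
    have e2 : 4 * Real.pi * dilogWidth β * a * t ≤ 4 * Real.pi * ω * min a c * t := by
      refine mul_le_mul_of_nonpos_right ?_ ht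
      gcongr
      exact min_le_left _ _
    have e3 := le_max_left (A β₀ + 1) (A' β₀ + 1)
    rw [hK, hκ]
    linarith
  · have hzim : |z.im| < dilogWidth β := abs_im_dilogArg_lt h2 (add_pos ha hc).le hac t
    -- For t ≥ 0 inversion replaces -L(z) by L(-z), which is bounded. The quadratic term contributes
    -- a phase and turns the growth rate proportional to a into decay proportional to c.
    have hinv := dilogLog_add_dilogLog_neg h2 hzim
    have hL := h1 (-z) (by rw [Complex.neg_im, abs_neg, hwz]; exact hwid)
    have hL2 : M * Real.exp (2 * ε * (-z).re) ≤ M * Real.exp (2 * ε * S) := by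
      gcongr
      rw [Complex.neg_re, hzre]
      linarith
    have hL3 : (dilogLog β (-z)).re ≤ ‖dilogLog β (-z)‖ :=
      (le_abs_self _).trans (Complex.abs_re_le_norm _)
    have e1 : (-dilogLog β z + 2 * Real.pi * s * a * (t - I * s * (a + c) / 2) +
        Real.pi * I * s ^ 2 * (4 * (a - c) + 1) / 24).re =
        (dilogLog β (-z)).re + A' β - 4 * Real.pi * dilogWidth β * c * t := by
      have : -dilogLog β z + 2 * Real.pi * s * a * (t - I * s * (a + c) / 2) +
        Real.pi * I * s ^ 2 * (4 * (a - c) + 1) / 24 = dilogLog β (-z) +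
        (-(Real.pi * I * s ^ 2 * a * (a + c)) + Real.pi * I * s ^ 2 * (4 * (a - c) + 1) / 24) +
        (-(Real.pi * I * ((-s ^ 2 * (a + c) ^ 2) + (s ^ 2 - 2) / 12))) +
        ((-2 * Real.pi * c * t : ℝ) : ℂ) * s + ((-Real.pi * t ^ 2 : ℝ) : ℂ) * I := by
        rw [show -dilogLog β z = dilogLog β (-z) -
          Real.pi * I * (z ^ 2 + (s ^ 2 - 2) / 12) by rw [hsdef, ← hinv]; ring, hz]
        push_cast
        linear_combination (-Real.pi * I * s ^ 2 * (a + c) ^ 2 + 2 * Real.pi * t * s * (a + c)) *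
          I_mul_I
      rw [this, Complex.add_re, Complex.add_re, Complex.add_re, Complex.add_re,
        Complex.re_ofReal_mul, Complex.re_ofReal_mul, hsre]
      simp only [hA', hA]
      rw [← hsdef, Complex.I_re]
      ring
    rw [e1, abs_of_nonneg ht]
    have e2 : 4 * Real.pi * ω * min a c * t ≤ 4 * Real.pi * dilogWidth β * c * t := by
      refine mul_le_mul_of_nonneg_right ?_ ht
      gcongr
      exact min_le_right _ _
    have e3 := le_max_right (A β₀ + 1) (A' β₀ + 1)
    rw [hK, hκ]
    linarith

lemma integrable_psiFun {β : ℂ} (hβ : 0 < β.re) {a c : ℝ} (ha : 0 < a) (hc : 0 < c)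
    (hac : a + c < 1 / 2) : Integrable (psiFun β a c) := by
  obtain ⟨C, κ, hκ, hb⟩ := exists_norm_psiFun_le hβ ha hc hac
  exact integrable_of_norm_le_exp_neg_mul_abs (T₀ := 0)
    (continuous_psiFun hβ (add_pos ha hc).le hac) hκ fun u _ => hb.self_of_nhds u

/-- The Fourier transform of `ψ_{a,c}` is holomorphic in the quantum parameter. -/
lemma differentiableAt_psiTilde {β : ℂ} (hβ : 0 < β.re) {a c : ℝ} (ha : 0 < a) (hc : 0 < c)
    (hac : a + c < 1 / 2) (s : ℝ) : DifferentiableAt ℂ (fun β => psiTilde β a c s) β := by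
  obtain ⟨C, κ, hκ, hb⟩ := exists_norm_psiFun_le hβ ha hc hac
  have hev1 : ∀ᶠ β' in 𝓝 β, 0 < β'.re := continuous_re.continuousAt.eventually_const_lt hβ
  refine (hasDerivAt_integral_of_holomorphic
    (F := fun β t => psiFun β a c t * cexp (-2 * Real.pi * I * s * t))
    (g := fun t => C * Real.exp (-(κ * |t|))) ?_ ?_ ?_
    ((integrable_exp_neg_mul_abs hκ).const_mul C)).differentiableAt
  · filter_upwards [hev1] with β' h t
    exact (differentiableAt_psiFun h (add_pos ha hc).le hac t).mul_const _
  · filter_upwards [hev1] with β' h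
    exact ((continuous_psiFun h (add_pos ha hc).le hac).mul (by fun_prop)).aestronglyMeasurable
  · filter_upwards [hb] with β' h t
    have : ‖cexp (-2 * Real.pi * I * s * t)‖ = 1 := by
      rw [show -2 * Real.pi * I * s * t = ((-2 * Real.pi * s * t : ℝ) : ℂ) * I by push_cast; ring]
      exact Complex.norm_exp_ofReal_mul_I _
    rw [norm_mul, this, mul_one]
    exact h t

/-! ### The Fourier transform of 1/Φ for a positive parameter. -/

/-- Two-sided asymptotics of the modulus of the quantum dilogarithm for a positive parameter. -/
lemma exists_abs_re_dilogLog_add_le {b : ℝ} (hb : 0 < b) {κ : ℝ} (hκ : 0 < κ) :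
    ∃ C : ℝ, ∀ z : ℂ, κ ≤ dilogWidth b - |z.im| →
      |(dilogLog b z).re + 2 * Real.pi * max z.re 0 * z.im| ≤ C := by
  have hre : 0 < (b : ℂ).re := by simpa using hb
  obtain ⟨M, ε, hM, hε, hbd⟩ := exists_norm_dilogLog_le hre hκ
  have hbd' := hbd.self_of_nhds
  refine ⟨M, fun z hz => ?_⟩
  rcases le_total z.re 0 with h | h
  · rw [max_eq_right h, mul_zero, zero_mul, add_zero]
    refine (Complex.abs_re_le_norm _).trans ((hbd' z hz).trans ?_)
    have : Real.exp (2 * ε * z.re) ≤ 1 :=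
      Real.exp_le_one_iff.2 (mul_nonpos_of_nonneg_of_nonpos (by positivity) h)
    nlinarith
  · have hinv := dilogLog_add_dilogLog_neg hre (show |z.im| < dilogWidth b by linarith)
    have e1 : (dilogLog b z).re + 2 * Real.pi * max z.re 0 * z.im = -(dilogLog b (-z)).re := by
      have h1 := congrArg Complex.re hinv
      have h2 : (Real.pi * I * (z ^ 2 + (((b : ℂ) + (b : ℂ)⁻¹) ^ 2 - 2) / 12)).re =
          -(2 * Real.pi * z.re * z.im) := by
        have : ((Real.pi * I * (z ^ 2 + (((b : ℂ) + (b : ℂ)⁻¹) ^ 2 - 2) / 12))) =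
            (Real.pi : ℂ) * (I * z ^ 2) + ((Real.pi * (((b + b⁻¹) ^ 2 - 2) / 12) : ℝ) : ℂ) * I := by
          push_cast
          ring
        rw [this, Complex.add_re, Complex.re_ofReal_mul, Complex.re_ofReal_mul, Complex.I_mul_re,
          Complex.I_re, pow_two, Complex.mul_im]
        ring
      rw [h2, Complex.add_re] at h1
      rw [max_eq_left h]
      linarith
    rw [e1, abs_neg]
    refine (Complex.abs_re_le_norm _).trans ((hbd' (-z) (by simpa using hz)).trans ?_)
    have : Real.exp (2 * ε * (-z).re) ≤ 1 :=
      Real.exp_le_one_iff.2 (mul_nonpos_of_nonneg_of_nonpos (by positivity) (by simpa using h))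
    nlinarith

/-- Recentring the functional equation at w - iq + ib/2, where q is the half width, multiplies
e^{2πbw} by e^{-πi} = -1, because q - b/2 = 1/(2b). -/
lemma exp_neg_dilogLog_shift {b : ℝ} (hb : 0 < b) {w : ℂ} (h0 : 0 < w.im) (h1 : w.im < 1 / b) :
    cexp (-dilogLog b (w + I * b - I * dilogWidth b)) =
      (1 - cexp (2 * Real.pi * b * w)) * cexp (-dilogLog b (w - I * dilogWidth b)) := by
  have hbc : (b : ℂ) ≠ 0 := by exact_mod_cast hb.ne'
  have h := exp_dilogLog_sub_eq hb (z := w - I * dilogWidth b + I * b / 2) (by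
    have : (w - I * dilogWidth b + I * b / 2).im = w.im - 1 / (2 * b) := by
      simp [dilogWidth_ofReal]
      ring
    rw [this]
    have e : 1 / b = 2 * (1 / (2 * b)) := by field_simp
    rw [e] at h1
    exact abs_lt.2 ⟨by linarith, by linarith⟩)
  have e1 : w - I * dilogWidth b + I * b / 2 - I * b / 2 = w - I * dilogWidth b := by ring
  have e2 : w - I * dilogWidth b + I * b / 2 + I * b / 2 = w + I * b - I * dilogWidth b := by ring
  have e3 : cexp (2 * Real.pi * b * (w - I * dilogWidth b + I * b / 2)) =
      -cexp (2 * Real.pi * b * w) := by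
    have : (2 * Real.pi * b * (w - I * dilogWidth b + I * b / 2) : ℂ) =
        2 * Real.pi * b * w - Real.pi * I := by
      rw [dilogWidth_ofReal]
      push_cast
      field_simp
      ring
    rw [this, Complex.exp_sub, Complex.exp_pi_mul_I]
    ring
  rw [e1, e2, e3] at h
  have n1 := Complex.exp_ne_zero (dilogLog b (w - I * dilogWidth b))
  have n2 := Complex.exp_ne_zero (dilogLog b (w + I * b - I * dilogWidth b))
  rw [Complex.exp_neg, Complex.exp_neg]
  generalize cexp (2 * Real.pi * b * w) = X at h ⊢
  field_simp
  linear_combination h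

/-- The Fourier transform of the reciprocal of the quantum dilogarithm along the line
`Im z = -η`. -/
noncomputable def dilogFourier (b η : ℝ) (w : ℂ) : ℂ :=
  ∫ t : ℝ, cexp (-dilogLog b (t - η * I) - 2 * Real.pi * I * w * (t - η * I))

/-- The closed form of the Fourier transform, up to a constant factor. -/
noncomputable def dilogDual (b : ℝ) (w : ℂ) : ℂ :=
  cexp (Real.pi * I * w ^ 2 - dilogLog b (w - I * dilogWidth b))

lemma continuous_dilogLog_line {b : ℝ} (hb : 0 < b) {η : ℝ} (hη : |η| < dilogWidth b) :
    Continuous (fun t : ℝ => dilogLog b (t - η * I)) := by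
  have hre : 0 < (b : ℂ).re := by simpa using hb
  refine continuous_iff_continuousAt.2 fun t => ContinuousAt.comp
    (f := fun t : ℝ => (t - η * I : ℂ))
    (differentiableAt_dilogLog hre (by simpa using hη)).continuousAt (by fun_prop)

/-- On Im z = -η the modulus of 1/Φ is comparable to e^{-2πη max(t, 0)}. Against e^{2πt Im w} this
decays at both ends exactly for 0 < Im w < η. -/
lemma exists_norm_dilogFourier_integrand_le {b : ℝ} (hb : 0 < b) {η : ℝ} (hη0 : 0 < η)
    (hη : η < dilogWidth b) : ∃ C : ℝ, ∀ {κ : ℝ} {w : ℂ}, κ ≤ w.im → κ ≤ η - w.im → ∀ t : ℝ,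
      ‖cexp (-dilogLog b (t - η * I) - 2 * Real.pi * I * w * (t - η * I))‖ ≤
        C * Real.exp (-(2 * Real.pi * η * w.re)) * Real.exp (-(2 * Real.pi * κ * |t|)) := by
  obtain ⟨C, hC⟩ := exists_abs_re_dilogLog_add_le hb (sub_pos.2 hη)
  refine ⟨Real.exp C, fun {κ w} h1 h2 t => ?_⟩
  have him : (t - η * I : ℂ).im = -η := by simp
  have hre : (t - η * I : ℂ).re = t := by simp
  have h3 := hC (t - η * I) (by rw [him, abs_neg, abs_of_pos hη0])
  rw [him, hre] at h3
  have h4 := (abs_le.1 h3).1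
  rw [Complex.norm_exp, ← Real.exp_add, ← Real.exp_add]
  apply Real.exp_le_exp.2
  have e1 : (-dilogLog b (t - η * I) - 2 * Real.pi * I * w * (t - η * I)).re =
      -(dilogLog b (t - η * I)).re + 2 * Real.pi * (w.im * t - η * w.re) := by
    rw [show (-dilogLog b (t - η * I) - 2 * Real.pi * I * w * (t - η * I)) =
      -dilogLog b (t - η * I) + ((-2 * Real.pi : ℝ) : ℂ) * (I * (w * (t - η * I))) by
        push_cast; ring, Complex.add_re, Complex.neg_re, Complex.re_ofReal_mul, Complex.I_mul_re,
      Complex.mul_im, him, hre]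
    ring
  rw [e1]
  have hπ := Real.pi_pos
  have key : w.im * t - η * max t 0 ≤ -(κ * |t|) := by
    rcases le_total t 0 with ht | ht
    · rw [max_eq_right ht, abs_of_nonpos ht]
      nlinarith
    · rw [max_eq_left ht, abs_of_nonneg ht]
      nlinarith
  nlinarith

lemma continuous_dilogFourier_integrand {b : ℝ} (hb : 0 < b) {η : ℝ} (hη : |η| < dilogWidth b)
    (w : ℂ) : Continuous (fun t : ℝ =>
      cexp (-dilogLog b (t - η * I) - 2 * Real.pi * I * w * (t - η * I))) := by
  have := continuous_dilogLog_line hb hη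
  fun_prop

lemma integrable_dilogFourier_integrand {b : ℝ} (hb : 0 < b) {η : ℝ} (hη0 : 0 < η)
    (hη : η < dilogWidth b) {w : ℂ} (h0 : 0 < w.im) (h1 : w.im < η) : Integrable (fun t : ℝ =>
      cexp (-dilogLog b (t - η * I) - 2 * Real.pi * I * w * (t - η * I))) := by
  obtain ⟨C, hC⟩ := exists_norm_dilogFourier_integrand_le hb hη0 hη
  have hκ : 0 < 2 * Real.pi * min w.im (η - w.im) :=
    mul_pos Real.two_pi_pos (lt_min h0 (sub_pos.2 h1))
  exact integrable_of_norm_le_exp_neg_mul_abs (T₀ := 0)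
    (continuous_dilogFourier_integrand hb (by rwa [abs_of_pos hη0]) w) hκ
    fun t _ => hC (min_le_left _ _) (min_le_right _ _) t

lemma exists_norm_dilogFourier_le {b : ℝ} (hb : 0 < b) {η : ℝ} (hη0 : 0 < η)
    (hη : η < dilogWidth b) {κ : ℝ} (hκ : 0 < κ) : ∃ C : ℝ, ∀ w : ℂ, κ ≤ w.im → κ ≤ η - w.im →
      ‖dilogFourier b η w‖ ≤ C * Real.exp (-(2 * Real.pi * η * w.re)) := by
  obtain ⟨C, hC⟩ := exists_norm_dilogFourier_integrand_le hb hη0 hη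
  have hint : Integrable (fun t : ℝ => Real.exp (-(2 * Real.pi * κ * |t|))) :=
    integrable_exp_neg_mul_abs (by have := Real.pi_pos; positivity)
  refine ⟨C * ∫ t : ℝ, Real.exp (-(2 * Real.pi * κ * |t|)), fun w h1 h2 => ?_⟩
  have := norm_integral_le_of_norm_le (hint.const_mul (C * Real.exp (-(2 * Real.pi * η * w.re))))
    (ae_of_all _ fun t => hC h1 h2 t)
  rw [integral_const_mul] at this
  exact this.trans (le_of_eq (by ring))

lemma differentiableAt_dilogFourier {b : ℝ} (hb : 0 < b) {η : ℝ} (hη0 : 0 < η)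
    (hη : η < dilogWidth b) {w : ℂ} (h0 : 0 < w.im) (h1 : w.im < η) :
    DifferentiableAt ℂ (dilogFourier b η) w := by
  obtain ⟨C, hC⟩ := exists_norm_dilogFourier_integrand_le hb hη0 hη
  have hC0 : 0 ≤ C := by
    have h2 := hC (κ := 0) (w := w) h0.le (by linarith) 0
    have := (norm_nonneg _).trans h2
    simp only [mul_zero, zero_mul, neg_zero, Real.exp_zero, mul_one] at this
    exact nonneg_of_mul_nonneg_left this (Real.exp_pos _)
  obtain ⟨κ, hκ, hκ1, hκ2⟩ : ∃ κ : ℝ, 0 < κ ∧ κ < w.im ∧ κ < η - w.im := by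
    obtain ⟨κ, hκ, hκ'⟩ := exists_between (lt_min h0 (sub_pos.2 h1))
    exact ⟨κ, hκ, lt_min_iff.1 hκ'⟩
  have e1 : ∀ᶠ ξ in 𝓝 w, κ < ξ.im := continuous_im.continuousAt.eventually_const_lt hκ1
  have e2 : ∀ᶠ ξ in 𝓝 w, ξ.im < η - κ :=
    continuous_im.continuousAt.eventually_lt_const (by linarith)
  have e3 : ∀ᶠ ξ in 𝓝 w, w.re - 1 < ξ.re :=
    continuous_re.continuousAt.eventually_const_lt (by linarith)
  refine (hasDerivAt_integral_of_holomorphic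
    (F := fun w t => cexp (-dilogLog b (t - η * I) - 2 * Real.pi * I * w * (t - η * I)))
    (g := fun t => C * Real.exp (-(2 * Real.pi * η * (w.re - 1))) *
      Real.exp (-(2 * Real.pi * κ * |t|)))
    (Eventually.of_forall fun ξ t => by fun_prop)
    (Eventually.of_forall fun ξ => (continuous_dilogFourier_integrand hb
      (by rwa [abs_of_pos hη0]) ξ).aestronglyMeasurable) ?_
    ((integrable_exp_neg_mul_abs (by have := Real.pi_pos; positivity)).const_mul _)).differentiableAt
  filter_upwards [e1, e2, e3] with ξ f1 f2 f3 t
  refine (hC f1.le (by linarith) t).trans ?_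
  have := Real.pi_pos
  gcongr

/-- The Fourier transform does not depend on the line of integration. -/
lemma dilogFourier_eq_of_lt {b : ℝ} (hb : 0 < b) {η₁ η₂ : ℝ} (h12 : η₁ < η₂)
    (hη : η₂ < dilogWidth b) {w : ℂ} (h0 : 0 < w.im) (h1 : w.im < η₁) :
    dilogFourier b η₂ w = dilogFourier b η₁ w := by
  have hre : 0 < (b : ℂ).re := by simpa using hb
  obtain ⟨C, hC⟩ := exists_abs_re_dilogLog_add_le hb (sub_pos.2 hη)
  have hκ : 0 < min w.im (η₁ - w.im) := lt_min h0 (sub_pos.2 h1)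
  set κ := min w.im (η₁ - w.im)
  have hπ := Real.pi_pos
  have h := integral_line_eq_integral_line (f := fun z => cexp (-dilogLog b z -
    2 * Real.pi * I * w * z)) (y₁ := -η₂) (y₂ := -η₁) (neg_lt_neg h12)
    (C := Real.exp (C + 2 * Real.pi * (|w.re| * η₂))) (κ := 2 * Real.pi * κ) (T₀ := 0)
    (fun z hz1 hz2 => by
      have : |z.im| < dilogWidth b := by
        rw [abs_of_nonpos (by linarith)]
        linarith
      have := differentiableAt_dilogLog hre this
      fun_prop)
    (by positivity)
    (fun z hz1 hz2 _ => by
      have him : z.im ≤ 0 := by linarith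
      have h3 := (abs_le.1 (hC z (by rw [abs_of_nonpos him]; linarith))).1
      rw [Complex.norm_exp, ← Real.exp_add]
      apply Real.exp_le_exp.2
      have e1 : (-dilogLog b z - 2 * Real.pi * I * w * z).re =
          -(dilogLog b z).re + 2 * Real.pi * (w.im * z.re + w.re * z.im) := by
        rw [show (-dilogLog b z - 2 * Real.pi * I * w * z) =
          -dilogLog b z + ((-2 * Real.pi : ℝ) : ℂ) * (I * (w * z)) by
            push_cast; ring, Complex.add_re, Complex.neg_re, Complex.re_ofReal_mul,
          Complex.I_mul_re, Complex.mul_im]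
        ring
      rw [e1]
      have key1 : w.re * z.im ≤ |w.re| * η₂ := by
        refine (le_abs_self _).trans ?_
        rw [abs_mul, abs_of_nonpos him]
        gcongr
        linarith
      have k1 : κ ≤ w.im := min_le_left _ _
      have k2 : κ ≤ η₁ - w.im := min_le_right _ _
      have key2 : w.im * z.re + max z.re 0 * z.im ≤ -(κ * |z.re|) := by
        rcases le_total z.re 0 with ht | ht
        · rw [max_eq_right ht, abs_of_nonpos ht]
          nlinarith
        · rw [max_eq_left ht, abs_of_nonneg ht]
          nlinarith
      nlinarith)
  have e : ∀ η : ℝ, ∀ u : ℝ, (u + ((-η : ℝ) : ℂ) * I : ℂ) = u - η * I := by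
    intro η u
    push_cast
    ring
  simp only [e] at h
  exact h

/-- The functional equation of the Fourier transform. -/
lemma dilogFourier_add {b : ℝ} (hb : 0 < b) {η : ℝ} (hη : η < dilogWidth b) {w : ℂ}
    (h0 : 0 < w.im) (h1 : w.im < η - b) :
    dilogFourier b η (w + b * I) = cexp (-(Real.pi * I * b ^ 2)) *
      (cexp (-(2 * Real.pi * b * w)) - 1) * dilogFourier b η w := by
  have hbc : (b : ℂ) ≠ 0 := by exact_mod_cast hb.ne'
  have hb2 : dilogWidth b - b / 2 = 1 / (2 * b) := by
    rw [dilogWidth_ofReal]; field_simp; ring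
  have hη0 : 0 < η := by linarith
  have i1 := integrable_dilogFourier_integrand hb hη0 hη h0 (by linarith)
  have i2 := integrable_dilogFourier_integrand hb hη0 hη (w := w + b * I) (by simp; linarith)
    (by simp; linarith)
  -- Raising the contour by ib replaces 1/Φ(z) by 1/Φ(z + ib). The functional equation expresses
  -- this through 1/Φ(z), and its factor e^{2πbz} shifts w to w + ib.
  have hshift := dilogFourier_eq_of_lt hb (show η - b < η by linarith) hη h0 h1
  have hsum : dilogFourier b (η - b) w = cexp (2 * Real.pi * b * w) * dilogFourier b η w +
      cexp (2 * Real.pi * b * w + Real.pi * I * b ^ 2) * dilogFourier b η (w + b * I) := by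
    rw [dilogFourier, dilogFourier, dilogFourier, ← integral_const_mul, ← integral_const_mul,
      ← integral_add (i1.const_mul _) (i2.const_mul _)]
    refine integral_congr_ae (ae_of_all _ fun t => ?_)
    simp only
    set z : ℂ := t - η * I with hz
    have hfe := exp_dilogLog_sub_eq hb (z := z + I * b / 2) (by
      have : (z + I * b / 2).im = -η + b / 2 := by simp [hz]
      rw [this]
      exact abs_lt.2 ⟨by linarith, by linarith⟩)
    have e1 : z + I * b / 2 - I * b / 2 = z := by ring
    have e2 : z + I * b / 2 + I * b / 2 = (t : ℂ) - ((η - b : ℝ) : ℂ) * I := by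
      rw [hz]; push_cast; ring
    rw [e1, e2] at hfe
    have e3 : cexp (-dilogLog b (t - ((η - b : ℝ) : ℂ) * I)) =
        (1 + cexp (2 * Real.pi * b * (z + I * b / 2))) * cexp (-dilogLog b z) := by
      rw [Complex.exp_neg, Complex.exp_neg, hfe]
      have n1 := Complex.exp_ne_zero (dilogLog b z)
      rw [hfe] at n1
      have n2 := left_ne_zero_of_mul n1
      have n3 := right_ne_zero_of_mul n1
      generalize 1 + cexp (2 * Real.pi * b * (z + I * b / 2)) = X at n2 ⊢
      field_simp
    have e4 : -2 * Real.pi * I * w * (t - ((η - b : ℝ) : ℂ) * I) =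
        2 * Real.pi * b * w + -(2 * Real.pi * I * w * z) := by
      rw [hz]
      push_cast
      linear_combination (-2 * Real.pi * b * w) * I_mul_I
    have e5 : -(2 * Real.pi * I * (w + b * I) * z) =
        -(2 * Real.pi * I * w * z) + 2 * Real.pi * b * z := by
      linear_combination (-2 * Real.pi * b * z) * I_mul_I
    have e6 : (2 * Real.pi * b * (z + I * b / 2) : ℂ) =
        2 * Real.pi * b * z + Real.pi * I * b ^ 2 := by ring
    rw [show -dilogLog b (t - ((η - b : ℝ) : ℂ) * I) - 2 * Real.pi * I * w *
      (t - ((η - b : ℝ) : ℂ) * I) = -dilogLog b (t - ((η - b : ℝ) : ℂ) * I) +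
        (-2 * Real.pi * I * w * (t - ((η - b : ℝ) : ℂ) * I)) by ring, Complex.exp_add, e3, e4, e6,
      sub_eq_add_neg, sub_eq_add_neg, e5]
    simp only [Complex.exp_add]
    ring
  rw [← hshift] at hsum
  have n1 : cexp (-(2 * Real.pi * b * w)) * cexp (2 * Real.pi * b * w) = 1 := by
    rw [← Complex.exp_add]; simp
  have n2 : cexp (-(Real.pi * I * b ^ 2)) * cexp (Real.pi * I * b ^ 2) = 1 := by
    rw [← Complex.exp_add]; simp
  rw [Complex.exp_add] at hsum
  set G := dilogFourier b η w
  set G' := dilogFourier b η (w + b * I)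
  set A := cexp (-(2 * Real.pi * b * w))
  set A' := cexp (2 * Real.pi * b * w)
  set B := cexp (-(Real.pi * I * b ^ 2))
  set B' := cexp (Real.pi * I * b ^ 2)
  linear_combination (-A * B) * hsum - (B * G + B * B' * G') * n1 - G' * n2

lemma dilogDual_add {b : ℝ} (hb : 0 < b) {w : ℂ} (h0 : 0 < w.im) (h1 : w.im < 1 / b) :
    dilogDual b (w + b * I) = cexp (-(Real.pi * I * b ^ 2)) *
      (cexp (-(2 * Real.pi * b * w)) - 1) * dilogDual b w := by
  have h := exp_neg_dilogLog_shift hb h0 h1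
  have n1 : cexp (-(2 * Real.pi * b * w)) * cexp (2 * Real.pi * b * w) = 1 := by
    rw [← Complex.exp_add]; simp
  have e1 : Real.pi * I * (w + b * I) ^ 2 = Real.pi * I * w ^ 2 + -(2 * Real.pi * b * w) +
      -(Real.pi * I * b ^ 2) := by
    linear_combination (2 * Real.pi * b * w + Real.pi * I * b ^ 2) * I_mul_I
  rw [dilogDual, dilogDual, sub_eq_add_neg, Complex.exp_add, e1, Complex.exp_add, Complex.exp_add,
    sub_eq_add_neg (_ * _ ^ 2), Complex.exp_add, mul_comm (b : ℂ) I, h]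
  linear_combination (-cexp (Real.pi * I * w ^ 2) * cexp (-(Real.pi * I * b ^ 2)) *
    cexp (-dilogLog b (w - I * dilogWidth b))) * n1

lemma differentiableAt_dilogDual {b : ℝ} (hb : 0 < b) {w : ℂ} (h0 : 0 < w.im)
    (h1 : w.im < dilogWidth b) : DifferentiableAt ℂ (dilogDual b) w := by
  have hre : 0 < (b : ℂ).re := by simpa using hb
  have hc : DifferentiableAt ℂ (fun w => dilogLog b (w - I * dilogWidth b)) w := by
    refine differentiableAt_dilogLog_comp (B := fun _ => b) (Z := fun w => w - I * dilogWidth b)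
      (Eventually.of_forall fun _ => differentiableAt_const _)
      (Eventually.of_forall fun _ => by fun_prop) hre ?_
    have : (w - I * dilogWidth b).im = w.im - dilogWidth b := by simp
    rw [this]
    exact abs_lt.2 ⟨by linarith, by linarith⟩
  unfold dilogDual
  fun_prop

/-- The Fourier transform is proportional to its closed form. -/
theorem exists_dilogFourier_eq {b : ℝ} (hb : 0 < b) (hb1 : b < 1) {η : ℝ} (hbη : b < η)
    (hη : η < dilogWidth b) :
    ∃ ρ : ℂ, ∀ w : ℂ, 0 < w.im → w.im < η → dilogFourier b η w = ρ * dilogDual b w := by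
  have hη0 : 0 < η := hb.trans hbη
  -- This is where b < 1 enters: the quotient R grows at rate at most 2πq, and the Liouville
  -- argument needs a rate below 2π/b.
  have hq : dilogWidth b < 1 / b := by
    rw [dilogWidth_ofReal, one_div]
    have : 1 < b⁻¹ := (one_lt_inv₀ hb).2 hb1
    linarith
  have hq0 : 0 < dilogWidth b := hη0.trans hη
  set U : Set ℂ := {w | 0 < w.im ∧ w.im < η} with hU
  have hUo : IsOpen U := (isOpen_lt continuous_const continuous_im).inter
    (isOpen_lt continuous_im continuous_const)
  have hUc : Convex ℝ U := (convex_halfSpace_im_gt 0).inter (convex_halfSpace_im_lt η)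
  have hH0 : ∀ w, dilogDual b w ≠ 0 := fun w => Complex.exp_ne_zero _
  set R : ℂ → ℂ := fun w => dilogFourier b η w / dilogDual b w with hR
  have hRd : DifferentiableOn ℂ R U := fun w hw =>
    ((differentiableAt_dilogFourier hb hη0 hη hw.1 hw.2).div
      (differentiableAt_dilogDual hb hw.1 (hw.2.trans hη)) (hH0 w)).differentiableWithinAt
  have hπ := Real.pi_pos
  have hder : U.EqOn (deriv R) 0 := by
    intro w₀ hw₀
    -- The strip y₀ ≤ Im w ≤ y₀ + b contains w₀ in its interior and stays inside 0 < Im w < η.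
    obtain ⟨y₀, hy1, hy2⟩ := exists_between (show max 0 (w₀.im - b) < min w₀.im (η - b) from
      max_lt (lt_min hw₀.1 (by linarith)) (lt_min (by linarith) (by linarith [hw₀.2])))
    have g1 := (le_max_left _ _).trans_lt hy1
    have g2 := (le_max_right _ _).trans_lt hy1
    have g3 := hy2.trans_le (min_le_left _ _)
    have g4 := hy2.trans_le (min_le_right _ _)
    have hκ : 0 < min y₀ (η - y₀ - b) := lt_min g1 (by linarith)
    set κ := min y₀ (η - y₀ - b)
    have k1 : κ ≤ y₀ := min_le_left _ _
    have k2 : κ ≤ η - y₀ - b := min_le_right _ _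
    obtain ⟨C₁, hC₁⟩ := exists_norm_dilogFourier_le hb hη0 hη hκ
    obtain ⟨C₂, hC₂⟩ := exists_abs_re_dilogLog_add_le hb hκ
    refine deriv_eq_zero_of_periodic_strip (C := |C₁| * Real.exp C₂)
      (κ := 2 * Real.pi * dilogWidth b) hb hUo
      (fun w h1 h2 => ⟨by linarith, by linarith⟩) hRd (fun w hw => ?_) (by positivity)
      ?_ (fun w h1 h2 => ?_) g3 (by linarith)
    · simp only [hR]
      rw [dilogFourier_add hb hη (by rw [hw]; exact g1) (by rw [hw]; exact g4),
        dilogDual_add hb (by rw [hw]; exact g1) (by rw [hw]; linarith), mul_div_mul_left]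
      have h3 := dilogDual_add hb (w := w) (by rw [hw]; exact g1) (by rw [hw]; linarith)
      intro h4
      rw [h4, zero_mul] at h3
      exact hH0 _ h3
    · rw [lt_div_iff₀ hb]
      rw [lt_div_iff₀ hb] at hq
      nlinarith
    · have b1 := hC₁ w (by linarith) (by linarith)
      have him : (w - I * dilogWidth b).im = w.im - dilogWidth b := by simp
      have hre : (w - I * dilogWidth b).re = w.re := by simp
      have b2 := hC₂ (w - I * dilogWidth b) (by
        rw [him, abs_of_nonpos (by linarith)]
        linarith)
      rw [him, hre] at b2
      have b3 := (abs_le.1 b2).2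
      have b4 : ‖dilogFourier b η w‖ ≤ |C₁| * Real.exp (-(2 * Real.pi * η * w.re)) :=
        b1.trans (mul_le_mul_of_nonneg_right (le_abs_self _) (Real.exp_pos _).le)
      have b5 : ‖dilogDual b w‖ = Real.exp (-(2 * Real.pi * w.re * w.im) -
          (dilogLog b (w - I * dilogWidth b)).re) := by
        rw [dilogDual, Complex.norm_exp, Complex.sub_re, mul_assoc, Complex.re_ofReal_mul,
          Complex.I_mul_re, pow_two, Complex.mul_im]
        congr 1
        ring
      simp only [hR]
      rw [norm_div, b5]
      refine (div_le_div_of_nonneg_right b4 (Real.exp_pos _).le).trans ?_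
      rw [mul_div_assoc, ← Real.exp_sub, mul_assoc |C₁|, ← Real.exp_add]
      refine mul_le_mul_of_nonneg_left (Real.exp_le_exp.2 ?_) (abs_nonneg _)
      have key : -(η * w.re) + w.re * w.im - max w.re 0 * (w.im - dilogWidth b) ≤
          dilogWidth b * |w.re| := by
        rcases le_total w.re 0 with ht | ht
        · rw [max_eq_right ht, abs_of_nonpos ht]
          nlinarith
        · rw [max_eq_left ht, abs_of_nonneg ht]
          nlinarith
      nlinarith
  have hmem : ((η / 2 : ℝ) : ℂ) * I ∈ U := by
    constructor <;> simp <;> linarith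
  refine ⟨R (((η / 2 : ℝ) : ℂ) * I), fun w h1 h2 => ?_⟩
  have := hUo.is_const_of_deriv_eq_zero hUc.isPreconnected hRd hder (x := w) ⟨h1, h2⟩ hmem
  rw [← this]
  simp only [hR]
  rw [div_mul_cancel₀ _ (hH0 w)]

/-- The simple pole at the origin of the Fourier transform of the reciprocal of the quantum
dilogarithm. -/
lemma tendsto_mul_dilogFourier {b : ℝ} (hb : 0 < b) {η : ℝ} (hη0 : 0 < η)
    (hη : η < dilogWidth b) :
    Tendsto (fun σ : ℝ => (σ : ℂ) * dilogFourier b η (σ * I)) (𝓝[>] 0)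
      (𝓝 (1 / (2 * Real.pi))) := by
  have hπ := Real.pi_pos
  have hre : 0 < (b : ℂ).re := by simpa using hb
  have hηd := sub_pos.2 hη
  obtain ⟨C, hC⟩ := exists_abs_re_dilogLog_add_le hb hηd
  obtain ⟨M, ε, hM, hε, hbd⟩ := exists_norm_dilogLog_le hre hηd
  have hbd' := hbd.self_of_nhds
  have him : ∀ t : ℝ, (t - η * I : ℂ).im = -η := fun t => by simp
  have hret : ∀ t : ℝ, (t - η * I : ℂ).re = t := fun t => by simp
  have hκ0 : 0 < min (2 * Real.pi * η) (2 * ε) := lt_min (by positivity) (by positivity)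
  set κ := min (2 * Real.pi * η) (2 * ε)
  -- The pole comes from 1/Φ → 1 at -∞. Without this step function the remainder e decays
  -- exponentially at both ends and contributes a bounded term.
  set J : ℝ → ℂ := (Set.Iic (0 : ℝ)).indicator fun _ => 1 with hJ
  set e : ℝ → ℂ := fun t => cexp (-dilogLog b (t - η * I)) - J t with he
  set K := max (Real.exp C) (M * Real.exp M) with hK
  have hKpos : 0 < K := (Real.exp_pos C).trans_le (le_max_left _ _)
  have heb : ∀ t, ‖e t‖ ≤ K * Real.exp (-(κ * |t|)) := by
    intro t
    have hcond : dilogWidth b - η ≤ dilogWidth b - |(t - η * I : ℂ).im| := by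
      rw [him, abs_neg, abs_of_pos hη0]
    rcases le_or_gt t 0 with ht | ht
    · have h1 := hbd' _ hcond
      rw [hret] at h1
      have h2 : M * Real.exp (2 * ε * t) ≤ M := by
        have : Real.exp (2 * ε * t) ≤ 1 :=
          Real.exp_le_one_iff.2 (mul_nonpos_of_nonneg_of_nonpos (by positivity) ht)
        nlinarith
      have h3 : e t = cexp (-dilogLog b (t - η * I)) - 1 := by
        simp only [he, hJ]
        rw [Set.indicator_of_mem (Set.mem_Iic.2 ht)]
      have h4 := norm_exp_sub_sum_le_norm_mul_exp (-dilogLog b (t - η * I)) 1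
      simp only [Finset.sum_range_one, pow_zero, Nat.factorial_zero, Nat.cast_one, div_one,
        pow_one, norm_neg] at h4
      rw [h3]
      calc _ ≤ _ := h4
        _ ≤ (M * Real.exp (2 * ε * t)) * Real.exp M := by
            gcongr
            exact h1.trans h2
        _ = (M * Real.exp M) * Real.exp (-(2 * ε * |t|)) := by
            rw [abs_of_nonpos ht]
            ring_nf
        _ ≤ _ := by
            gcongr
            · exact le_max_right _ _
            · exact min_le_right _ _
    · have h1 := (abs_le.1 (hC _ hcond)).1
      rw [hret, him, max_eq_left ht.le] at h1
      have h3 : e t = cexp (-dilogLog b (t - η * I)) := by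
        simp only [he, hJ]
        rw [Set.indicator_of_notMem (by simpa using ht), sub_zero]
      rw [h3, Complex.norm_exp, Complex.neg_re]
      calc _ ≤ Real.exp (C + -(2 * Real.pi * η * |t|)) := by
            apply Real.exp_le_exp.2
            rw [abs_of_pos ht]
            linarith
        _ = Real.exp C * Real.exp (-(2 * Real.pi * η * |t|)) := Real.exp_add _ _
        _ ≤ _ := by
            gcongr
            · exact le_max_left _ _
            · exact min_le_left _ _
  have hint : Integrable (fun t : ℝ => Real.exp (-(κ / 2 * |t|))) :=
    integrable_exp_neg_mul_abs (half_pos hκ0)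
  set N := ∫ t : ℝ, K * Real.exp (-(κ / 2 * |t|)) with hN
  -- The bound on σ lets e^{2πσt} consume at most half of the decay rate κ, so N does not depend on
  -- σ.
  have hsplit : ∀ σ : ℝ, 0 < σ → σ < η → σ < κ / (4 * Real.pi) → ∃ r : ℂ, ‖r‖ ≤ N ∧
      dilogFourier b η (σ * I) = cexp (-(2 * Real.pi * σ * η * I)) * (r + 1 / (2 * Real.pi * σ)) := by
    intro σ hσ hση hσκ
    have hσc : (σ : ℂ) ≠ 0 := by exact_mod_cast hσ.ne'
    have hind : Integrable (fun t : ℝ => J t * cexp (2 * Real.pi * σ * t)) := by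
      have := (integrableOn_exp_mul_complex_Iic (a := ((2 * Real.pi * σ : ℝ) : ℂ))
        (by rw [Complex.ofReal_re]; positivity) 0).integrable_indicator measurableSet_Iic
      refine this.congr (ae_of_all _ fun t => ?_)
      simp only [hJ, Set.indicator]
      split_ifs <;> push_cast <;> simp
    have hindval : ∫ t : ℝ, J t * cexp (2 * Real.pi * σ * t) = 1 / (2 * Real.pi * σ) := by
      have h := integral_exp_mul_complex_Iic (a := ((2 * Real.pi * σ : ℝ) : ℂ))
        (by rw [Complex.ofReal_re]; positivity) 0
      rw [← integral_indicator measurableSet_Iic] at h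
      simp only [Complex.ofReal_zero, mul_zero, Complex.exp_zero] at h
      push_cast at h
      rw [← h]
      refine integral_congr_ae (ae_of_all _ fun t => ?_)
      simp only [hJ, Set.indicator]
      split_ifs <;> simp
    have hfac : ∀ t : ℝ, cexp (-dilogLog b (t - η * I) - 2 * Real.pi * I * (σ * I) * (t - η * I)) =
        cexp (-(2 * Real.pi * σ * η * I)) *
          (e t * cexp (2 * Real.pi * σ * t) + J t * cexp (2 * Real.pi * σ * t)) := by
      intro t
      rw [← add_mul, show e t + J t = cexp (-dilogLog b (t - η * I)) by simp [he],
        ← Complex.exp_add, ← Complex.exp_add]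
      congr 1
      linear_combination (-(2 * Real.pi * σ) * (t - η * I)) * I_mul_I
    have htot := (integrable_dilogFourier_integrand hb hη0 hη (w := σ * I) (by simpa using hσ)
      (by simpa using hση)).const_mul (cexp (2 * Real.pi * σ * η * I))
    have hei : Integrable (fun t : ℝ => e t * cexp (2 * Real.pi * σ * t)) := by
      refine (htot.sub hind).congr (ae_of_all _ fun t => ?_)
      simp only [Pi.sub_apply]
      rw [hfac t, ← mul_assoc, ← Complex.exp_add]
      simp
    refine ⟨∫ t : ℝ, e t * cexp (2 * Real.pi * σ * t), ?_, ?_⟩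
    · refine norm_integral_le_of_norm_le (hint.const_mul K) (ae_of_all _ fun t => ?_)
      have h1 : ‖cexp (2 * Real.pi * σ * t)‖ = Real.exp (2 * Real.pi * σ * t) := by
        rw [Complex.norm_exp]
        congr 1
        rw [show (2 * Real.pi * σ * t : ℂ) = ((2 * Real.pi * σ * t : ℝ) : ℂ) by push_cast; rfl,
          Complex.ofReal_re]
      rw [norm_mul, h1]
      have h2 : 2 * Real.pi * σ * t ≤ κ / 2 * |t| := by
        rw [lt_div_iff₀ (by positivity)] at hσκ
        refine (mul_le_mul_of_nonneg_left (le_abs_self t) (by positivity)).trans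
          (mul_le_mul_of_nonneg_right ?_ (abs_nonneg t))
        linarith
      calc _ ≤ K * Real.exp (-(κ * |t|)) * Real.exp (κ / 2 * |t|) :=
            mul_le_mul (heb t) (Real.exp_le_exp.2 h2) (Real.exp_pos _).le (by positivity)
        _ = K * Real.exp (-(κ / 2 * |t|)) := by
            rw [mul_assoc, ← Real.exp_add]
            ring_nf
    · rw [dilogFourier, integral_congr_ae (ae_of_all _ hfac), integral_const_mul,
        integral_add hei hind, hindval]
  have hlim1 : Tendsto (fun σ : ℝ => σ * N) (𝓝[>] 0) (𝓝 0) := by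
    have : Tendsto (fun σ : ℝ => σ * N) (𝓝 0) (𝓝 (0 * N)) := tendsto_id.mul_const N
    rw [zero_mul] at this
    exact this.mono_left nhdsWithin_le_nhds
  have hev : ∀ᶠ σ : ℝ in 𝓝[>] 0, 0 < σ ∧ σ < η ∧ σ < κ / (4 * Real.pi) := by
    have h2 : ∀ᶠ σ : ℝ in 𝓝 0, σ < η := eventually_lt_nhds hη0
    have h3 : ∀ᶠ σ : ℝ in 𝓝 0, σ < κ / (4 * Real.pi) := eventually_lt_nhds (by positivity)
    filter_upwards [self_mem_nhdsWithin, nhdsWithin_le_nhds h2, nhdsWithin_le_nhds h3]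
      with σ a1 a2 a3 using ⟨a1, a2, a3⟩
  have hlim2 : Tendsto (fun σ : ℝ => cexp (2 * Real.pi * σ * η * I) *
      ((σ : ℂ) * dilogFourier b η (σ * I)) - 1 / (2 * Real.pi)) (𝓝[>] 0) (𝓝 0) := by
    refine squeeze_zero_norm' ?_ hlim1
    filter_upwards [hev] with σ hσ
    obtain ⟨r, hr, hG⟩ := hsplit σ hσ.1 hσ.2.1 hσ.2.2
    have hσc : (σ : ℂ) ≠ 0 := by exact_mod_cast hσ.1.ne'
    have hone : cexp (2 * Real.pi * σ * η * I) * cexp (-(2 * Real.pi * σ * η * I)) = 1 := by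
      rw [← Complex.exp_add]; simp
    have : cexp (2 * Real.pi * σ * η * I) * ((σ : ℂ) * dilogFourier b η (σ * I)) -
        1 / (2 * Real.pi) = σ * r := by
      rw [hG]
      have h5 : (σ : ℂ) * (1 / (2 * Real.pi * σ)) = 1 / (2 * Real.pi) := by
        field_simp
      linear_combination (σ * (r + 1 / (2 * Real.pi * σ))) * hone + h5
    rw [this, norm_mul, Complex.norm_real, Real.norm_eq_abs, abs_of_pos hσ.1]
    exact mul_le_mul_of_nonneg_left hr hσ.1.le
  have hphase : Tendsto (fun σ : ℝ => cexp (-(2 * Real.pi * σ * η * I))) (𝓝[>] 0) (𝓝 1) := by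
    have : Continuous (fun σ : ℝ => cexp (-(2 * Real.pi * σ * η * I))) := by fun_prop
    have h := this.tendsto 0
    simp only [Complex.ofReal_zero, mul_zero, zero_mul, neg_zero, Complex.exp_zero] at h
    exact h.mono_left nhdsWithin_le_nhds
  have hfin := hphase.mul (hlim2.add_const (1 / (2 * Real.pi) : ℂ))
  rw [zero_add, one_mul] at hfin
  refine hfin.congr fun σ => ?_
  have hone : cexp (-(2 * Real.pi * σ * η * I)) * cexp (2 * Real.pi * σ * η * I) = 1 := by
    rw [← Complex.exp_add]; simp
  linear_combination ((σ : ℂ) * dilogFourier b η (σ * I)) * hone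

/-- Comparison of the residues at the origin, through a functional equation with shift `b'`. -/
lemma mul_exp_neg_dilogLog_eq {b b' : ℝ} (hb : 0 < b) (hb' : 0 < b') {η : ℝ} (hη0 : 0 < η)
    (hη : η < dilogWidth b) {ρ : ℂ}
    (hρ : ∀ w : ℂ, 0 < w.im → w.im < η → dilogFourier b η w = ρ * dilogDual b w)
    (hb'w : |b' - dilogWidth b| < dilogWidth b)
    (hshift : ∀ w : ℂ, 0 < w.im → w.im < 1 / b' →
      w.im + b' < 2 * dilogWidth b → cexp (-dilogLog b (w + I * b' - I * dilogWidth b)) =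
      (1 - cexp (2 * Real.pi * b' * w)) * cexp (-dilogLog b (w - I * dilogWidth b))) :
    ρ * cexp (-dilogLog b (I * (b' - dilogWidth b))) = -(I * b') := by
  have hre : 0 < (b : ℂ).re := by simpa using hb
  have hπ : (Real.pi : ℂ) ≠ 0 := by exact_mod_cast Real.pi_ne_zero
  -- The simple zero of 1 - e^{2πb'w} cancels the pole of the transform. On the dual side the
  -- functional equation absorbs the same factor and leaves an expression continuous at 0.
  have h1 : Tendsto (fun σ : ℝ => (1 - cexp (2 * Real.pi * b' * (σ * I))) *
      dilogFourier b η (σ * I)) (𝓝[>] 0) (𝓝 (-(I * b'))) := by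
    have hd : HasDerivAt (fun σ : ℝ => 1 - cexp (2 * Real.pi * b' * (σ * I)))
        (-(2 * Real.pi * b' * I)) 0 := by
      have h0 : HasDerivAt (fun σ : ℝ => (2 * Real.pi * b' * (σ * I) : ℂ))
          (2 * Real.pi * b' * (1 * I)) 0 :=
        ((HasDerivAt.ofReal_comp (hasDerivAt_id (0 : ℝ))).mul_const I).const_mul _
      have := (h0.cexp).const_sub 1
      simpa using this
    have hs := hd.tendsto_slope_zero_right.mul (tendsto_mul_dilogFourier hb hη0 hη)
    have hval : -(2 * Real.pi * b' * I) * (1 / (2 * Real.pi)) = -(I * b') := by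
      field_simp
    rw [hval] at hs
    refine hs.congr' ?_
    filter_upwards [self_mem_nhdsWithin] with σ hσ
    have hσc : (σ : ℂ) ≠ 0 := by exact_mod_cast (Set.mem_Ioi.1 hσ).ne'
    simp only [zero_add, Complex.ofReal_zero, zero_mul, mul_zero, Complex.exp_zero, sub_self,
      sub_zero, Complex.real_smul, Complex.ofReal_inv]
    field_simp
  have h2 : Tendsto (fun σ : ℝ => ρ * (cexp (Real.pi * I * (σ * I) ^ 2) *
      cexp (-dilogLog b (σ * I + I * b' - I * dilogWidth b)))) (𝓝[>] 0)
      (𝓝 (ρ * cexp (-dilogLog b (I * (b' - dilogWidth b))))) := by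
    have hL : ContinuousAt (fun σ : ℝ => dilogLog b (σ * I + I * b' - I * dilogWidth b)) 0 := by
      refine ContinuousAt.comp (f := fun σ : ℝ => (σ * I + I * b' - I * dilogWidth b : ℂ))
        (g := dilogLog b) (differentiableAt_dilogLog hre ?_).continuousAt (by fun_prop)
      simpa using hb'w
    have hc : ContinuousAt (fun σ : ℝ => ρ * (cexp (Real.pi * I * (σ * I) ^ 2) *
      cexp (-dilogLog b (σ * I + I * b' - I * dilogWidth b)))) 0 := by fun_prop
    have := hc.tendsto.mono_left (nhdsWithin_le_nhds (s := Set.Ioi 0))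
    simpa [← mul_sub] using this
  refine (tendsto_nhds_unique (h1.congr' ?_) h2).symm
  have e2 : ∀ᶠ σ : ℝ in 𝓝 0, σ < η := eventually_lt_nhds hη0
  have e3 : ∀ᶠ σ : ℝ in 𝓝 0, σ < 1 / b' := eventually_lt_nhds (by positivity)
  have e4 : ∀ᶠ σ : ℝ in 𝓝 0, σ < 2 * dilogWidth b - b' :=
    eventually_lt_nhds (by linarith [(abs_lt.1 hb'w).2])
  filter_upwards [self_mem_nhdsWithin, nhdsWithin_le_nhds e2, nhdsWithin_le_nhds e3,
    nhdsWithin_le_nhds e4] with σ s1 s2 s3 s4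
  have s1' : 0 < σ := s1
  have him : ((σ : ℂ) * I).im = σ := by simp
  rw [hρ _ (by rwa [him]) (by rwa [him]), hshift _ (by rwa [him]) (by rwa [him])
    (by rw [him]; linarith), dilogDual, sub_eq_add_neg (_ * _ ^ 2), Complex.exp_add]
  ring

/-- The proportionality factor between the Fourier transform and its closed form. -/
theorem dilogFourier_eq {b : ℝ} (hb : 0 < b) (hb1 : b < 1) {η : ℝ} (hbη : b < η)
    (hη : η < dilogWidth b) {w : ℂ} (h0 : 0 < w.im) (h1 : w.im < η) :
    dilogFourier b η w = cexp (-(Real.pi * I / 12) - Real.pi * I * (b + (b : ℂ)⁻¹) ^ 2 / 12) *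
      dilogDual b w := by
  obtain ⟨ρ, hρ⟩ := exists_dilogFourier_eq hb hb1 hbη hη
  rw [hρ w h0 h1]
  congr 1
  have hre : 0 < (b : ℂ).re := by simpa using hb
  have hη0 : 0 < η := hb.trans hbη
  have hbi : 0 < b⁻¹ := inv_pos.2 hb
  have hbc : (b : ℂ) ≠ 0 := by exact_mod_cast hb.ne'
  have hq := dilogWidth_ofReal b
  have hy : b - dilogWidth b = -(b⁻¹ - dilogWidth b) := by rw [hq]; ring
  have hinvc : ((b⁻¹ : ℝ) : ℂ) = (b : ℂ)⁻¹ := Complex.ofReal_inv b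
  have hwinv : dilogWidth ((b⁻¹ : ℝ) : ℂ) = dilogWidth b := by rw [hinvc, dilogWidth_inv]
  have hbw : |b - dilogWidth b| < dilogWidth b := by
    rw [hq]
    exact abs_lt.2 ⟨by linarith, by linarith⟩
  have E1 := mul_exp_neg_dilogLog_eq hb hb hη0 hη hρ hbw
    (fun w h0 h1 _ => exp_neg_dilogLog_shift hb h0 h1)
  -- Invariance of the exponent under b ↦ b⁻¹ supplies the functional equation with the dual step.
  -- The two equations for ρ involve opposite points ±z.
  have E2 := mul_exp_neg_dilogLog_eq hb hbi hη0 hη hρ (by rw [← abs_neg, ← hy]; exact hbw)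
    (fun w h0 h1 h2 => by
      have h := exp_neg_dilogLog_shift hbi h0 h1
      have hq0 : 0 < dilogWidth b := hη0.trans hη
      have hwlt : w.im < 2 * dilogWidth b := by linarith
      rw [hwinv, hinvc, dilogLog_inv hre (by
        have : (w + I * (b : ℂ)⁻¹ - I * dilogWidth b).im = w.im + b⁻¹ - dilogWidth b := by
          rw [← hinvc]; simp
        rw [this]
        exact abs_lt.2 ⟨by linarith, by linarith⟩), dilogLog_inv hre (by
        have : (w - I * dilogWidth b).im = w.im - dilogWidth b := by simp
        rw [this]
        exact abs_lt.2 ⟨by linarith, by linarith⟩)] at h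
      rw [hinvc]
      exact h)
  have hz : (I * (((b⁻¹ : ℝ) : ℂ) - dilogWidth b) : ℂ) = -(I * (b - dilogWidth b)) := by
    rw [hq]; push_cast; ring
  rw [hz] at E2
  set z : ℂ := I * (b - dilogWidth b) with hzd
  have hzconj : (starRingEnd ℂ) z = -z := by
    simp [hzd]
  have hzim : |z.im| < dilogWidth b := by simpa [hzd] using hbw
  have hconj := conj_dilogLog (β := b) (Or.inl (Complex.conj_ofReal b)) z
  rw [hzconj] at hconj
  have hinv := dilogLog_add_dilogLog_neg hre hzim
  -- Inversion gives 2iφ as the sum of the exponents at z and -z. As z is imaginary, unitarity makes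
  -- their real parts opposite and their imaginary parts equal, hence both φ.
  set φ : ℝ := Real.pi / 2 * (5 / 6 - (b + b⁻¹) ^ 2 / 6) with hφ
  have hsum : dilogLog b z + dilogLog b (-z) = 2 * φ * I := by
    rw [hinv, hφ, hzd, hq]
    push_cast
    field_simp
    linear_combination ((b : ℂ) ^ 2 - 1) ^ 2 * 72 * I_mul_I
  set x : ℝ := (dilogLog b z).re with hx
  have hneg : dilogLog b (-z) = -(starRingEnd ℂ) (dilogLog b z) := by rw [hconj, neg_neg]
  have hL : dilogLog b z = x + φ * I := by
    have him := congrArg Complex.im hsum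
    rw [hneg] at him
    simp at him
    apply Complex.ext
    · simp [hx]
    · simp
      linarith
  have hL' : dilogLog b (-z) = -x + φ * I := by
    rw [hneg, hL]
    simp
    ring
  rw [hL] at E1
  rw [hL'] at E2
  have hρ1 : ρ = -(I * b) * cexp (x + φ * I) := by
    rw [← E1, mul_assoc, ← Complex.exp_add]; simp
  have hρ2 : ρ = -(I * ((b⁻¹ : ℝ) : ℂ)) * cexp (-x + φ * I) := by
    rw [← E2, mul_assoc, ← Complex.exp_add]; simp
  -- The two expressions for ρ give b e^x = (b e^x)⁻¹, and positivity excludes -1; only the phase -i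
  -- e^{iφ} survives in ρ.
  have hv : b * Real.exp x = 1 := by
    have h3 : (b * Real.exp x : ℝ) = (b * Real.exp x)⁻¹ := by
      have h4 := hρ1.symm.trans hρ2
      rw [Complex.exp_add, Complex.exp_add] at h4
      have h5 : ((b : ℂ) * cexp x) = ((b⁻¹ : ℝ) : ℂ) * cexp (-x) := by
        have n1 := Complex.exp_ne_zero (φ * I)
        have n2 := I_ne_zero
        have : (I * cexp (φ * I)) * ((b : ℂ) * cexp x) =
            (I * cexp (φ * I)) * (((b⁻¹ : ℝ) : ℂ) * cexp (-x)) := by linear_combination -h4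
        exact mul_left_cancel₀ (mul_ne_zero n2 n1) this
      rw [mul_inv, ← Real.exp_neg]
      have h6 : ((b * Real.exp x : ℝ) : ℂ) = ((b⁻¹ * Real.exp (-x) : ℝ) : ℂ) := by
        push_cast
        push_cast at h5
        exact h5
      exact_mod_cast h6
    have h4 : 0 < b * Real.exp x := by positivity
    have h5 : (b * Real.exp x) * (b * Real.exp x) = 1 := by
      nth_rewrite 2 [h3]
      exact mul_inv_cancel₀ h4.ne'
    nlinarith
  have hv' : (b : ℂ) * cexp x = 1 := by
    have := congrArg (fun r : ℝ => (r : ℂ)) hv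
    push_cast at this
    exact this
  have hI : -I = cexp (-(Real.pi / 2 * I)) := by
    rw [Complex.exp_neg, Complex.exp_pi_div_two_mul_I, Complex.inv_I]
  calc ρ = -I * ((b : ℂ) * cexp x) * cexp (φ * I) := by rw [hρ1, Complex.exp_add]; ring
    _ = cexp (-(Real.pi / 2 * I)) * cexp (φ * I) := by rw [hv', mul_one, hI]
    _ = _ := by
      rw [← Complex.exp_add, hφ]
      congr 1
      push_cast
      ring

/-! ### Fourier duality of ψ and continuation in the parameter. -/

/-- The Fourier transform of `ψ_{a,c}` for a small positive quantum parameter. -/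
lemma psiTilde_eq_of_small {b : ℝ} (hb : 0 < b) (hb1 : b < 1) {a c : ℝ} (ha : 0 < a) (hc : 0 < c)
    (hac : a + c < 1 / 2) (hsmall : b ^ 2 < a + c) (s : ℝ) :
    psiTilde b a c s = cexp (-(Real.pi * I / 12)) * cexp (Real.pi * I * s ^ 2) *
      psiFun b c (1 / 2 - a - c) s := by
  have hbc : (b : ℂ) ≠ 0 := by exact_mod_cast hb.ne'
  have hq := dilogWidth_ofReal b
  have hb' : 0 < b⁻¹ := inv_pos.2 hb
  set S : ℝ := b + b⁻¹ with hS
  have hSc : (b : ℂ) + (b : ℂ)⁻¹ = (S : ℂ) := by rw [hS]; push_cast; rfl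
  have hSpos : 0 < S := by positivity
  set η : ℝ := S * (a + c) with hη
  -- Smallness of b is used here: the strip 0 < Im w < η must be wider than the step b of the
  -- difference equation.
  have hbη : b < η := by
    have h1 : b⁻¹ * b ^ 2 < b⁻¹ * (a + c) := by gcongr
    have h2 : b⁻¹ * b ^ 2 = b := by field_simp
    have h3 : 0 < b * (a + c) := by positivity
    rw [hη, hS]
    linarith
  have hηq : η < dilogWidth b := by
    rw [hq, hη]
    nlinarith
  -- The imaginary part S·a encodes the exponential factor of ψ_{a,c}, and w - iq is the dilogarithm
  -- argument in ψ_{c,b}(s).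
  set w : ℂ := s + I * (S * a : ℝ) with hw
  have hwim : w.im = S * a := by simp [hw]
  have hG := dilogFourier_eq hb hb1 hbη hηq (w := w) (by rw [hwim]; positivity)
    (by rw [hwim, hη]; gcongr; linarith)
  have hlhs : psiTilde b a c s = cexp (2 * Real.pi * s * S * (a + c) +
      Real.pi * I * S ^ 2 * a * (a + c) + Real.pi * I * S ^ 2 * (4 * (a - c) + 1) / 24) *
      dilogFourier b η w := by
    rw [psiTilde, dilogFourier, ← integral_const_mul]
    refine integral_congr_ae (ae_of_all _ fun t => ?_)
    simp only
    rw [psiFun_eq, hSc, ← Complex.exp_add, ← Complex.exp_add]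
    have : (t : ℂ) - I * S * (a + c) = t - η * I := by rw [hη]; push_cast; ring
    rw [this]
    congr 1
    rw [hw, hη]
    push_cast
    linear_combination (2 * Real.pi * S * a * t - 2 * Real.pi * s * S * (a + c) -
      2 * Real.pi * I * S ^ 2 * a * (a + c)) * I_mul_I
  rw [hlhs, hG, dilogDual, psiFun_eq, hSc, ← Complex.exp_add, ← Complex.exp_add,
    ← Complex.exp_add, ← Complex.exp_add]
  have : (s : ℂ) - I * S * (c + ((1 / 2 - a - c : ℝ) : ℂ)) = w - I * dilogWidth b := by
    rw [hw, hq]; push_cast; ring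
  rw [this]
  congr 1
  rw [hw]
  push_cast
  linear_combination (2 * Real.pi * S * a * s + Real.pi * I * S ^ 2 * a ^ 2) * I_mul_I

/-- The Fourier transform of `ψ_{a,c}`. -/
theorem psiTilde_eq {β : ℂ} (hβ : 0 < β.re) {a c : ℝ} (ha : 0 < a) (hc : 0 < c)
    (hac : a + c < 1 / 2) (s : ℝ) :
    psiTilde β a c s = cexp (-(Real.pi * I / 12)) * cexp (Real.pi * I * s ^ 2) *
      psiFun β c (1 / 2 - a - c) s := by
  set U : Set ℂ := {β | 0 < β.re} with hU
  have hUo : IsOpen U := isOpen_lt continuous_const continuous_re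
  have hUc : IsPreconnected U := (convex_halfSpace_re_gt 0).isPreconnected
  have hf : AnalyticOnNhd ℂ (fun β => psiTilde β a c s) U :=
    DifferentiableOn.analyticOnNhd (fun β hβ =>
      (differentiableAt_psiTilde hβ ha hc hac s).differentiableWithinAt) hUo
  have hg : AnalyticOnNhd ℂ (fun β => cexp (-(Real.pi * I / 12)) * cexp (Real.pi * I * s ^ 2) *
      psiFun β c (1 / 2 - a - c) s) U :=
    DifferentiableOn.analyticOnNhd (fun β hβ =>
      ((differentiableAt_psiFun hβ (by linarith) (by linarith) s).const_mul
        _).differentiableWithinAt) hUo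
  have hx0 : 0 < (a + c) / 2 := by linarith
  have hz0 : (((a + c) / 2 : ℝ) : ℂ) ∈ U := by
    rw [hU, Set.mem_ofPred_eq, Complex.ofReal_re]
    exact hx0
  -- Real parameters near (a + c)/2 are below 1 and have squares below a + c, so the small case
  -- covers a set accumulating at that point.
  refine hf.eqOn_of_preconnected_of_frequently_eq hg hUc hz0 ?_ hβ
  have htend : Tendsto (fun x : ℝ => (x : ℂ)) (𝓝[≠] ((a + c) / 2))
      (𝓝[≠] (((a + c) / 2 : ℝ) : ℂ)) := by
    refine tendsto_nhdsWithin_iff.2 ⟨?_, ?_⟩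
    · exact (Complex.continuous_ofReal.tendsto _).mono_left nhdsWithin_le_nhds
    · filter_upwards [self_mem_nhdsWithin] with x hx
      exact fun h => hx (Complex.ofReal_injective h)
  refine htend.frequently (Eventually.frequently ?_)
  have h1 : ∀ᶠ x in 𝓝 ((a + c) / 2), 0 < x := eventually_gt_nhds hx0
  have h2 : ∀ᶠ x in 𝓝 ((a + c) / 2), x < a + c := eventually_lt_nhds (by linarith)
  filter_upwards [nhdsWithin_le_nhds h1, nhdsWithin_le_nhds h2] with x hx1 hx2
  exact psiTilde_eq_of_small hx1 (by linarith) ha hc hac (by nlinarith) s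

/-! ### Conjugation of ψ and the terms of the tetrahedral weight. -/

/-- A real square with positive real part of the root forces β + β⁻¹ to be real, that is Im β ·
(|β|² - 1) = 0. -/
lemma conj_eq_self_or_eq_inv {r : ℝ} {β : ℂ} (hβ : 0 < β.re)
    (hr : (β + β⁻¹) ^ 2 = (r : ℂ)) :
    (starRingEnd ℂ) β = β ∨ (starRingEnd ℂ) β = β⁻¹ := by
  have hβ0 := ne_zero_of_re_pos hβ
  have hN := normSq_pos.2 hβ0
  have hre : 0 < (β + β⁻¹).re := by
    rw [add_re]
    exact add_pos hβ (inv_re_pos hβ)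
  have him : (β + β⁻¹).im = 0 := by
    have h := congrArg Complex.im hr
    rw [sq, mul_im, ofReal_im] at h
    have : (β + β⁻¹).re * (β + β⁻¹).im = 0 := by linarith
    exact (mul_eq_zero.1 this).resolve_left hre.ne'
  have h : β.im * (normSq β - 1) = 0 := by
    rw [add_im, inv_im] at him
    field_simp at him
    linarith
  rcases mul_eq_zero.1 h with h | h
  · exact Or.inl (conj_eq_iff_im.2 h)
  · right
    exact eq_inv_of_mul_eq_one_right (by rw [mul_conj, sub_eq_zero.1 h, ofReal_one])

lemma conj_add_inv {β : ℂ} (hβ : (starRingEnd ℂ) β = β ∨ (starRingEnd ℂ) β = β⁻¹) :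
    (starRingEnd ℂ) (β + β⁻¹) = β + β⁻¹ := by
  rw [map_add, map_inv₀]
  rcases hβ with h | h <;> rw [h]
  rw [inv_inv, add_comm]

/-- Unitarity turns the conjugate of 1/Φ(z) into Φ at the conjugate point, and inversion turns that
into 1/Φ at the opposite point. The inversion constant produces the Gaussian and e^{-πi/6}. -/
lemma conj_psiFun {β : ℂ} (hβ : 0 < β.re)
    (hβ' : (starRingEnd ℂ) β = β ∨ (starRingEnd ℂ) β = β⁻¹) {a c : ℝ} (hac : 0 ≤ a + c)
    (hac' : a + c < 1 / 2) (t : ℝ) :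
    (starRingEnd ℂ) (psiFun β a c t) =
      cexp (-(Real.pi * I / 6)) * cexp (Real.pi * I * t ^ 2) * psiFun β c a (-t) := by
  have hs := conj_add_inv hβ'
  have hz := abs_im_dilogArg_lt hβ (a := c) (c := a) (by linarith) (by linarith) (-t)
  have hinv := dilogLog_add_dilogLog_neg hβ hz
  rw [psiFun_eq, psiFun_eq, ← Complex.exp_conj, ← Complex.exp_add, ← Complex.exp_add]
  congr 1
  simp only [map_add, map_neg, conj_dilogLog hβ', map_sub, map_mul, map_div₀, map_pow, conj_I,
    conj_ofReal, map_ofNat, map_one]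
  rw [← map_add, hs]
  set s := β + β⁻¹
  rw [show (t : ℂ) - -I * s * (a + c) = -(((-t : ℝ) : ℂ) - I * s * (c + a)) by push_cast; ring]
  push_cast at hinv ⊢
  linear_combination hinv + (Real.pi * I * s ^ 2 * (a + c) ^ 2 +
    2 * Real.pi * t * s * (a + c)) * I_mul_I

lemma weightTerm_eq {β : ℂ} (hβ : 0 < β.re) {a c : ℝ} (ha : 0 < a) (hc : 0 < c)
    (hac : a + c < 1 / 2) (x y : ℝ) (m : ℤ) :
    weightTerm β a c x y m = cexp (-(Real.pi * I / 12)) * psiFun β c (1 / 2 - a - c) (x + m) *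
      cexp (I * Real.pi * y * (x + 2 * m)) := by
  rw [weightTerm, psiTildePrime, psiTilde_eq hβ ha hc hac]
  have : cexp (-Real.pi * I * ((x + m : ℝ) : ℂ) ^ 2) * cexp (Real.pi * I * ((x + m : ℝ) : ℂ) ^ 2)
      = 1 := by
    rw [← Complex.exp_add, ← Complex.exp_zero]
    ring_nf
  linear_combination (cexp (-(Real.pi * I / 12)) * psiFun β c (1 / 2 - a - c) (x + m) *
      cexp (I * Real.pi * y * (x + 2 * m))) * this

/-- Exponential decay is weakened to the power decay that Poisson summation and the comparison with
Σ |m|⁻² take as input. -/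
lemma isBigO_rpow_neg_two_of_norm_le_exp {E : Type*} [NormedAddCommGroup E] {h : ℝ → E} {C κ : ℝ}
    (hκ : 0 < κ) (x : ℝ) (hb : ∀ u, ‖h u‖ ≤ C * Real.exp (-(κ * |x + u|))) :
    h =O[cocompact ℝ] (fun u => |u| ^ (-2 : ℝ)) := by
  have hC : 0 ≤ C := by
    have := (norm_nonneg _).trans (hb 0)
    exact nonneg_of_mul_nonneg_left this (Real.exp_pos _)
  refine Asymptotics.IsBigO.of_bound (C * Real.exp (κ * |x|) * (2 / κ ^ 2)) ?_
  filter_upwards [(isCompact_singleton (x := (0 : ℝ))).compl_mem_cocompact] with u hu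
  have hu' : 0 < |u| := abs_pos.2 hu
  refine (hb u).trans ?_
  have e1 : Real.exp (-(κ * |x + u|)) ≤ Real.exp (κ * |x|) * Real.exp (-(κ * |u|)) := by
    rw [← Real.exp_add]
    apply Real.exp_le_exp.2
    have : |u| ≤ |x + u| + |x| := by
      have := abs_sub (x + u) x
      rwa [add_sub_cancel_left] at this
    nlinarith
  have e2 : Real.exp (-(κ * |u|)) ≤ 2 / κ ^ 2 * |u| ^ (-2 : ℝ) := by
    have h2 : (κ * |u|) ^ 2 / 2 ≤ Real.exp (κ * |u|) := by
      have := Real.quadratic_le_exp_of_nonneg (x := κ * |u|) (by positivity)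
      have : 0 ≤ κ * |u| := by positivity
      linarith
    rw [Real.exp_neg, Real.rpow_neg hu'.le, Real.rpow_two, inv_le_comm₀ (Real.exp_pos _)
      (by positivity)]
    refine le_trans (le_of_eq ?_) h2
    field_simp
  rw [Real.norm_of_nonneg (by positivity)]
  calc C * Real.exp (-(κ * |x + u|)) ≤ C * (Real.exp (κ * |x|) * (2 / κ ^ 2 * |u| ^ (-2 : ℝ))) := by
        gcongr
        exact e1.trans (by gcongr)
    _ = _ := by ring

lemma norm_cexp_of_eq_ofReal_mul_I {z : ℂ} {r : ℝ} (h : z = r * I) : ‖cexp z‖ = 1 := by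
  rw [h, Complex.norm_exp_ofReal_mul_I]

lemma summable_weightTerm {β : ℂ} (hβ : 0 < β.re) {a c : ℝ} (ha : 0 < a) (hc : 0 < c)
    (hac : a + c < 1 / 2) (x y : ℝ) : Summable (fun m : ℤ => weightTerm β a c x y m) := by
  obtain ⟨C, κ, hκ, hb⟩ := exists_norm_psiFun_le hβ hc (sub_pos.2 (by linarith : c < 1 / 2 - a))
    (by linarith)
  have hO := isBigO_rpow_neg_two_of_norm_le_exp (h := fun u => psiFun β c (1 / 2 - a - c) (x + u))
    hκ x fun u => by simpa only [sub_right_comm] using hb.self_of_nhds (x + u)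
  have hs := summable_of_isBigO (Real.summable_abs_int_rpow one_lt_two)
    (hO.comp_tendsto Int.tendsto_coe_cofinite)
  simp only [weightTerm_eq hβ ha hc hac]
  refine Summable.of_norm ?_
  refine (hs.norm.mul_left ‖cexp (-(Real.pi * I / 12))‖).congr fun m => ?_
  rw [norm_mul, norm_mul, norm_cexp_of_eq_ofReal_mul_I (z := I * Real.pi * y * (x + 2 * m))
    (r := Real.pi * y * (x + 2 * m)) (by push_cast; ring), mul_one]
  rfl

lemma cexp_pi_mul_even {k : ℤ} (hk : Even k) : cexp (Real.pi * I * k) = 1 := by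
  obtain ⟨n, rfl⟩ := hk
  rw [← Complex.exp_int_mul_two_pi_mul_I n]
  congr 1
  push_cast
  ring

/-! ### The two symmetries. -/

/-- The symmetry that exchanges `b` and `c`, a termwise consequence of the Fourier
transformation of `ψ_{a,c}`. -/
theorem tetWeight_eq_tetWeightBar_mul_exp {β : ℂ} (hβ : 0 < β.re)
    (hβ' : (starRingEnd ℂ) β = β ∨ (starRingEnd ℂ) β = β⁻¹) {a b c : ℝ} (ha : 0 < a) (hb : 0 < b)
    (hc : 0 < c) (habc : b = 1 / 2 - a - c) (x y : ℝ) :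
    tetWeight β a c x y =
      tetWeightBar β a b (-x) (y - x - 1 / 2) * cexp (Real.pi * I * x / 2) := by
  rw [tetWeight, tetWeightBar, tetWeight, Complex.conj_tsum, ← tsum_mul_right,
    ← (Equiv.neg ℤ).tsum_eq (fun m => (starRingEnd ℂ) (weightTerm β a b (-x) _ m) * _)]
  refine tsum_congr fun m => ?_
  rw [weightTerm_eq hβ ha hc (by linarith), Equiv.neg_apply,
    weightTerm_eq hβ ha hb (by linarith), ← habc,
    show 1 / 2 - a - b = c by linarith, map_mul, map_mul, conj_psiFun hβ hβ' (by linarith)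
      (by linarith), ← Complex.exp_conj, ← Complex.exp_conj]
  -- The Gaussian contributes e^{πim²} and the shift by 1/2 contributes e^{-πim}; their product is 1
  -- by parity.
  have he := cexp_pi_mul_even (Int.even_mul_pred_self m)
  rw [show -(-x + ((-m : ℤ) : ℝ)) = x + m by push_cast; ring]
  simp only [map_neg, map_mul, map_div₀, conj_I, conj_ofReal, map_ofNat, map_add, map_intCast]
  push_cast at he ⊢
  calc _ = psiFun β c b (x + m) * (cexp (-(Real.pi * I / 12)) *
        cexp (I * Real.pi * y * (x + 2 * m)) * cexp (Real.pi * I * (m * (m - 1)))) := by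
        rw [he]; ring
    _ = psiFun β c b (x + m) * (cexp (-(Real.pi * -I / 12)) * cexp (-(Real.pi * I / 6)) *
        cexp (Real.pi * I * (-x + -m) ^ 2) *
        cexp (-I * Real.pi * (y - x - 1 / 2) * (-x + 2 * -m)) * cexp (Real.pi * I * x / 2)) := by
        rw [← Complex.exp_add, ← Complex.exp_add, ← Complex.exp_add, ← Complex.exp_add,
          ← Complex.exp_add, ← Complex.exp_add]
        congr 2
        ring
    _ = _ := by ring

lemma psiTildePrime_eq {β : ℂ} (hβ : 0 < β.re) {a c : ℝ} (ha : 0 < a) (hc : 0 < c)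
    (hac : a + c < 1 / 2) (s : ℝ) :
    psiTildePrime β a c s = cexp (-(Real.pi * I / 12)) * psiFun β c (1 / 2 - a - c) s := by
  have := weightTerm_eq hβ ha hc hac s 0 0
  simpa [weightTerm] using this

/-- Conjugating under the integral and reflecting t brings in e^{πit²} ψ_{c,b}(t), whose Fourier
transform is what Poisson summation needs. -/
lemma conj_psiTildePrime {β : ℂ} (hβ : 0 < β.re)
    (hβ' : (starRingEnd ℂ) β = β ∨ (starRingEnd ℂ) β = β⁻¹) {b c : ℝ} (hb : 0 < b)
    (hc : 0 < c) (hbc : b + c < 1 / 2) (s : ℝ) :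
    (starRingEnd ℂ) (psiTildePrime β b c s) = cexp (-(Real.pi * I / 6)) *
      cexp (Real.pi * I * s ^ 2) * ∫ t : ℝ, cexp (Real.pi * I * t ^ 2) * psiFun β c b t *
        cexp (-2 * Real.pi * I * s * t) := by
  rw [psiTildePrime, psiTilde, map_mul, ← integral_conj, ← integral_const_mul,
    ← integral_const_mul, ← integral_neg_eq_self]
  refine integral_congr_ae (ae_of_all _ fun t => ?_)
  simp only [map_mul, conj_psiFun hβ hβ' (add_pos hb hc).le hbc, ← Complex.exp_conj, neg_neg,
    map_neg, map_pow, conj_I, conj_ofReal, map_ofNat]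
  push_cast
  ring_nf

/-- The symmetry that exchanges `a` and `b`, from Poisson summation. -/
theorem tetWeight_eq_exp_mul_tetWeightBar {β : ℂ} (hβ : 0 < β.re)
    (hβ' : (starRingEnd ℂ) β = β ∨ (starRingEnd ℂ) β = β⁻¹) {a b c : ℝ} (ha : 0 < a) (hb : 0 < b)
    (hc : 0 < c) (habc : b = 1 / 2 - a - c) (x y : ℝ) :
    tetWeight β a c x y = cexp (-(Real.pi * I / 6)) * tetWeightBar β b c (x - y - 1 / 2) (-y) *
      cexp (-(Real.pi * I * y / 2)) := by
  -- At integers the phase e^{-2πiθm} together with e^{πi(x+m)²} reproduces e^{iπy(x+2m)}, up to a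
  -- factor independent of m and e^{πim(m+1)} = 1.
  set θ : ℝ := x - y - 1 / 2 with hθ
  set F : ℝ → ℂ := fun u => cexp (Real.pi * I * (x + u) ^ 2) * psiFun β c b (x + u) *
    cexp (-2 * Real.pi * I * θ * u) with hF
  have hcont : Continuous F := by
    have := continuous_psiFun hβ (a := c) (c := b) (by linarith) (by linarith)
    rw [hF]
    fun_prop
  have hFdecay : F =O[cocompact ℝ] (fun u => |u| ^ (-2 : ℝ)) := by
    obtain ⟨C, κ, hκ, h⟩ := exists_norm_psiFun_le hβ hc hb (by linarith)
    refine isBigO_rpow_neg_two_of_norm_le_exp (C := C) hκ x fun u => ?_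
    rw [hF, norm_mul, norm_mul,
      norm_cexp_of_eq_ofReal_mul_I (z := Real.pi * I * (x + u) ^ 2) (r := Real.pi * (x + u) ^ 2)
        (by push_cast; ring),
      norm_cexp_of_eq_ofReal_mul_I (z := -2 * Real.pi * I * θ * u) (r := -2 * Real.pi * θ * u)
        (by push_cast; ring), one_mul, mul_one]
    exact h.self_of_nhds (x + u)
  have hFF : ∀ k : ℝ, FourierTransform.fourier F k = cexp (2 * Real.pi * I * x * (θ + k)) *
      cexp (Real.pi * I / 6) * cexp (-(Real.pi * I * (θ + k) ^ 2)) *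
        (starRingEnd ℂ) (psiTildePrime β b c (θ + k)) := by
    intro k
    rw [conj_psiTildePrime hβ hβ' hb hc (by linarith), Real.fourier_real_eq_integral_exp_smul,
      ← integral_const_mul, ← integral_const_mul, ← integral_add_left_eq_self _ (-x)]
    refine integral_congr_ae (ae_of_all _ fun t => ?_)
    simp only [hF, smul_eq_mul, add_neg_cancel_left]
    push_cast
    rw [add_neg_cancel_left]
    have e1 : cexp (Real.pi * I / 6) * cexp (-(Real.pi * I / 6)) = 1 := by
      rw [← Complex.exp_add, add_neg_cancel, Complex.exp_zero]
    have e2 : cexp (-(Real.pi * I * (θ + k) ^ 2)) * cexp (Real.pi * I * (θ + k) ^ 2) = 1 := by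
      rw [← Complex.exp_add, neg_add_cancel, Complex.exp_zero]
    have e3 : cexp (-2 * Real.pi * (-x + t) * k * I) * cexp (-2 * Real.pi * I * θ * (-x + t)) =
        cexp (2 * Real.pi * I * x * (θ + k)) * cexp (-2 * Real.pi * I * (θ + k) * t) := by
      rw [← Complex.exp_add, ← Complex.exp_add]
      ring_nf
    calc _ = cexp (Real.pi * I * t ^ 2) * psiFun β c b t *
          (cexp (-2 * Real.pi * (-x + t) * k * I) * cexp (-2 * Real.pi * I * θ * (-x + t))) := by
          ring
      _ = (cexp (Real.pi * I / 6) * cexp (-(Real.pi * I / 6))) *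
          (cexp (-(Real.pi * I * (θ + k) ^ 2)) * cexp (Real.pi * I * (θ + k) ^ 2)) *
          (cexp (Real.pi * I * t ^ 2) * psiFun β c b t * (cexp (2 * Real.pi * I * x * (θ + k)) *
            cexp (-2 * Real.pi * I * (θ + k) * t))) := by
          rw [e1, e2, e3, one_mul, one_mul]
      _ = _ := by ring
  -- Duality again: the transform has the modulus of ψ_{c,a}(θ + k), which decays exponentially.
  have hFFdecay : FourierTransform.fourier F =O[cocompact ℝ] (fun u => |u| ^ (-2 : ℝ)) := by
    obtain ⟨C, κ, hκ, h⟩ := exists_norm_psiFun_le hβ hc ha (by linarith)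
    refine isBigO_rpow_neg_two_of_norm_le_exp (C := C) hκ θ fun k => ?_
    rw [hFF, norm_mul, norm_mul, norm_mul,
      norm_cexp_of_eq_ofReal_mul_I (z := 2 * Real.pi * I * x * (θ + k)) (r := 2 * Real.pi * x * (θ + k))
        (by push_cast; ring),
      norm_cexp_of_eq_ofReal_mul_I (z := Real.pi * I / 6) (r := Real.pi / 6) (by push_cast; ring),
      norm_cexp_of_eq_ofReal_mul_I (z := -(Real.pi * I * (θ + k) ^ 2)) (r := -(Real.pi * (θ + k) ^ 2))
        (by push_cast; ring), one_mul, one_mul, one_mul, RCLike.norm_conj,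
      psiTildePrime_eq hβ hb hc (by linarith), norm_mul,
      norm_cexp_of_eq_ofReal_mul_I (z := -(Real.pi * I / 12)) (r := -(Real.pi / 12))
        (by push_cast; ring), one_mul, show 1 / 2 - b - c = a by linarith]
    exact h.self_of_nhds (θ + k)
  have hP := Real.tsum_eq_tsum_fourier_of_rpow_decay hcont one_lt_two hFdecay hFFdecay 0
  simp only [zero_add] at hP
  have hP' : ∑' m : ℤ, F m = ∑' k : ℤ, FourierTransform.fourier F k := by
    rw [hP]
    refine tsum_congr fun k => ?_
    simp
  have hl : tetWeight β a c x y = cexp (-(Real.pi * I / 12) - Real.pi * I * x ^ 2 +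
      Real.pi * I * x * y) * ∑' m : ℤ, F m := by
    rw [tetWeight, ← tsum_mul_left]
    refine tsum_congr fun m => ?_
    rw [weightTerm_eq hβ ha hc (by linarith), ← habc]
    have he := cexp_pi_mul_even (Int.even_mul_succ_self m)
    push_cast at he
    calc _ = psiFun β c b (x + m) * (cexp (-(Real.pi * I / 12)) *
          cexp (I * Real.pi * y * (x + 2 * m)) * cexp (Real.pi * I * (m * (m + 1)))) := by
          rw [he]; ring
      _ = psiFun β c b (x + m) * (cexp (-(Real.pi * I / 12) - Real.pi * I * x ^ 2 +
          Real.pi * I * x * y) * cexp (Real.pi * I * (x + m) ^ 2) *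
          cexp (-2 * Real.pi * I * θ * m)) := by
          rw [← Complex.exp_add, ← Complex.exp_add, ← Complex.exp_add, ← Complex.exp_add, hθ]
          congr 2
          push_cast
          ring
      _ = _ := by
          simp only [hF, ofReal_intCast]
          ring
  have hr : cexp (-(Real.pi * I / 6)) * tetWeightBar β b c θ (-y) * cexp (-(Real.pi * I * y / 2)) =
      cexp (-(Real.pi * I / 12) - Real.pi * I * x ^ 2 + Real.pi * I * x * y) *
        ∑' k : ℤ, FourierTransform.fourier F k := by
    rw [tetWeightBar, tetWeight, Complex.conj_tsum, ← tsum_mul_left, ← tsum_mul_left,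
      ← tsum_mul_right]
    refine tsum_congr fun k => ?_
    rw [hFF, weightTerm, map_mul, ← Complex.exp_conj]
    have he := cexp_pi_mul_even (Int.even_mul_pred_self k)
    simp only [map_mul, conj_I, conj_ofReal, map_ofNat, map_add, map_intCast]
    push_cast at he ⊢
    calc _ = (starRingEnd ℂ) (psiTildePrime β b c (θ + k)) * (cexp (-(Real.pi * I / 6)) *
          cexp (-I * Real.pi * -y * (θ + 2 * k)) * cexp (-(Real.pi * I * y / 2))) := by ring
      _ = (starRingEnd ℂ) (psiTildePrime β b c (θ + k)) *
          (cexp (-(Real.pi * I / 12) - Real.pi * I * x ^ 2 + Real.pi * I * x * y) *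
          cexp (2 * Real.pi * I * x * (θ + k)) * cexp (Real.pi * I / 6) *
          cexp (-(Real.pi * I * (θ + k) ^ 2)) * cexp (Real.pi * I * (k * (k - 1)))) := by
          rw [← Complex.exp_add, ← Complex.exp_add, ← Complex.exp_add, ← Complex.exp_add,
            ← Complex.exp_add, ← Complex.exp_add, hθ]
          congr 2
          push_cast
          ring
      _ = _ := by
          rw [he]
          ring
  rw [hl, hP', hr]

lemma integrable_dilogIntegrand {β : ℂ} (hβ : 0 < β.re) {a c : ℝ} (hac : 0 ≤ a + c)
    (hac' : a + c < 1 / 2) (t : ℝ) : Integrable (fun u : ℝ =>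
      dilogIntegrand β (t - 2 * dilogConst β * (a + c))
        ((u : ℂ) + (dilogHeight β : ℂ) * I)) := by
  have e : (t : ℂ) - 2 * dilogConst β * (a + c) = t - I * (β + β⁻¹) * (a + c) := by
    rw [dilogConst]; ring
  rw [e]
  exact (admissibleHeight_dilogHeight hβ).integrable (abs_im_dilogArg_lt hβ hac hac' t)

end

theorem lemma2 (ħ : ℝ) (hħ : 0 < ħ) (β : ℂ) (hβ : 0 < β.re)
    (hβħ : (β + β⁻¹) ^ 2 = ((ħ⁻¹ : ℝ) : ℂ))
    (a b c : ℝ) (ha : 0 < a) (hb : 0 < b) (hc : 0 < c) (habc : b = 1 / 2 - a - c) :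
    (∀ t : ℝ, Integrable (fun u : ℝ =>
      dilogIntegrand β (t - 2 * dilogConst β * (a + c))
        ((u : ℂ) + (dilogHeight β : ℂ) * Complex.I))) ∧
    Integrable (fun t : ℝ => psiFun β a c t) ∧
    (∀ x y : ℝ, Summable (fun m : ℤ => weightTerm β a c x y m)) ∧
    (∀ x y : ℝ,
      tetWeight β a c x y =
        tetWeightBar β a b (-x) (y - x - 1 / 2) * Complex.exp (Real.pi * Complex.I * x / 2)) ∧
    (∀ x y : ℝ,
      tetWeight β a c x y =
        Complex.exp (-(Real.pi * Complex.I / 6)) * tetWeightBar β b c (x - y - 1 / 2) (-y) *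
          Complex.exp (-(Real.pi * Complex.I * y / 2))) := by
  have hac : a + c < 1 / 2 := by linarith
  have hβ' := conj_eq_self_or_eq_inv hβ hβħ
  exact ⟨integrable_dilogIntegrand hβ (add_pos ha hc).le hac, integrable_psiFun hβ ha hc hac,
    summable_weightTerm hβ ha hc hac,
    tetWeight_eq_tetWeightBar_mul_exp hβ hβ' ha hb hc habc,
    tetWeight_eq_exp_mul_tetWeightBar hβ hβ' ha hb hc habc⟩
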